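/- **Notation.** For a nonzero integer $D$ let $E_D: y^2=x^3+Dx$ (discriminant $-64D^3$); for a prime $p\nmid 64D^3$ put $a_p=p+1-\#E_D(\mathbb F_p)$, and for $t\in\mathbb Z$ let $\pi_{E_D,t}(N)$ be the number of primes $p\le N$, $p\nmid 64D^3$, with $a_p=t$. We say that *the Lang–Trotter asymptotic holds for $E_D$ and $t$ with constant $C\ge 0$* if $\pi_{E_D,t}(N)=C\frac{\sqrt N}{\log N}+o\big(\frac{\sqrt N}{\log N}\big)$ as $N\to\infty$ and, in case $C=0$, only finitely many primes $p\nmid 64D^3$ have $a_p=t$. **Hardy–Littlewood Conjecture.** Let $a,b,c$ be integers with $a>0$, $\gcd(a,b,c)=1$, $a+b$ and $c$ not both even, and $\Delta=b^2-4ac$ not a square. Then the number of primes less than $n$ of the form $ax^2+bx+c$ ($x=0,1,2,\dots$) is $\sim\delta(a,b,c)\sqrt n/\log n$, where $$\delta(a,b,c)=\frac{\gcd(2,a+b)}{\sqrt a}\prod_{p>2,\;p\mid a,\;p\mid b}\frac p{p-1}\;\prod_{p>2,\;p\nmid a}\Big(1-\frac{(\Delta/p)}{p-1}\Big),$$ the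 infinite product being taken in increasing order of $p$. **The density.** Let $D,r$ be nonzero integers. Let $D_0$ be the integer with the sign of $D$ in which every prime exponent of $D$ is replaced by its residue in $\{0,1,2,3\}$ modulo $4$; let $2^\sigma\,\|\,D_0$. Write $D_0=d\bar d$, where $d>0$ is odd, every prime dividing $d$ divides $r$, and no odd prime dividing $\bar d$ divides $r$. Let $A'$ be the set of primes with exponent $1$ or $3$ in $d$, and $A''$ (resp. $B''$) the set of odd primes with exponent $1$ or $3$ (resp. $2$) in $\bar d$. For an odd prime $l$ put $\tau(l)=l$ if $l\equiv3\pmod 4$, $\tau(l)=l-2$ if $l\equiv1\pmod 4$. For a finite set $S$ of primes let $S_{i,j}$ be the number of $l\in S$ with $l\equiv i$ or $j\pmod 8$. Put $T=\prod_{l\in A''\cup B''}\tau(l)$, $$E_2=\frac{(-1)^{\#A''}}{\prod_{l\in A''}\tau(l)},\qquad F=\frac{(-1)^{A'_{3,5}+A''_{1,7}+\#B''}}{T},\qquad G=\frac{(-1)^{A''_{1,5}+\#B''+\frac{d-1}2}}{T}.$$ Define $a_p(D,2r)$ as follows. * $r$ odd, and $D_0\equiv1\pmod 4$, or $\sigma=2$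 and $D_0/4\equiv3\pmod 4$: $a_p(D,2r)=\frac14(1+E_2+2\varepsilon F)$, where $\varepsilon=1$ if $r\equiv1\pmod 4$ and $\varepsilon=-1$ if $r\equiv3\pmod 4$. * $r$ odd, and $D_0\equiv3\pmod 4$, or $\sigma=2$ and $D_0/4\equiv1\pmod 4$: $a_p(D,2r)=\frac14(1+E_2)$. * $r$ odd and $\sigma\in\{1,3\}$: $a_p(D,2r)=\frac14$. * $r$ even, and $\sigma\in\{0,2\}$ or $4\mid r$: $a_p(D,2r)=\frac14(1-E_2)$. * $r\equiv2\pmod 4$ and $\sigma\in\{1,3\}$: $a_p(D,2r)=\frac14(1+E_2+2\varepsilon\,\varepsilon_\sigma\,\mathrm{sgn}(D)\,G)$, where $\varepsilon=1$ if $r\equiv2\pmod 8$, $\varepsilon=-1$ if $r\equiv6\pmod 8$, $\varepsilon_1=1$, $\varepsilon_3=-1$. **The tables.** We say that $(D,r)$ is in the tables if one of the following holds. * (I) $r$ is odd; $D_0\equiv1\pmod 4$, or $\sigma=2$ and $D_0/4\equiv3\pmod 4$; $|\bar d|\in\{1,3,5,3^3,5^3\}\cup\{4,4\cdot3,4\cdot5,4\cdot3^3,4\cdot5^3\}$;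 and $A'_{3,5}$ is odd if $r\equiv1\pmod 4$, even if $r\equiv3\pmod 4$. * (II) $r$ is even and one of: * $\sigma\in\{0,2\}$ or $4\mid r$, and every odd prime that divides $D$ to an odd power divides $r$ (that is, $A''=\emptyset$); * $\bar d=\pm2$, and either $D_0/2\equiv1\pmod 4$ and $r\equiv6\pmod 8$, or $D_0/2\equiv3\pmod 4$ and $r\equiv2\pmod 8$; * $\bar d=\pm8$, and either $D_0/8\equiv1\pmod 4$ and $r\equiv2\pmod 8$, or $D_0/8\equiv3\pmod 4$ and $r\equiv6\pmod 8$; * $\bar d\in\{2\cdot5,\,2\cdot5^3,\,-2\cdot3,\,-2\cdot3^3,\,-8\cdot5,\,-8\cdot5^3,\,8\cdot3,\,8\cdot3^3\}$, and either $d\equiv1\pmod 4$ and $r\equiv2\pmod 8$, or $d\equiv3\pmod 4$ and $r\equiv6\pmod 8$; * $\bar d\in\{2\cdot3,\,2\cdot3^3,\,-2\cdot5,\,-2\cdot5^3,\,-8\cdot3,\,-8\cdot3^3,\,8\cdot5,\,8\cdot5^3\}$, and either $d\equiv1\pmod 4$ and $r\equiv6\pmod 8$, or $d\equiv3\pmod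 4$ and $r\equiv2\pmod 8$. **Theorem.** (1) Assume the Hardy–Littlewood Conjecture, and let $D$ be a nonzero integer. Then for every nonzero integer $t$ the Lang–Trotter asymptotic holds for $E_D$ and $t$ with some constant $C\ge0$. Moreover, for every nonzero integer $r$: * among the primes $p\le N$ of the form $x^2+r^2$, the proportion of those with $p\nmid 64D^3$ and $a_p=2r$ tends to $a_p(D,2r)$ as $N\to\infty$; * the Lang–Trotter asymptotic holds for $E_D$ and $2r$ with constant $\delta(D,r)=\delta(1,0,r^2)\,a_p(D,2r)$; * if $(D,r)$ is in the tables, then $\delta(D,r)=0$; otherwise $\delta(D,r)>0$ and $\pi_{E_D,2r}(N)\sim\delta(D,r)\sqrt N/\log N$. (2) Conversely (and unconditionally), if for some nonzero integers $D,r$ the Lang–Trotter asymptotic holds for $E_D$ and $2r$ with a positive constant, then the polynomial $x^2+r^2$ represents infinitely many primes. -/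

import Mathlib

open Filter Topology Asymptotics

/-! ### The Hardy–Littlewood conjecture for quadratic polynomials -/

/-- The number of primes less than `x` of the form `a n² + b n + c` with `n = 0, 1, 2, …`. -/
noncomputable def hlPrimeCount (a b c : ℤ) (x : ℝ) : ℕ :=
  {p : ℕ | p.Prime ∧ (p : ℝ) < x ∧ ∃ n : ℕ, (p : ℤ) = a * (n : ℤ) ^ 2 + b * (n : ℤ) + c}.ncard

/-- The partial product, over the primes `2 < p ≤ z` with `p ∤ a`, of `1 - (Δ/p)/(p - 1)`,
where `Δ = b² - 4ac`. -/
noncomputable def hlPartialProduct (a b c : ℤ) (z : ℕ) : ℝ :=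
  ∏ p ∈ (Finset.range (z + 1)).filter (fun p : ℕ => p.Prime ∧ 2 < p ∧ ¬ (p : ℤ) ∣ a),
    (1 - (jacobiSym (b ^ 2 - 4 * a * c) p : ℝ) / ((p : ℝ) - 1))

/-- The Hardy–Littlewood constant `δ(a, b, c)`. The infinite product converges only conditionally:
it is the limit of its partial products taken in increasing order of the primes. -/
noncomputable def hlConst (a b c : ℤ) : ℝ :=
  (Int.gcd 2 (a + b) : ℝ) / Real.sqrt (a : ℝ) *
    (∏ p ∈ (Int.gcd a b).primeFactors.filter (fun p => 2 < p), (p : ℝ) / ((p : ℝ) - 1)) *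
    limUnder atTop (hlPartialProduct a b c)

/-- The Hardy–Littlewood conjecture for all admissible quadratic polynomials `a x² + b x + c`. -/
def HardyLittlewoodConjecture : Prop :=
  ∀ a b c : ℤ, 0 < a → Int.gcd (Int.gcd a b : ℤ) c = 1 → ¬ (Even (a + b) ∧ Even c) →
    ¬ IsSquare (b ^ 2 - 4 * a * c) →
    (fun x : ℝ => (hlPrimeCount a b c x : ℝ)) ~[atTop]
      (fun x : ℝ => hlConst a b c * (Real.sqrt x / Real.log x))

/-! ### Traces of Frobenius and the Lang–Trotter asymptotic -/

/-- `a_p = p + 1 - #W(𝔽_p)`; it is only used for primes `p` not dividing the discriminant. -/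
noncomputable def frobeniusTrace (W : WeierstrassCurve ℤ) (p : ℕ) : ℤ :=
  (p : ℤ) + 1 - (Nat.card (W.map (Int.castRingHom (ZMod p))).toAffine.Point : ℤ)

/-- The primes `p ∤ Δ` with `a_p = t`. -/
def tracePrimes (W : WeierstrassCurve ℤ) (t : ℤ) : Set ℕ :=
  {p : ℕ | p.Prime ∧ ¬ (p : ℤ) ∣ W.Δ ∧ frobeniusTrace W p = t}

/-- `π_{W,t}(x)`: the number of primes `p ≤ x` with `p ∤ Δ` and `a_p = t`. -/
noncomputable def tracePrimeCount (W : WeierstrassCurve ℤ) (t : ℤ) (x : ℝ) : ℕ :=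
  {p : ℕ | p ∈ tracePrimes W t ∧ (p : ℝ) ≤ x}.ncard

/-- The Lang–Trotter asymptotic for `W` and the trace `t`, with the constant `C ≥ 0`. If `C = 0`,
the asymptotic is interpreted to mean that only finitely many primes have `a_p = t`. -/
def LangTrotterAsymptotic (W : WeierstrassCurve ℤ) (t : ℤ) (C : ℝ) : Prop :=
  0 ≤ C ∧
  (fun x : ℝ => (tracePrimeCount W t x : ℝ) - C * (Real.sqrt x / Real.log x)) =o[atTop]
    (fun x : ℝ => Real.sqrt x / Real.log x) ∧
  (C = 0 → (tracePrimes W t).Finite)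

/-- The curve `E_D : y² = x³ + D x`. -/
def curveE (D : ℤ) : WeierstrassCurve ℤ := ⟨0, 0, 0, D, 0⟩

/-! ### The density of `a_p = 2r` among the primes of the form `x² + r²` -/

/-- `Q(r, N)`: the primes `p ≤ N` of the form `r² + x²`. -/
def primesQ (r : ℤ) (N : ℝ) : Set ℕ :=
  {p : ℕ | p.Prime ∧ (p : ℝ) ≤ N ∧ ∃ x : ℤ, (p : ℤ) = r ^ 2 + x ^ 2}

/-- The exponent of `l` in `D`, reduced modulo `4` (`E_D` and `E_{D m⁴}` are isomorphic over `ℚ`,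
so that only these exponents matter). -/
def expMod4 (D : ℤ) (l : ℕ) : ℕ := padicValNat l D.natAbs % 4

/-- The odd prime factors of `D`. -/
def oddPrimeFactors (D : ℤ) : Finset ℕ := D.natAbs.primeFactors.filter (fun l => l ≠ 2)

/-- The positive odd integer `d`: the part of the fourth-power-free part of `D` that is made up of
the odd primes dividing `r`. -/
def dPart (D r : ℤ) : ℤ :=
  ∏ l ∈ (oddPrimeFactors D).filter (fun l : ℕ => (l : ℤ) ∣ r), (l : ℤ) ^ expMod4 D l

/-- The complementary factor `d̄`: the sign, the power of `2`, and the odd primes not dividing `r`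
in the fourth-power-free part of `D`. -/
def dBar (D r : ℤ) : ℤ :=
  D.sign * 2 ^ expMod4 D 2 *
    ∏ l ∈ (oddPrimeFactors D).filter (fun l : ℕ => ¬ (l : ℤ) ∣ r), (l : ℤ) ^ expMod4 D l

/-- The fourth-power-free part `D₀ = d · d̄` of `D`, with the sign of `D`. -/
def fourthFree (D : ℤ) : ℤ :=
  D.sign * 2 ^ expMod4 D 2 * ∏ l ∈ oddPrimeFactors D, (l : ℤ) ^ expMod4 D l

/-- The odd primes dividing both `r` and `D`, with exponent `1` or `3` in `D₀`. -/
def oddExpOn (D r : ℤ) : Finset ℕ :=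
  (oddPrimeFactors D).filter (fun l : ℕ => (l : ℤ) ∣ r ∧ (expMod4 D l = 1 ∨ expMod4 D l = 3))

/-- The odd primes not dividing `r`, with exponent `1` or `3` in `D₀`. -/
def oddExpOff (D r : ℤ) : Finset ℕ :=
  (oddPrimeFactors D).filter (fun l : ℕ => ¬ (l : ℤ) ∣ r ∧ (expMod4 D l = 1 ∨ expMod4 D l = 3))

/-- The odd primes not dividing `r`, with exponent `2` in `D₀`. -/
def twoExpOff (D r : ℤ) : Finset ℕ :=
  (oddPrimeFactors D).filter (fun l : ℕ => ¬ (l : ℤ) ∣ r ∧ expMod4 D l = 2)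

/-- `τ(l) = l` if `l ≡ 3 (mod 4)` and `τ(l) = l - 2` if `l ≡ 1 (mod 4)`, for an odd prime `l`. -/
def tauPrime (l : ℕ) : ℚ := if l % 4 = 3 then (l : ℚ) else (l : ℚ) - 2

/-- The number of `l ∈ s` with `l ≡ i` or `l ≡ j (mod 8)`. -/
def countMod8 (s : Finset ℕ) (i j : ℕ) : ℕ := (s.filter (fun l => l % 8 = i ∨ l % 8 = j)).card

/-- The quadratic term of the density. -/
def quadTerm (D r : ℤ) : ℚ :=
  (-1) ^ (oddExpOff D r).card / ∏ l ∈ oddExpOff D r, tauPrime l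

/-- The denominator of the quartic term of the density. -/
def quartDenom (D r : ℤ) : ℚ :=
  (∏ l ∈ oddExpOff D r, tauPrime l) * ∏ l ∈ twoExpOff D r, tauPrime l

/-- The quartic term of the density for odd `r`. -/
def quartTermOdd (D r : ℤ) : ℚ :=
  (-1) ^ (countMod8 (oddExpOn D r) 3 5 + countMod8 (oddExpOff D r) 1 7 + (twoExpOff D r).card) /
    quartDenom D r

/-- The quartic term of the density for `r ≡ 2 (mod 4)` and `D₀` exactly divisible by `2` or `8`. -/
def quartTermEven (D r : ℤ) : ℚ :=
  (-1) ^ (countMod8 (oddExpOff D r) 1 5 + (twoExpOff D r).card + ((dPart D r - 1) / 2).toNat) /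
    quartDenom D r

/-- For odd `r`, the condition `D₀ ≡ 1 (mod 4)`, or `4 ∥ D₀` and `D₀ / 4 ≡ 3 (mod 4)`. -/
def QuarticCase (D : ℤ) : Prop :=
  fourthFree D % 4 = 1 ∨ (expMod4 D 2 = 2 ∧ fourthFree D / 4 % 4 = 3)

instance (D : ℤ) : Decidable (QuarticCase D) := by unfold QuarticCase; infer_instance

/-- The explicit density `a_p(D, 2r)`. An odd `r` is `α` or `-α` with `α ≡ 1 (mod 4)`, and
`r` with `2 ∥ r` is `β` or `-β` with `β ≡ 2 (mod 8)`; this gives the signs below. -/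
def explicitDensity (D r : ℤ) : ℚ :=
  if Odd r then
    if QuarticCase D then
      1 / 4 * (1 + quadTerm D r + (if r % 4 = 1 then 1 else -1) * (2 * quartTermOdd D r))
    else if Even (expMod4 D 2) then 1 / 4 * (1 + quadTerm D r)
    else 1 / 4
  else
    if Even (expMod4 D 2) ∨ (4 : ℤ) ∣ r then 1 / 4 * (1 - quadTerm D r)
    else
      1 / 4 * (1 + quadTerm D r +
        (if r % 8 = 2 then 1 else -1) * (if expMod4 D 2 = 1 then 1 else -1) * (D.sign : ℚ) *
          (2 * quartTermEven D r))

/-- The Lang–Trotter constant `δ(D, r) = δ(1, 0, r²) · a_p(D, 2r)` of `E_D` and the trace `2r`. -/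
noncomputable def langTrotterConst (D r : ℤ) : ℝ :=
  hlConst 1 0 (r ^ 2) * (explicitDensity D r : ℝ)

/-! ### The list of pairs `(D, r)` with density zero -/

/-- The list for odd `r`. -/
def VanishingOdd (D r : ℤ) : Prop :=
  QuarticCase D ∧
  (dBar D r).natAbs ∈ ({1, 4, 3, 5, 27, 125, 12, 20, 108, 500} : Finset ℕ) ∧
  ((r % 4 = 1 ∧ Odd (countMod8 (oddExpOn D r) 3 5)) ∨
   (r % 4 = 3 ∧ Even (countMod8 (oddExpOn D r) 3 5)))

/-- The list for even `r`. -/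
def VanishingEven (D r : ℤ) : Prop :=
  ((Even (expMod4 D 2) ∨ (4 : ℤ) ∣ r) ∧ oddExpOff D r = ∅) ∨
  ((dBar D r).natAbs = 2 ∧
    ((fourthFree D / 2 % 4 = 1 ∧ r % 8 = 6) ∨ (fourthFree D / 2 % 4 = 3 ∧ r % 8 = 2))) ∨
  ((dBar D r).natAbs = 8 ∧
    ((fourthFree D / 8 % 4 = 1 ∧ r % 8 = 2) ∨ (fourthFree D / 8 % 4 = 3 ∧ r % 8 = 6))) ∨
  (dBar D r ∈ ({10, 250, -6, -54, -40, -1000, 24, 216} : Finset ℤ) ∧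
    ((dPart D r % 4 = 1 ∧ r % 8 = 2) ∨ (dPart D r % 4 = 3 ∧ r % 8 = 6))) ∨
  (dBar D r ∈ ({6, 54, -10, -250, -24, -216, 40, 1000} : Finset ℤ) ∧
    ((dPart D r % 4 = 1 ∧ r % 8 = 6) ∨ (dPart D r % 4 = 3 ∧ r % 8 = 2)))

/-- The pairs `(D, r)` of nonzero integers in the two lists. -/
def InVanishingTables (D r : ℤ) : Prop :=
  (Odd r ∧ VanishingOdd D r) ∨ (Even r ∧ VanishingEven D r)

/-!
The curve `E_D : y² = x³ + D x` has complex multiplication by `ℤ[i]`, and this makes the condition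
`a_p = 2r` a congruence condition. For `p ≡ 3 (mod 4)` the trace is `0`. For `p ≡ 1 (mod 4)` let
`χ` be the quartic residue character of a prime of `ℤ[i]` above `p`; then `a_p` is
`-(w + star w)` with `w = χ(-1) χ(D)³ J(χ, χ²)` (`IsQuarticChar.sum_cubic`), a Gaussian integer of
norm `p`. Hence `a_p = 2r ≠ 0` forces `p = r² + x²`. Since `-J(χ, χ²)` is the primary generator
`u (r + x i)` of the prime of `χ`, where the unit `u` is determined by the class of `r + x i` modulo
`2 + 2i`, the condition becomes `χ(-D) = u` (`IsQuarticChar.frobeniusTrace_eq_iff`).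

The factorization of `-D` into a sign, a power of `2` and signed primes `l* ≡ 1 (mod 4)` turns
`χ(-D)` into a product of symbols that depend on `x` modulo `8` and modulo the odd primes `l ∣ D`.
At an odd prime this is a form of quartic reciprocity (`IsQuarticChar.reciprocity`), which comes
from the `l`-th power of a quartic Gauss sum, computed in characteristic `l`. The symbol at `l` is a
character of the norm-one torus over `𝔽_l` evaluated at `(r + x i)/(r - x i)`, up to a constant; so
its power sums over `x` are given by orthogonality, with one point at infinity removed
(`exists_isLocalSymbol`). By the Chinese remainder theorem the number of residues `x` modulo
`M = 8 ∏ l` for which `p = r² + x²` has `a_p = 2r` is a combination of three products over `l ∣ D`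
(`four_mul_card_goodResidues`), and its quotient by the number of residues prime to `2D` is the
explicit density (`card_goodResidues`).

Thus the primes with `a_p = 2r` are the disjoint union, over the good residues `k`, of the primes of
the form `(M n + k)² + r²`, `n ≥ 0`. The Hardy–Littlewood conjecture applies to each of these
polynomials, and its constant for them is the constant `δ(1, 0, r²)`, divided by the number of
admissible residues (`hlConst_progression`). The product for `δ(1, 0, r²)` converges to a positive
limit because `∑ χ₄(p) / p` converges, which follows from `L(1, χ₄) ≠ 0` as in Mertens' theorem
(`exists_pos_tendsto_hlPartialProduct`). A density zero means that there is no good residue, hence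
no prime with `a_p = 2r` at all; since `τ(l) ≥ 3`, with equality only for `l = 3, 5`, this happens
only for the pairs in the lists (`explicitDensity_eq_zero_iff`).

For the converse it is enough that every prime with `a_p = 2r` has the form `x² + r²`, while a
positive constant makes the number of these primes unbounded.
-/

/-! ### Convergence of the Hardy–Littlewood product for `x² + r²` -/

/-- Abel's inequality: a sum weighted by an antitone nonnegative sequence is bounded by the first
weight times a bound for the unweighted partial sums. -/
theorem abs_sum_mul_le_of_antitone {f z : ℕ → ℝ} {B : ℝ} (hf : Antitone f) (h0 : ∀ n, 0 ≤ f n)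
    (hz : ∀ n, |∑ i ∈ Finset.range n, z i| ≤ B) (n : ℕ) :
    |∑ i ∈ Finset.range n, f i * z i| ≤ f 0 * B := by
  have hB : 0 ≤ B := (abs_nonneg _).trans (hz 0)
  rcases Nat.eq_zero_or_pos n with rfl | hn
  · simpa using mul_nonneg (h0 0) hB
  have key := Finset.sum_range_by_parts f z n
  simp only [smul_eq_mul] at key
  rw [key]
  have h1 : |f (n - 1) * ∑ i ∈ Finset.range n, z i| ≤ f (n - 1) * B := by
    rw [abs_mul, abs_of_nonneg (h0 _)]
    exact mul_le_mul_of_nonneg_left (hz n) (h0 _)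
  have h2 : |∑ i ∈ Finset.range (n - 1), (f (i + 1) - f i) * ∑ j ∈ Finset.range (i + 1), z j|
      ≤ ∑ i ∈ Finset.range (n - 1), (f i - f (i + 1)) * B := by
    refine (Finset.abs_sum_le_sum_abs _ _).trans (Finset.sum_le_sum fun i _ => ?_)
    have := hf (Nat.le_succ i)
    rw [abs_mul, abs_sub_comm, abs_of_nonneg (sub_nonneg.2 this)]
    exact mul_le_mul_of_nonneg_left (hz _) (sub_nonneg.2 this)
  rw [← Finset.sum_mul, Finset.sum_range_sub'] at h2
  calc _ ≤ _ := abs_sub _ _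
    _ ≤ f (n - 1) * B + (f 0 - f (n - 1)) * B := add_le_add h1 h2
    _ = f 0 * B := by ring

/-- The nontrivial Dirichlet character modulo `4`, with real values. -/
noncomputable def realChi (n : ℕ) : ℝ := (ZMod.χ₄ (n : ZMod 4) : ℝ)

theorem realChi_eq (n : ℕ) :
    realChi n = if n % 4 = 1 then 1 else if n % 4 = 3 then -1 else 0 := by
  unfold realChi
  rw [ZMod.χ₄_nat_eq_if_mod_four]
  have : n % 4 < 4 := Nat.mod_lt _ (by norm_num)
  have h2 : n % 2 = n % 4 % 2 := by omega
  rw [h2]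
  interval_cases n % 4 <;> simp

theorem realChi_mul (m n : ℕ) : realChi (m * n) = realChi m * realChi n := by
  unfold realChi
  rw [Nat.cast_mul, map_mul, Int.cast_mul]

theorem abs_realChi_le_one (n : ℕ) : |realChi n| ≤ 1 := by
  rw [realChi_eq]; split_ifs <;> simp

theorem sum_realChi (n : ℕ) :
    ∑ i ∈ Finset.range n, realChi i = if n % 4 = 2 ∨ n % 4 = 3 then 1 else 0 := by
  induction n with
  | zero => simp
  | succ n ih =>
    rw [Finset.sum_range_succ, ih, realChi_eq]
    have : n % 4 < 4 := Nat.mod_lt _ (by norm_num)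
    have h2 : (n + 1) % 4 = (n % 4 + 1) % 4 := by omega
    rw [h2]
    interval_cases n % 4 <;> simp

theorem abs_sum_realChi_shift_le_one (m n : ℕ) :
    |∑ i ∈ Finset.range n, realChi (m + i)| ≤ 1 := by
  have := Finset.sum_range_add_sub_sum_range realChi m n
  rw [← this, sum_realChi, sum_realChi]
  split_ifs <;> simp

/-- Tails of `∑ χ₄(n) f(n)` for antitone `f ≥ 0` are bounded by their first weight. -/
theorem abs_sum_Ico_realChi_le {f : ℕ → ℝ} {m : ℕ} (hf : AntitoneOn f (Set.Ici m))
    (h0 : ∀ n, m ≤ n → 0 ≤ f n) (N : ℕ) :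
    |∑ i ∈ Finset.Ico m N, f i * realChi i| ≤ f m := by
  rw [Finset.sum_Ico_eq_sum_range]
  have := abs_sum_mul_le_of_antitone (f := fun i => f (m + i)) (z := fun i => realChi (m + i))
    (B := 1) (fun i j hij => hf (by simp) (by simp) (by simpa using hij))
    (fun n => h0 _ (by simp)) (abs_sum_realChi_shift_le_one m) (N - m)
  simpa using this

/-- The partial sums of `L(1, χ₄)` converge to a positive limit, with error `O(1/N)`. -/
theorem exists_limit_sum_realChi_div :
    ∃ L : ℝ, 0 < L ∧ ∀ N : ℕ,
      |∑ n ∈ Finset.Ioc 0 N, realChi n / n - L| ≤ 1 / ((N : ℝ) + 1) := by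
  set H : ℕ → ℝ := fun N => ∑ n ∈ Finset.Ioc 0 N, realChi n / n with hH
  have hdiff : ∀ M N : ℕ, M ≤ N → |H N - H M| ≤ 1 / ((M : ℝ) + 1) := by
    intro M N hMN
    have h1 : H N - H M = ∑ n ∈ Finset.Ico (M + 1) (N + 1), (1 / (n : ℝ)) * realChi n := by
      have e : ∀ K : ℕ, Finset.Ioc 0 K = Finset.Ico 1 (K + 1) := fun K => by
        ext; simp; omega
      simp only [hH, e]
      rw [← Finset.sum_Ico_consecutive _ (show 1 ≤ M + 1 by omega) (show M + 1 ≤ N + 1 by omega),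
        add_sub_cancel_left]
      exact Finset.sum_congr rfl fun n _ => by ring
    rw [h1]
    have := abs_sum_Ico_realChi_le (f := fun n : ℕ => 1 / (n : ℝ)) (m := M + 1)
      (fun a ha b hb hab => by
        have : (0 : ℝ) < a := by
          have : 0 < a := lt_of_lt_of_le (Nat.succ_pos M) ha
          exact_mod_cast this
        exact one_div_le_one_div_of_le this (by exact_mod_cast hab))
      (fun n _ => by positivity) (N + 1)
    simpa using this
  have hc : CauchySeq H := by
    refine cauchySeq_of_le_tendsto_0 (fun M : ℕ => 2 * (1 / ((M : ℝ) + 1))) ?_ ?_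
    · intro n m N hn hm
      rw [Real.dist_eq]
      have a1 := hdiff N n hn
      have a2 := hdiff N m hm
      calc |H n - H m| = |(H n - H N) - (H m - H N)| := by ring_nf
        _ ≤ _ := abs_sub _ _
        _ ≤ _ := by linarith
    · simpa using (tendsto_one_div_add_atTop_nhds_zero_nat (𝕜 := ℝ)).const_mul 2
  obtain ⟨L, hL⟩ := cauchySeq_tendsto_of_complete hc
  have hb : ∀ N : ℕ, |H N - L| ≤ 1 / ((N : ℝ) + 1) := by
    intro N
    have : Tendsto (fun K => |H N - H K|) atTop (𝓝 |H N - L|) := (tendsto_const_nhds.sub hL).abs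
    refine le_of_tendsto this ?_
    filter_upwards [eventually_ge_atTop N] with K hK
    rw [abs_sub_comm]; exact hdiff N K hK
  refine ⟨L, ?_, hb⟩
  -- the partial sum `1 - 1/3` exceeds the error bound `1/4` at `N = 3`
  have h3 := hb 3
  have : H 3 = 2 / 3 := by
    simp only [hH]
    rw [show Finset.Ioc 0 3 = {1, 2, 3} from rfl]
    simp [realChi_eq]; norm_num
  rw [this, abs_le] at h3
  push_cast at h3
  linarith [h3.2]

/-- The partial sums of `-L'(1, χ₄)` are bounded. -/
theorem abs_sum_realChi_mul_log_div_le :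
    ∃ B : ℝ, ∀ N : ℕ, |∑ n ∈ Finset.Ioc 0 N, realChi n * (Real.log n / n)| ≤ B := by
  refine ⟨Real.log 3 / 3 + 1, fun N => ?_⟩
  have h3 : 0 ≤ Real.log 3 / 3 := div_nonneg (Real.log_nonneg (by norm_num)) (by norm_num)
  have e : Finset.Ioc 0 N = Finset.Ico 1 (N + 1) := by ext; simp; omega
  rw [e]
  -- `log n / n` decreases only from `e` on, so that the terms before `3` are split off
  have small : ∀ K, K ≤ 3 → ∑ n ∈ Finset.Ico 1 K, realChi n * (Real.log n / n) = 0 := by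
    intro K hK
    refine Finset.sum_eq_zero fun n hn => ?_
    rw [Finset.mem_Ico] at hn
    have : n = 1 ∨ n = 2 := by omega
    rcases this with rfl | rfl
    · simp
    · simp [realChi_eq]
  by_cases hN : N + 1 ≤ 3
  · rw [small _ hN]; simpa using by linarith
  push Not at hN
  rw [← Finset.sum_Ico_consecutive _ (show 1 ≤ 3 by norm_num) hN.le, small 3 le_rfl, zero_add]
  have hexp : Real.exp 1 ≤ 3 := by linarith [Real.exp_one_lt_d9]
  have := abs_sum_Ico_realChi_le (f := fun n : ℕ => Real.log n / (n : ℝ)) (m := 3)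
    (fun a ha b hb hab => by
      have ha' : (3 : ℝ) ≤ a := by exact_mod_cast ha
      have hab' : (a : ℝ) ≤ b := by exact_mod_cast hab
      exact Real.log_div_self_antitoneOn (Set.mem_Ici.2 (hexp.trans ha'))
        (Set.mem_Ici.2 ((hexp.trans ha').trans hab')) hab')
    (fun n hn => div_nonneg (Real.log_natCast_nonneg n) (by positivity)) (N + 1)
  push_cast at this
  calc _ = |∑ i ∈ Finset.Ico 3 (N + 1), Real.log i / i * realChi i| := by
        congr 1; exact Finset.sum_congr rfl fun n _ => by ring
    _ ≤ _ := by linarith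

/-- Mertens' estimate for `χ₄`: since `χ₄ · log = (χ₄ Λ) * χ₄` and `L(1, χ₄) ≠ 0`, the partial sums
of `∑ χ₄(n) Λ(n) / n` are bounded. -/
theorem exists_bound_sum_realChi_vonMangoldt_div :
    ∃ B : ℝ, ∀ N : ℕ,
      |∑ n ∈ Finset.Ioc 0 N, realChi n * ArithmeticFunction.vonMangoldt n / n| ≤ B := by
  obtain ⟨L, hL, hH⟩ := exists_limit_sum_realChi_div
  obtain ⟨B, hB⟩ := abs_sum_realChi_mul_log_div_le
  let f : ArithmeticFunction ℝ :=
    ⟨fun n => realChi n * ArithmeticFunction.vonMangoldt n / n, by simp⟩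
  let g : ArithmeticFunction ℝ := ⟨fun n => realChi n / n, by simp⟩
  have hfg : ∀ n : ℕ, 0 < n → (f * g) n = realChi n * (Real.log n / n) := by
    intro n hn
    rw [ArithmeticFunction.mul_apply, ← ArithmeticFunction.vonMangoldt_sum, Finset.sum_div,
      Finset.mul_sum, ← Nat.sum_divisorsAntidiagonal
        (fun i _ => realChi n * (ArithmeticFunction.vonMangoldt i / (n : ℝ)))]
    refine Finset.sum_congr rfl fun x hx => ?_
    have hx' := (Nat.mem_divisorsAntidiagonal.1 hx).1
    change realChi x.1 * ArithmeticFunction.vonMangoldt x.1 / x.1 * (realChi x.2 / x.2) = _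
    rw [← hx', realChi_mul]
    push_cast
    rw [div_mul_div_comm]; ring
  refine ⟨(B + (Real.log 4 + 4)) / L, fun N => ?_⟩
  rw [le_div_iff₀ hL]
  set S := ∑ n ∈ Finset.Ioc 0 N, realChi n * ArithmeticFunction.vonMangoldt n / n with hS
  have h1 := ArithmeticFunction.sum_Ioc_mul_eq_sum_sum f g N
  have h2 : ∑ n ∈ Finset.Ioc 0 N, (f * g) n =
      ∑ n ∈ Finset.Ioc 0 N, realChi n * (Real.log n / n) :=
    Finset.sum_congr rfl fun n hn => hfg n (Finset.mem_Ioc.1 hn).1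
  have h3 : ∑ n ∈ Finset.Ioc 0 N, f n * ∑ m ∈ Finset.Ioc 0 (N / n), g m - S * L
      = ∑ n ∈ Finset.Ioc 0 N, f n * (∑ m ∈ Finset.Ioc 0 (N / n), realChi m / m - L) := by
    simp only [mul_sub, Finset.sum_sub_distrib, ← Finset.sum_mul]
    rfl
  have h4 : |∑ n ∈ Finset.Ioc 0 N, f n * (∑ m ∈ Finset.Ioc 0 (N / n), realChi m / m - L)|
      ≤ Real.log 4 + 4 := by
    rcases Nat.eq_zero_or_pos N with rfl | hN
    · simpa using by positivity
    have hN' : (0 : ℝ) < N := by exact_mod_cast hN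
    calc _ ≤ ∑ n ∈ Finset.Ioc 0 N, ArithmeticFunction.vonMangoldt n / N := by
          refine (Finset.abs_sum_le_sum_abs _ _).trans (Finset.sum_le_sum fun n hn => ?_)
          have hn0 : 0 < n := (Finset.mem_Ioc.1 hn).1
          have hn' : (0 : ℝ) < n := by exact_mod_cast hn0
          have hΛ : 0 ≤ ArithmeticFunction.vonMangoldt n :=
            ArithmeticFunction.vonMangoldt_nonneg
          rw [abs_mul]
          have hf : |f n| ≤ ArithmeticFunction.vonMangoldt n / n := by
            change |realChi n * ArithmeticFunction.vonMangoldt n / n| ≤ _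
            rw [abs_div, abs_mul, abs_of_nonneg hΛ, abs_of_pos hn']
            gcongr
            exact mul_le_of_le_one_left hΛ (abs_realChi_le_one n)
          -- the error `1 / (N / n + 1)` of the inner sum cancels the denominator `n` of `f n`
          have hq : 1 / (((N / n : ℕ) : ℝ) + 1) ≤ n / N := by
            rw [div_le_div_iff₀ (by positivity) hN', one_mul]
            have : N < (N / n + 1) * n := by
              rw [mul_comm]; exact Nat.lt_mul_div_succ N hn0
            have : N ≤ n * (N / n + 1) := by linarith
            exact_mod_cast this
          calc _ ≤ ArithmeticFunction.vonMangoldt n / n * (n / N) :=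
                mul_le_mul hf ((hH _).trans hq) (abs_nonneg _) (by positivity)
            _ = _ := by field_simp
      _ = Chebyshev.psi N / N := by
          rw [← Finset.sum_div, Chebyshev.psi]; simp
      _ ≤ _ := by
          rw [div_le_iff₀ hN']
          exact Chebyshev.psi_le_const_mul_self hN'.le
  rw [← h3, ← h1, h2] at h4
  have h5 := hB N
  have h6 : |S| * L = |S * L| := by rw [abs_mul, abs_of_pos hL]
  rw [h6]
  rw [abs_le] at *
  constructor <;> linarith [h4.1, h4.2, h5.1, h5.2]

/-- The sum `∑ χ₄(p) / p` over the primes, in increasing order, converges. -/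
theorem exists_tendsto_sum_realChi_prime_div :
    ∃ l : ℝ, Tendsto (fun N : ℕ => ∑ n ∈ Finset.range N,
      if n.Prime then realChi n / n else 0) atTop (𝓝 l) := by
  obtain ⟨B, hB⟩ := exists_bound_sum_realChi_vonMangoldt_div
  set a : ℕ → ℝ := fun n => realChi n * ArithmeticFunction.vonMangoldt n / n with ha
  have hrange : ∀ N : ℕ, |∑ i ∈ Finset.range N, a (i + 2)| ≤ B := by
    intro N
    have : ∑ n ∈ Finset.Ioc 0 (N + 1), a n = ∑ i ∈ Finset.range N, a (i + 2) := by
      rw [show Finset.Ioc 0 (N + 1) = Finset.Ico 1 (N + 2) by ext; simp; omega,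
        Finset.sum_Ico_eq_sum_range, show N + 2 - 1 = N + 1 by omega, Finset.sum_range_succ']
      simp only [ha]
      simp only [add_zero, ArithmeticFunction.vonMangoldt_apply_one, mul_zero, zero_div]
      exact Finset.sum_congr rfl fun i _ => by rw [show 1 + (i + 1) = i + 2 by ring]
    rw [← this]; exact hB _
  have hlog : ∀ n : ℕ, 0 < Real.log ((n : ℝ) + 2) := fun n =>
    Real.log_pos (by linarith [(Nat.cast_nonneg n : (0 : ℝ) ≤ n)])
  have hcs := Antitone.cauchySeq_series_mul_of_tendsto_zero_of_bounded
    (f := fun n : ℕ => 1 / Real.log ((n : ℝ) + 2)) (z := fun i => a (i + 2)) (b := B)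
    (fun m n hmn => one_div_le_one_div_of_le (hlog m)
      (Real.log_le_log (by positivity) (by gcongr)))
    (by
      refine tendsto_const_nhds.div_atTop (Real.tendsto_log_atTop.comp ?_)
      exact tendsto_atTop_add_const_right _ _ tendsto_natCast_atTop_atTop) hrange
  obtain ⟨l₁, hl₁⟩ := cauchySeq_tendsto_of_complete hcs
  simp only [smul_eq_mul] at hl₁
  -- partial summation with the weight `1 / log n`; the proper prime powers contribute an
  -- absolutely convergent sum
  set b : ℕ → ℝ := fun n => 1 / Real.log n * a n with hb
  have hl₂ : Tendsto (fun N : ℕ => ∑ n ∈ Finset.range N, b n) atTop (𝓝 l₁) := by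
    rw [← tendsto_add_atTop_iff_nat 2]
    refine hl₁.congr fun N => ?_
    rw [Finset.sum_range_succ', Finset.sum_range_succ']
    simp only [hb, ha]
    simp
    refine Finset.sum_congr rfl fun i _ => ?_
    rw [show (i : ℝ) + 1 + 1 = i + 2 by ring]
  have hres : ∀ n : ℕ, ArithmeticFunction.vonMangoldt.residueClass (1 : ZMod 1) n =
      ArithmeticFunction.vonMangoldt n := fun n => by
    simp [ArithmeticFunction.vonMangoldt.residueClass, Subsingleton.elim (n : ZMod 1) 1]
  have hsum : Summable fun n : ℕ => if n.Prime then 0 else b n := by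
    have h1 := (ArithmeticFunction.vonMangoldt.summable_residueClass_non_primes_div
      (1 : ZMod 1)).mul_left (1 / Real.log 2)
    refine Summable.of_norm_bounded h1 fun n => ?_
    by_cases hp : n.Prime
    · simp [hp]
    simp only [hp, if_false, hres]
    rcases Nat.lt_or_ge n 2 with hn | hn
    · interval_cases n <;> simp [hb, ha]
    have hn' : (2 : ℝ) ≤ n := by exact_mod_cast hn
    have hl2 : 0 < Real.log 2 := Real.log_pos (by norm_num)
    have hln : Real.log 2 ≤ Real.log n := Real.log_le_log (by norm_num) hn'
    have hΛ : 0 ≤ ArithmeticFunction.vonMangoldt n := ArithmeticFunction.vonMangoldt_nonneg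
    simp only [hb, ha, Real.norm_eq_abs]
    rw [abs_mul, abs_of_pos (by have := hl2.trans_le hln; positivity), abs_div, abs_mul,
      abs_of_nonneg hΛ, abs_of_nonneg (by positivity : (0 : ℝ) ≤ n)]
    gcongr
    exact mul_le_of_le_one_left hΛ (abs_realChi_le_one n)
  refine ⟨l₁ - ∑' n, if n.Prime then 0 else b n, ?_⟩
  refine (hl₂.sub hsum.hasSum.tendsto_sum_nat).congr fun N => ?_
  rw [← Finset.sum_sub_distrib]
  refine Finset.sum_congr rfl fun n _ => ?_
  by_cases hp : n.Prime
  · have : 0 < Real.log n := Real.log_pos (by exact_mod_cast hp.one_lt)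
    simp only [hp, if_true, sub_zero, hb, ha, ArithmeticFunction.vonMangoldt_apply_prime hp]
    field_simp
  · simp [hp]

/-- The Legendre symbol of the discriminant of `x² + r²`. -/
theorem jacobiSym_neg_four_mul_sq {r : ℤ} {p : ℕ} (hp : p.Prime) (h2 : 2 < p) :
    jacobiSym (0 ^ 2 - 4 * 1 * r ^ 2) p = if (p : ℤ) ∣ r then 0 else ZMod.χ₄ p := by
  have hodd : Odd p := hp.odd_of_ne_two h2.ne'
  have e : (0 ^ 2 - 4 * 1 * r ^ 2 : ℤ) = -1 * (2 * r) ^ 2 := by ring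
  have hcop : IsCoprime (p : ℤ) 2 :=
    (Int.isCoprime_iff_gcd_eq_one).2 (by
      have := (Nat.coprime_primes hp Nat.prime_two).2 h2.ne'
      simpa [Int.gcd] using this)
  rw [e, jacobiSym.mul_left]
  split_ifs with h
  · have : jacobiSym ((2 * r) ^ 2) p = 0 := by
      rw [jacobiSym.eq_zero_iff]
      refine ⟨hp.ne_zero, ?_⟩
      have : (p : ℤ) ∣ Int.gcd ((2 * r) ^ 2) p :=
        Int.dvd_coe_gcd (dvd_pow (h.mul_left 2) two_ne_zero) dvd_rfl
      intro h1
      rw [h1] at this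
      exact hp.one_lt.ne' (by exact_mod_cast (Int.natCast_dvd_natCast.1 this) |> Nat.dvd_one.1)
    rw [this, mul_zero]
  · have hc : IsCoprime (2 * r) (p : ℤ) := by
      refine IsCoprime.mul_left hcop.symm ?_
      exact ((Prime.coprime_iff_not_dvd (Nat.prime_iff_prime_int.1 hp)).2 h).symm
    rw [jacobiSym.sq_one' (Int.isCoprime_iff_gcd_eq_one.1 hc), mul_one,
      jacobiSym.at_neg_one hodd]

/-- The partial products of the Hardy–Littlewood constant of `x² + r²` converge to a positive
limit: taking logarithms, this is the convergence of `∑ χ₄(p) / p`. -/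
theorem exists_pos_tendsto_hlPartialProduct {r : ℤ} (hr : r ≠ 0) :
    ∃ L : ℝ, 0 < L ∧ Tendsto (hlPartialProduct 1 0 (r ^ 2)) atTop (𝓝 L) := by
  obtain ⟨l, hl⟩ := exists_tendsto_sum_realChi_prime_div
  set c : ℕ → ℝ := fun p => (jacobiSym (0 ^ 2 - 4 * 1 * r ^ 2) p : ℝ) with hc
  set a : ℕ → ℝ := fun n => if n.Prime ∧ 2 < n then Real.log (1 - c n / ((n : ℝ) - 1)) else 0
    with ha
  have hcabs : ∀ n : ℕ, n.Prime → 2 < n → |c n| ≤ 1 := by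
    intro n hp h2
    simp only [hc]
    rw [jacobiSym_neg_four_mul_sq hp h2]
    split_ifs
    · simp
    · exact abs_realChi_le_one n
  have hpos : ∀ n : ℕ, n.Prime → 2 < n → 0 < 1 - c n / ((n : ℝ) - 1) := by
    intro n hp h2
    have h3 : (3 : ℝ) ≤ n := by exact_mod_cast h2
    have := abs_le.1 (hcabs n hp h2)
    rw [sub_pos, div_lt_one (by linarith)]
    linarith [this.2]
  have hsum : Summable fun n : ℕ => a n + if n.Prime then realChi n / n else 0 := by
    have hO : (fun n : ℕ => a n + if n.Prime then realChi n / n else 0) =O[atTop]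
        (fun n : ℕ => 1 / (n : ℝ) ^ 2) := by
      refine IsBigO.of_bound 12 ?_
      filter_upwards [eventually_gt_atTop (max 3 r.natAbs)] with n hn
      have hn3 : 3 < n := (le_max_left _ _).trans_lt hn
      have hnr : r.natAbs < n := (le_max_right _ _).trans_lt hn
      by_cases hp : n.Prime
      · have hn4 : (4 : ℝ) ≤ n := by exact_mod_cast hn3
        have hndvd : ¬ (n : ℤ) ∣ r := fun h =>
          absurd (Nat.le_of_dvd (Int.natAbs_pos.2 hr) (Int.natCast_dvd.1 h)) (not_le.2 hnr)
        have hcn : c n = realChi n := by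
          simp only [hc]
          rw [jacobiSym_neg_four_mul_sq hp (by omega), if_neg hndvd]
          rfl
        have h2n : 2 < n := by omega
        simp only [ha, hp, h2n, and_self, if_true]
        rw [hcn]
        set χ := realChi n with hχ
        have hχ1 : |χ| ≤ 1 := abs_realChi_le_one n
        set u := χ / ((n : ℝ) - 1) with hu
        have hn1 : (0 : ℝ) < n - 1 := by linarith
        have hu1 : |u| ≤ 1 / ((n : ℝ) - 1) := by
          rw [hu, abs_div, abs_of_pos hn1]; gcongr
        have hu2 : |u| ≤ 1 / 3 := hu1.trans (one_div_le_one_div_of_le (by norm_num) (by linarith))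
        have key := Real.abs_log_sub_add_sum_range_le (x := u) (by linarith) 1
        simp only [Finset.sum_range_one, zero_add, pow_one, Nat.cast_zero, div_one] at key
        have hsq : |u| ^ 2 / (1 - |u|) ≤ 2 * (1 / ((n : ℝ) - 1)) ^ 2 := by
          rw [div_le_iff₀ (by linarith)]
          have h1 : |u| ^ 2 ≤ (1 / ((n : ℝ) - 1)) ^ 2 := pow_le_pow_left₀ (abs_nonneg _) hu1 2
          nlinarith [sq_nonneg (1 / ((n : ℝ) - 1))]
        have hdiff : |χ / n - u| ≤ (1 / ((n : ℝ) - 1)) ^ 2 := by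
          have : χ / n - u = -χ * (1 / (n * ((n : ℝ) - 1))) := by
            rw [hu]; field_simp; ring
          rw [this, abs_mul, abs_neg]
          have h1 : |1 / ((n : ℝ) * (n - 1))| ≤ (1 / ((n : ℝ) - 1)) ^ 2 := by
            rw [abs_of_pos (by positivity), div_pow, one_pow]
            apply one_div_le_one_div_of_le (by positivity)
            nlinarith
          calc _ ≤ 1 * (1 / ((n : ℝ) - 1)) ^ 2 :=
                mul_le_mul hχ1 h1 (abs_nonneg _) zero_le_one
            _ = _ := one_mul _
        have hfin : (1 / ((n : ℝ) - 1)) ^ 2 ≤ 4 * (1 / (n : ℝ) ^ 2) := by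
          rw [div_pow, one_pow, mul_one_div, div_le_div_iff₀ (by positivity) (by positivity)]
          nlinarith
        rw [Real.norm_eq_abs, Real.norm_eq_abs, abs_of_pos (by positivity : 0 < 1 / (n : ℝ) ^ 2)]
        calc |Real.log (1 - u) + χ / n| = |(u + Real.log (1 - u)) + (χ / n - u)| := by ring_nf
          _ ≤ _ := abs_add_le _ _
          _ ≤ 2 * (1 / ((n : ℝ) - 1)) ^ 2 + (1 / ((n : ℝ) - 1)) ^ 2 :=
              add_le_add (key.trans hsq) hdiff
          _ ≤ _ := by linarith
      · simp only [ha, hp]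
        simp
    exact summable_of_isBigO_nat (Real.summable_one_div_nat_pow.2 (by norm_num)) hO
  have hlim := (hsum.hasSum.tendsto_sum_nat.sub hl)
  set S := (∑' n, (a n + if n.Prime then realChi n / n else 0)) - l
  refine ⟨Real.exp S, Real.exp_pos _, ?_⟩
  have hlim' := (Real.continuous_exp.tendsto S).comp hlim
  rw [← tendsto_add_atTop_iff_nat 1] at hlim'
  refine hlim'.congr fun z => ?_
  simp only [Function.comp]
  rw [← Finset.sum_sub_distrib, Real.exp_sum]
  unfold hlPartialProduct
  rw [Finset.prod_filter]
  refine Finset.prod_congr rfl fun n _ => ?_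
  by_cases h : n.Prime ∧ 2 < n
  · have hnd : ¬ ((n : ℤ) ∣ 1) := fun h1 => h.1.one_lt.ne' (by
      have := Int.natCast_dvd_natCast (m := n) (n := 1) |>.1 (by simpa using h1)
      exact Nat.dvd_one.1 this)
    have h' : n.Prime ∧ 2 < n ∧ ¬ (n : ℤ) ∣ 1 := ⟨h.1, h.2, hnd⟩
    rw [if_pos h']
    simp only [ha]
    rw [if_pos h, add_sub_cancel_right, Real.exp_log (hpos n h.1 h.2)]
  · have h' : ¬ (n.Prime ∧ 2 < n ∧ ¬ (n : ℤ) ∣ 1) := fun h' => h ⟨h'.1, h'.2.1⟩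
    rw [if_neg h']
    simp only [ha]
    rw [if_neg h]; simp

/-! ### The Hardy–Littlewood constant of a residue class -/

theorem hlConst_one_zero_sq {r : ℤ} {L : ℝ}
    (hL : Tendsto (hlPartialProduct 1 0 (r ^ 2)) atTop (𝓝 L)) :
    hlConst 1 0 (r ^ 2) = L := by
  unfold hlConst
  rw [hL.limUnder_eq]
  simp

theorem hlConst_one_zero_sq_pos {r : ℤ} (hr : r ≠ 0) : 0 < hlConst 1 0 (r ^ 2) := by
  obtain ⟨L, hL, h⟩ := exists_pos_tendsto_hlPartialProduct hr
  rwa [hlConst_one_zero_sq h]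

/-- The number of residue classes `k` modulo an odd prime `l` with `l ∤ k² + r²`. -/
def admCount (r : ℤ) (l : ℕ) : ℤ := (l : ℤ) - 1 - jacobiSym (0 ^ 2 - 4 * 1 * r ^ 2) l

theorem abs_jacobiSym_le_one (a : ℤ) (b : ℕ) : |(jacobiSym a b : ℝ)| ≤ 1 := by
  rcases jacobiSym.trichotomy a b with h | h | h <;> rw [h] <;> simp

/-- The Hardy–Littlewood constants of the polynomials `(M y + k)² + r²` do not depend on `k`: each
is the constant of `x² + r²` divided by the number of admissible classes modulo `M`. -/
theorem hlConst_progression {r : ℤ} (hr : r ≠ 0) {S : Finset ℕ}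
    (hS : ∀ l ∈ S, l.Prime ∧ 2 < l) {M : ℕ} (hM : M = 8 * ∏ l ∈ S, l) (k : ℕ) :
    hlConst ((M : ℤ) ^ 2) (2 * M * k) ((k : ℤ) ^ 2 + r ^ 2) *
      (4 * ∏ l ∈ S, (admCount r l : ℝ)) = hlConst 1 0 (r ^ 2) := by
  obtain ⟨L, hL, hlim⟩ := exists_pos_tendsto_hlPartialProduct hr
  rw [hlConst_one_zero_sq hlim]
  have hprod0 : 0 < ∏ l ∈ S, l := Finset.prod_pos fun l hl => (hS l hl).1.pos
  have hM0 : 0 < M := by rw [hM]; positivity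
  have hdvd : ∀ p : ℕ, p.Prime → 2 < p → (p ∣ M ↔ p ∈ S) := by
    intro p hp h2
    rw [hM]
    constructor
    · intro h
      rcases (Nat.Prime.dvd_mul hp).1 h with h | h
      · have : p ∣ 2 := hp.dvd_of_dvd_pow (show p ∣ 2 ^ 3 by simpa using h)
        exact absurd (Nat.le_of_dvd two_pos this) (not_le.2 h2)
      · obtain ⟨l, hl, hpl⟩ := (Prime.dvd_finsetProd_iff hp.prime _).1 h
        rwa [(Nat.prime_dvd_prime_iff_eq hp (hS l hl).1).1 hpl]
    · exact fun h => (Finset.dvd_prod_of_mem _ h).mul_left _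
  set c : ℕ → ℝ := fun p => (jacobiSym (0 ^ 2 - 4 * 1 * r ^ 2) p : ℝ) with hc
  have hpos : ∀ n : ℕ, 2 < n → 0 < 1 - c n / ((n : ℝ) - 1) := by
    intro n h2
    have h3 : (3 : ℝ) ≤ n := by exact_mod_cast h2
    have := abs_le.1 (abs_jacobiSym_le_one (0 ^ 2 - 4 * 1 * r ^ 2) n)
    rw [sub_pos, div_lt_one (by linarith)]
    simp only [hc]
    linarith [this.2]
  -- the factors at the primes of `S` are missing from the product for `(M y + k)² + r²`
  set Q := ∏ l ∈ S, (1 - c l / ((l : ℝ) - 1)) with hQ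
  have hQ0 : 0 < Q := Finset.prod_pos fun l hl => hpos l (hS l hl).2
  have hpp : ∀ᶠ z : ℕ in atTop, hlPartialProduct 1 0 (r ^ 2) z / Q =
      hlPartialProduct ((M : ℤ) ^ 2) (2 * M * k) ((k : ℤ) ^ 2 + r ^ 2) z := by
    filter_upwards [eventually_ge_atTop M] with z hz
    rw [div_eq_iff hQ0.ne']
    unfold hlPartialProduct
    rw [← Finset.prod_filter_mul_prod_filter_not _ (fun p => p ∈ S), mul_comm]
    congr 1
    · rw [Finset.filter_filter]
      refine Finset.prod_congr ?_ ?_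
      · ext p
        simp only [Finset.mem_filter, Finset.mem_range]
        refine and_congr_right fun _ => ?_
        constructor
        · rintro ⟨⟨hp, h2, h1⟩, hpS⟩
          refine ⟨hp, h2, fun h => hpS ((hdvd p hp h2).1 ?_)⟩
          exact Int.natCast_dvd_natCast.1 ((Nat.prime_iff_prime_int.1 hp).dvd_of_dvd_pow h)
        · rintro ⟨hp, h2, h1⟩
          refine ⟨⟨hp, h2, ?_⟩, fun hpS => h1 ?_⟩
          · intro h; exact h1 (h.trans (one_dvd _))
          · exact dvd_pow (Int.natCast_dvd_natCast.2 ((hdvd p hp h2).2 hpS)) two_ne_zero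
      · intro p hp
        simp only [Finset.mem_filter, Finset.mem_range] at hp
        obtain ⟨-, hp, h2, h1⟩ := hp
        have e : ((2 * M * k : ℤ) ^ 2 - 4 * (M : ℤ) ^ 2 * ((k : ℤ) ^ 2 + r ^ 2)) =
            (0 ^ 2 - 4 * 1 * r ^ 2) * (M : ℤ) ^ 2 := by ring
        have hcop : IsCoprime (M : ℤ) (p : ℤ) := by
          refine ((Prime.coprime_iff_not_dvd (Nat.prime_iff_prime_int.1 hp)).2 fun h => h1 ?_).symm
          exact dvd_pow h two_ne_zero
        rw [e, jacobiSym.mul_left, jacobiSym.sq_one' (Int.isCoprime_iff_gcd_eq_one.1 hcop),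
          mul_one (jacobiSym _ _)]
    · rw [Finset.filter_filter]
      refine Finset.prod_congr ?_ fun _ _ => rfl
      ext p
      simp only [Finset.mem_filter, Finset.mem_range]
      constructor
      · exact fun h => h.2.2
      · intro h
        obtain ⟨hp, h2⟩ := hS p h
        have := Nat.le_of_dvd hM0 ((hdvd p hp h2).2 h)
        refine ⟨by omega, ⟨hp, h2, fun h1 => hp.one_lt.ne' ?_⟩, h⟩
        exact Nat.dvd_one.1 (Int.natCast_dvd_natCast.1 (by simpa using h1))
  have hlim' : Tendsto (hlPartialProduct ((M : ℤ) ^ 2) (2 * M * k) ((k : ℤ) ^ 2 + r ^ 2)) atTop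
      (𝓝 (L / Q)) := (hlim.div_const Q).congr' hpp
  unfold hlConst
  rw [hlim'.limUnder_eq]
  have hg2 : Int.gcd 2 ((M : ℤ) ^ 2 + 2 * M * k) = 2 := by
    refine Int.natCast_inj.1 (Int.gcd_eq_left (by norm_num) ?_)
    have : (2 : ℤ) ∣ M := by rw [hM]; push_cast; exact ⟨4 * ∏ l ∈ S, (l : ℤ), by ring⟩
    exact dvd_add (dvd_pow this two_ne_zero) ((dvd_mul_right _ _).mul_right _)
  have hsqrt : Real.sqrt (((M : ℤ) ^ 2 : ℤ) : ℝ) = M := by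
    push_cast; exact Real.sqrt_sq (Nat.cast_nonneg M)
  have hpf : (Int.gcd ((M : ℤ) ^ 2) (2 * M * k)).primeFactors.filter (fun p => 2 < p) = S := by
    ext p
    simp only [Finset.mem_filter, Nat.mem_primeFactors]
    have hg : Int.gcd ((M : ℤ) ^ 2) (2 * M * k) ≠ 0 := by
      rw [Ne, Int.gcd_eq_zero_iff]; rintro ⟨h, -⟩
      exact hM0.ne' (by exact_mod_cast pow_eq_zero_iff (two_ne_zero) |>.1 h)
    constructor
    · rintro ⟨⟨hp, h, -⟩, h2⟩
      refine (hdvd p hp h2).1 ?_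
      have h1 : (p : ℤ) ∣ (M : ℤ) ^ 2 :=
        (Int.natCast_dvd_natCast.2 h).trans (Int.gcd_dvd_left _ _)
      exact Int.natCast_dvd_natCast.1 ((Nat.prime_iff_prime_int.1 hp).dvd_of_dvd_pow h1)
    · intro h
      obtain ⟨hp, h2⟩ := hS p h
      have h1 : (p : ℤ) ∣ M := Int.natCast_dvd_natCast.2 ((hdvd p hp h2).2 h)
      refine ⟨⟨hp, ?_, hg⟩, h2⟩
      exact Int.natCast_dvd_natCast.1 (Int.dvd_coe_gcd (dvd_pow h1 two_ne_zero)
        ((h1.mul_left 2).mul_right _))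
  rw [hg2, hsqrt, hpf]
  have hMr : (M : ℝ) = 8 * ∏ l ∈ S, (l : ℝ) := by rw [hM]; push_cast; rfl
  -- `l / (l - 1) · (l - 1 - (Δ/l)) = l · (1 - (Δ/l) / (l - 1))`
  have hterm : (∏ p ∈ S, (p : ℝ) / ((p : ℝ) - 1)) * ∏ l ∈ S, (admCount r l : ℝ) =
      (∏ l ∈ S, (l : ℝ)) * Q := by
    rw [hQ, ← Finset.prod_mul_distrib, ← Finset.prod_mul_distrib]
    refine Finset.prod_congr rfl fun l hl => ?_
    have h3 : (2 : ℝ) < l := by exact_mod_cast (hS l hl).2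
    have : (l : ℝ) - 1 ≠ 0 := by linarith
    simp only [hc, admCount]
    push_cast
    field_simp
  have hPr : (0 : ℝ) < ∏ l ∈ S, (l : ℝ) :=
    Finset.prod_pos fun l hl => Nat.cast_pos.2 (hS l hl).1.pos
  calc _ = (2 / M * 4) * (L / Q) *
        ((∏ p ∈ S, (p : ℝ) / ((p : ℝ) - 1)) * ∏ l ∈ S, (admCount r l : ℝ)) := by
        push_cast; ring
    _ = L := by
        rw [hterm, hMr]; field_simp; norm_num

/-! ### The trace of Frobenius as a character sum -/

theorem curveE_discr (D : ℤ) : (curveE D).Δ = -64 * D ^ 3 := by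
  simp [curveE, WeierstrassCurve.Δ, WeierstrassCurve.b₂, WeierstrassCurve.b₄,
    WeierstrassCurve.b₆, WeierstrassCurve.b₈]
  ring

theorem dvd_curveE_discr_iff {D : ℤ} {p : ℕ} (hp : p.Prime) :
    (p : ℤ) ∣ (curveE D).Δ ↔ (p : ℤ) ∣ 2 * D := by
  have hp' := Nat.prime_iff_prime_int.1 hp
  rw [curveE_discr, show (-64 * D ^ 3 : ℤ) = -((2 ^ 6) * D ^ 3) by ring, dvd_neg,
    hp'.dvd_mul, hp'.dvd_mul, hp'.dvd_pow_iff_dvd (by norm_num), hp'.dvd_pow_iff_dvd (by norm_num)]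

theorem frobeniusTrace_curveE {D : ℤ} {p : ℕ} [Fact p.Prime] (h : ¬ (p : ℤ) ∣ 2 * D) :
    frobeniusTrace (curveE D) p = -∑ x : ZMod p, quadraticChar (ZMod p) (x ^ 3 + D * x) := by
  have hp : p.Prime := Fact.out
  set W := ((curveE D).map (Int.castRingHom (ZMod p))).toAffine with hW
  have hΔ : W.Δ ≠ 0 := by
    rw [hW, WeierstrassCurve.map_Δ]
    intro h0
    exact h ((dvd_curveE_discr_iff hp).1
      ((ZMod.intCast_zmod_eq_zero_iff_dvd _ p).1 (by simpa using h0)))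
  have hE : W.IsElliptic := ⟨hΔ.isUnit⟩
  have h2 : ringChar (ZMod p) ≠ 2 := by
    rw [ZMod.ringChar_zmod_n]
    rintro rfl
    exact h (dvd_mul_right _ _)
  have heq : ∀ x y : ZMod p, W.Equation x y ↔ y ^ 2 = x ^ 3 + D * x := by
    intro x y
    rw [WeierstrassCurve.Affine.equation_iff]
    simp [hW, curveE]
  have hcard : (Nat.card W.Point : ℤ) =
      p + 1 + ∑ x : ZMod p, quadraticChar (ZMod p) (x ^ 3 + D * x) := by
    have e1 : Nat.card W.Point =
        Nat.card (Σ x : ZMod p, {y : ZMod p // y ^ 2 = x ^ 3 + D * x}) + 1 := by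
      rw [Nat.card_congr (WeierstrassCurve.Affine.pointEquiv W)]
      have e2 : {xy : ZMod p × ZMod p // W.Equation xy.1 xy.2} ≃
          Σ x : ZMod p, {y : ZMod p // y ^ 2 = x ^ 3 + D * x} :=
        (Equiv.subtypeEquivRight fun xy : ZMod p × ZMod p => heq xy.1 xy.2).trans
          (Equiv.subtypeProdEquivSigmaSubtype fun x y : ZMod p => y ^ 2 = x ^ 3 + D * x)
      rw [← Nat.card_congr e2]
      exact Finite.card_option
    rw [e1, Nat.card_sigma]
    have e3 : ∀ x : ZMod p, (Nat.card {y : ZMod p // y ^ 2 = x ^ 3 + D * x} : ℤ) =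
        quadraticChar (ZMod p) (x ^ 3 + D * x) + 1 := by
      intro x
      rw [← quadraticChar_card_sqrts h2, Nat.card_eq_fintype_card, Fintype.card_subtype]
      congr 2
      ext; simp
    push_cast
    simp only [e3]
    rw [Finset.sum_add_distrib]
    simp [ZMod.card]
    ring
  unfold frobeniusTrace
  rw [hcard]; ring

theorem frobeniusTrace_curveE_of_mod_four_eq_three {D : ℤ} {p : ℕ} [Fact p.Prime]
    (h : ¬ (p : ℤ) ∣ 2 * D) (h3 : p % 4 = 3) : frobeniusTrace (curveE D) p = 0 := by
  rw [frobeniusTrace_curveE h, neg_eq_zero]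
  have h2 : ringChar (ZMod p) ≠ 2 := by
    rw [ZMod.ringChar_zmod_n]; rintro rfl; omega
  have hneg : quadraticChar (ZMod p) (-1) = -1 := by
    rw [quadraticChar_neg_one h2, ZMod.card, ZMod.χ₄_nat_three_mod_four h3]
  -- the summand is odd
  have e := Equiv.sum_comp (Equiv.neg (ZMod p))
    (fun x => quadraticChar (ZMod p) (x ^ 3 + D * x))
  have e2 : ∀ x : ZMod p, quadraticChar (ZMod p) ((Equiv.neg (ZMod p) x) ^ 3 +
      D * (Equiv.neg (ZMod p) x)) = -quadraticChar (ZMod p) (x ^ 3 + D * x) := by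
    intro x
    rw [Equiv.neg_apply, show (-x) ^ 3 + (D : ZMod p) * -x = -1 * (x ^ 3 + D * x) by ring, map_mul,
      hneg, neg_one_mul]
  simp only [e2, Finset.sum_neg_distrib] at e
  linarith

/-! ### The quartic residue character with values in the Gaussian integers -/

/-- The ring homomorphism `ℤ[i] → R` given by a square root of `-1` in `R`. -/
def gaussLift {R : Type*} [CommRing R] (ι : R) (h : ι * ι = -1) : GaussianInt →+* R :=
  Zsqrtd.lift ⟨ι, by simpa using h⟩

theorem gaussLift_apply {R : Type*} [CommRing R] (ι : R) (h : ι * ι = -1) (z : GaussianInt) :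
    gaussLift ι h z = z.re + z.im * ι := rfl

/-- The imaginary unit of `ℤ[i]`. -/
def gaussI : GaussianInt := ⟨0, 1⟩

theorem gaussI_sq : gaussI ^ 2 = -1 := by rw [sq]; rfl

theorem gaussI_pow_four : gaussI ^ 4 = 1 := by
  rw [show 4 = 2 * 2 by rfl, pow_mul, gaussI_sq]; rfl

theorem gaussLift_gaussI {R : Type*} [CommRing R] (ι : R) (h : ι * ι = -1) :
    gaussLift ι h gaussI = ι := by
  rw [gaussLift_apply]; simp [gaussI]

theorem gaussian_norm_eq (z : GaussianInt) : z.norm = z.re ^ 2 + z.im ^ 2 := by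
  rw [Zsqrtd.norm_def]; ring

theorem gaussian_norm_eq_one_of_pow_four {z : GaussianInt} (h : z ^ 4 = 1) : z.norm = 1 := by
  have h1 : z.norm ^ 4 = 1 := by
    have := congrArg (Zsqrtd.normMonoidHom (d := -1)) h
    rw [map_pow, map_one] at this
    exact this
  have h0 := GaussianInt.norm_nonneg z
  exact (pow_eq_one_iff_of_nonneg h0 (by norm_num)).1 h1

theorem gaussian_pow_four_cases {z : GaussianInt} (h : z ^ 4 = 1) :
    z = 1 ∨ z = gaussI ∨ z = -1 ∨ z = -gaussI := by
  have h1 := gaussian_norm_eq_one_of_pow_four h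
  rw [gaussian_norm_eq] at h1
  obtain ⟨a, b⟩ := z
  simp only at h1
  have ha : -1 ≤ a ∧ a ≤ 1 := by constructor <;> nlinarith [sq_nonneg b]
  have hb : -1 ≤ b ∧ b ≤ 1 := by constructor <;> nlinarith [sq_nonneg a]
  obtain ⟨ha1, ha2⟩ := ha
  obtain ⟨hb1, hb2⟩ := hb
  interval_cases a <;> interval_cases b <;> first | (exfalso; revert h1; decide) | decide

theorem gaussian_star_eq_pow_three {z : GaussianInt} (h : z ^ 4 = 1) : star z = z ^ 3 := by
  rcases gaussian_pow_four_cases h with rfl | rfl | rfl | rfl <;> decide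

/-- For `ι² = -1` in `𝔽_p`, `p ≡ 1 (mod 4)`, the multiplicative character `χ : 𝔽_p → ℤ[i]` is the
quartic residue character of the prime ideal `ker (ℤ[i] → 𝔽_p, i ↦ ι)`. -/
structure IsQuarticChar {p : ℕ} [Fact p.Prime] (ι : ZMod p) (hι : ι * ι = -1)
    (χ : MulChar (ZMod p) GaussianInt) : Prop where
  lift_apply : ∀ a, gaussLift ι hι (χ a) = a ^ ((p - 1) / 4)
  pow_four : ∀ a, a ≠ 0 → χ a ^ 4 = 1

theorem exists_isQuarticChar {p : ℕ} [Fact p.Prime] (hp : p % 4 = 1) (ι : ZMod p)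
    (hι : ι * ι = -1) : ∃ χ, IsQuarticChar ι hι χ := by
  have hp2 : 5 ≤ p := by
    have := (Fact.out : p.Prime).two_le
    by_contra h; interval_cases p <;> omega
  obtain ⟨g, hg⟩ := IsCyclic.exists_generator (α := (ZMod p)ˣ)
  set m := (p - 1) / 4 with hm
  have hpm : p - 1 = 4 * m := by omega
  have hcard : Fintype.card (ZMod p)ˣ = 4 * m := by rw [ZMod.card_units p, hpm]
  have horder : orderOf g = 4 * m := by
    rw [orderOf_eq_card_of_forall_mem_zpowers hg, Nat.card_eq_fintype_card, hcard]
  have hne : (1 : ZMod p) ≠ -1 := by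
    have : Fact (2 < p) := ⟨by omega⟩
    exact (ZMod.neg_one_ne_one).symm
  have hg2 : (g : ZMod p) ^ (2 * m) = -1 := by
    have h4 : (g : ZMod p) ^ (4 * m) = 1 := by
      rw [← horder, ← Units.val_pow_eq_pow_val, pow_orderOf_eq_one, Units.val_one]
    have h2 : (g : ZMod p) ^ (2 * m) ≠ 1 := by
      intro h
      have h' : g ^ (2 * m) = 1 := Units.ext (by simpa using h)
      have := Nat.le_of_dvd (by omega) (orderOf_dvd_of_pow_eq_one h')
      omega
    have h3 : ((g : ZMod p) ^ (2 * m)) ^ 2 = 1 := by rw [← pow_mul, ← h4]; congr 1; ring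
    exact (sq_eq_one_iff.1 h3).resolve_left h2
  have hcases : (g : ZMod p) ^ m = ι ∨ (g : ZMod p) ^ m = -ι := by
    refine sq_eq_sq_iff_eq_or_eq_neg.1 ?_
    rw [← pow_mul, mul_comm m 2, hg2, sq, hι]
  obtain ⟨z, hz4, hz⟩ : ∃ z : GaussianInt, z ^ 4 = 1 ∧ gaussLift ι hι z = (g : ZMod p) ^ m := by
    rcases hcases with h | h
    · exact ⟨gaussI, gaussI_pow_four, by rw [h, gaussLift_gaussI]⟩
    · exact ⟨-gaussI, by rw [Even.neg_pow (by decide)]; exact gaussI_pow_four,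
        by rw [h, map_neg, gaussLift_gaussI]⟩
  set ζ : GaussianIntˣ := Units.ofPowEqOne z 4 hz4 (by norm_num) with hζ
  have hζ4 : ζ ^ 4 = 1 := Units.pow_ofPowEqOne _ _
  have hζmem : ζ ∈ rootsOfUnity (Fintype.card (ZMod p)ˣ) GaussianInt := by
    rw [mem_rootsOfUnity, hcard, pow_mul, hζ4, one_pow]
  refine ⟨MulChar.ofRootOfUnity hζmem hg, ?_, ?_⟩
  · intro a
    rcases eq_or_ne a 0 with rfl | ha
    · rw [MulChar.map_zero, map_zero, zero_pow (by omega)]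
    · obtain ⟨k, hk⟩ := (Submonoid.mem_powers_iff _ _).1
        (mem_powers_iff_mem_zpowers.2 (hg (Units.mk0 a ha)))
      have : a = (g : ZMod p) ^ k := by
        rw [← Units.val_pow_eq_pow_val, hk, Units.val_mk0]
      rw [this, map_pow, MulChar.ofRootOfUnity_spec hζmem hg, map_pow]
      change (gaussLift ι hι z) ^ k = _
      rw [hz, ← pow_mul, ← pow_mul, mul_comm]
  · intro a ha
    obtain ⟨k, hk⟩ := (Submonoid.mem_powers_iff _ _).1
        (mem_powers_iff_mem_zpowers.2 (hg (Units.mk0 a ha)))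
    have : a = (g : ZMod p) ^ k := by
      rw [← Units.val_pow_eq_pow_val, hk, Units.val_mk0]
    rw [this, map_pow, MulChar.ofRootOfUnity_spec hζmem hg]
    change (z ^ k) ^ 4 = 1
    rw [← pow_mul, mul_comm, pow_mul, hz4, one_pow]

namespace IsQuarticChar

variable {p : ℕ} [Fact p.Prime] {ι : ZMod p} {hι : ι * ι = -1} {χ : MulChar (ZMod p) GaussianInt}

theorem sq_eq_quadraticChar (h : IsQuarticChar ι hι χ) (hp : p % 4 = 1) (a : ZMod p) :
    (χ ^ 2) a = (quadraticChar (ZMod p) a : GaussianInt) := by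
  have hp2 : 5 ≤ p := by
    have := (Fact.out : p.Prime).two_le
    by_contra h; interval_cases p <;> omega
  rw [MulChar.pow_apply' _ two_ne_zero]
  rcases eq_or_ne a 0 with rfl | ha
  · rw [MulChar.map_zero, MulChar.map_zero]; simp
  have hne : (1 : ZMod p) ≠ -1 := by
    have : Fact (2 < p) := ⟨by omega⟩
    exact (ZMod.neg_one_ne_one).symm
  have hring : ringChar (ZMod p) ≠ 2 := by rw [ZMod.ringChar_zmod_n]; omega
  have h1 : (gaussLift ι hι (χ a)) ^ 2 = (quadraticChar (ZMod p) a : ZMod p) := by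
    rw [quadraticChar_eq_pow_of_char_ne_two' hring, h.lift_apply, ← pow_mul, ZMod.card]
    congr 1; omega
  have h2 : χ a ^ 2 = 1 ∨ χ a ^ 2 = -1 := by
    have := h.pow_four a ha
    rw [show 4 = 2 * 2 by rfl, pow_mul] at this
    exact sq_eq_one_iff.1 this
  rw [← map_pow] at h1
  rcases h2 with h2 | h2 <;> rcases quadraticChar_dichotomy ha with h3 | h3 <;>
    rw [h2, h3] at h1 ⊢ <;> simp at h1 ⊢
  · exact (hne h1).elim
  · exact (hne h1.symm).elim

theorem pow_ne_one (h : IsQuarticChar ι hι χ) (hp : p % 4 = 1) :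
    χ ≠ 1 ∧ χ ^ 2 ≠ 1 ∧ χ ^ 3 ≠ 1 := by
  have hp2 : 5 ≤ p := by
    have := (Fact.out : p.Prime).two_le
    by_contra h; interval_cases p <;> omega
  have hring : ringChar (ZMod p) ≠ 2 := by rw [ZMod.ringChar_zmod_n]; omega
  obtain ⟨a, ha⟩ := quadraticChar_exists_neg_one hring
  have ha0 : a ≠ 0 := by rintro rfl; simp at ha
  have h2 := h.sq_eq_quadraticChar hp a
  rw [ha] at h2
  have hone : ((-1 : ℤ) : GaussianInt) ≠ 1 := by decide
  have h2' : χ ^ 2 ≠ 1 := by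
    intro h1
    rw [h1, MulChar.one_apply ha0.isUnit] at h2
    exact hone h2.symm
  refine ⟨fun h1 => h2' (by rw [h1, one_pow]), h2', fun h3 => h2' ?_⟩
  have h4 : χ a ^ 4 = 1 := h.pow_four a ha0
  have h5 : (χ ^ 3) a = 1 := by rw [h3, MulChar.one_apply ha0.isUnit]
  rw [MulChar.pow_apply' _ (by norm_num)] at h5
  have h6 : χ a = 1 := by rw [pow_succ, h5, one_mul] at h4; exact h4
  rw [MulChar.pow_apply' _ (by norm_num), h6, one_pow] at h2
  exact absurd h2.symm hone

theorem star_apply (h : IsQuarticChar ι hι χ) (a : ZMod p) : star (χ a) = (χ ^ 3) a := by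
  rw [MulChar.pow_apply' _ (by norm_num)]
  rcases eq_or_ne a 0 with rfl | ha
  · rw [MulChar.map_zero, star_zero, zero_pow (by norm_num)]
  · exact gaussian_star_eq_pow_three (h.pow_four a ha)

/-- The conjugate of the Jacobi sum `J(χ, χ²)` is `J(χ³, χ²)`. -/
theorem star_jacobiSum (h : IsQuarticChar ι hι χ) (hp : p % 4 = 1) :
    star (jacobiSum χ (χ ^ 2)) = jacobiSum (χ ^ 3) (χ ^ 2) := by
  unfold jacobiSum
  rw [star_sum]
  refine Finset.sum_congr rfl fun a _ => ?_
  rw [star_mul', h.star_apply, h.sq_eq_quadraticChar hp]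
  congr 1

theorem pow_four_eq_one (h : IsQuarticChar ι hι χ) : χ ^ 4 = 1 := by
  refine MulChar.ext fun a => ?_
  rw [MulChar.pow_apply_coe, h.pow_four _ a.ne_zero, MulChar.one_apply_coe]

theorem jacobiSum_mul_star (h : IsQuarticChar ι hι χ) (hp : p % 4 = 1) :
    jacobiSum χ (χ ^ 2) * star (jacobiSum χ (χ ^ 2)) = (p : GaussianInt) := by
  obtain ⟨h1, h2, h3⟩ := h.pow_ne_one hp
  have hinj := GaussianInt.toComplex_injective
  set c := GaussianInt.toComplex
  have e2 : (χ ^ 2).ringHomComp c = (χ.ringHomComp c) ^ 2 := by rw [MulChar.ringHomComp_pow]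
  have hc : ∀ {ψ : MulChar (ZMod p) GaussianInt}, ψ ≠ 1 → ψ.ringHomComp c ≠ 1 :=
    fun hψ => (MulChar.ringHomComp_ne_one_iff hinj).2 hψ
  have key := jacobiSum_mul_jacobiSum_inv (F' := ℂ) (χ := χ.ringHomComp c)
    (φ := (χ ^ 2).ringHomComp c)
    (by rw [ZMod.ringChar_zmod_n, ringChar.eq_zero]; exact (Fact.out : p.Prime).ne_zero.symm)
    (hc h1) (hc h2) (by rw [← MulChar.ringHomComp_mul, ← pow_succ']; exact hc h3)
  have i1 : (χ.ringHomComp c)⁻¹ = (χ ^ 3).ringHomComp c := by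
    rw [inv_eq_iff_mul_eq_one, ← MulChar.ringHomComp_mul, ← pow_succ', h.pow_four_eq_one,
      MulChar.ringHomComp_one]
  have i2 : ((χ ^ 2).ringHomComp c)⁻¹ = (χ ^ 2).ringHomComp c := by
    rw [inv_eq_iff_mul_eq_one, ← MulChar.ringHomComp_mul, ← pow_add, h.pow_four_eq_one,
      MulChar.ringHomComp_one]
  rw [i1, i2, jacobiSum_ringHomComp, jacobiSum_ringHomComp, ← map_mul, ZMod.card] at key
  rw [h.star_jacobiSum hp]
  apply hinj
  rw [key]; simp [c]

/-- The Jacobi sum `J(χ, χ²)` lies in the prime ideal attached to `χ`. -/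
theorem lift_jacobiSum (h : IsQuarticChar ι hι χ) (hp : p % 4 = 1) :
    gaussLift ι hι (jacobiSum χ (χ ^ 2)) = 0 := by
  have hp2 : 5 ≤ p := by
    have := (Fact.out : p.Prime).two_le
    by_contra h; interval_cases p <;> omega
  set m := (p - 1) / 4 with hm
  have e : gaussLift ι hι (jacobiSum χ (χ ^ 2)) =
      ∑ v : ZMod p, ∑ k ∈ Finset.range (2 * m + 1),
        (-1) ^ k * ((2 * m).choose k : ZMod p) * v ^ (m + k) := by
    unfold jacobiSum
    rw [map_sum]
    refine Finset.sum_congr rfl fun v _ => ?_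
    rw [map_mul, MulChar.pow_apply' _ two_ne_zero, map_pow, h.lift_apply, h.lift_apply, ← pow_mul,
      mul_comm _ 2, show (1 - v) = -v + 1 by ring, add_pow, Finset.mul_sum]
    refine Finset.sum_congr rfl fun k _ => ?_
    rw [neg_pow, one_pow, pow_add]; ring
  rw [e, Finset.sum_comm]
  refine Finset.sum_eq_zero fun k hk => ?_
  rw [← Finset.mul_sum, FiniteField.sum_pow_lt_card_sub_one, mul_zero]
  rw [ZMod.card]
  have := Finset.mem_range.1 hk
  omega

/-- The Jacobi sum `J(χ, χ²)` is congruent to `-1` modulo `2 + 2i`, because in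
`∑ (χ(v) - 1)(χ²(1 - v) - 1)` the first factors are divisible by `1 + i` and the second ones by `2`,
except for `v = 0, 1` where the product vanishes. -/
theorem jacobiSum_congr (h : IsQuarticChar ι hι χ) (hp : p % 4 = 1) :
    (⟨2, 2⟩ : GaussianInt) ∣ jacobiSum χ (χ ^ 2) + 1 := by
  obtain ⟨h1, h2, h3⟩ := h.pow_ne_one hp
  have e : jacobiSum χ (χ ^ 2) =
      ∑ v : ZMod p, (χ v - 1) * ((χ ^ 2) (1 - v) - 1) - p := by
    have s1 : ∑ v : ZMod p, χ v = 0 := MulChar.sum_eq_zero_of_ne_one h1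
    have s2 : ∑ v : ZMod p, (χ ^ 2) (1 - v) = 0 :=
      (Equiv.sum_comp (Equiv.subLeft (1 : ZMod p)) (fun v => (χ ^ 2) v)).trans
        (MulChar.sum_eq_zero_of_ne_one h2)
    have : ∀ v : ZMod p, (χ v - 1) * ((χ ^ 2) (1 - v) - 1) =
        χ v * (χ ^ 2) (1 - v) - χ v - (χ ^ 2) (1 - v) + 1 := fun v => by ring
    simp only [this]
    rw [Finset.sum_add_distrib, Finset.sum_sub_distrib, Finset.sum_sub_distrib, s1, s2]
    simp [jacobiSum, ZMod.card]
  have hp4 : (⟨2, 2⟩ : GaussianInt) ∣ 1 - (p : GaussianInt) := by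
    have h4 : (⟨2, 2⟩ : GaussianInt) ∣ 4 := ⟨⟨1, -1⟩, by decide⟩
    obtain ⟨k, hk⟩ : ∃ k, p = 4 * k + 1 := ⟨p / 4, by omega⟩
    refine h4.trans ⟨-(k : GaussianInt), ?_⟩
    rw [hk]; push_cast; ring
  rw [e, sub_add_eq_add_sub, add_sub_assoc]
  refine dvd_add (Finset.dvd_sum fun v _ => ?_) hp4
  rw [show (⟨2, 2⟩ : GaussianInt) = ⟨1, 1⟩ * 2 by decide]
  rcases eq_or_ne v 0 with rfl | hv
  · simp
  rcases eq_or_ne v 1 with rfl | hv1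
  · simp
  refine mul_dvd_mul ?_ ?_
  · rcases gaussian_pow_four_cases (h.pow_four v hv) with h | h | h | h <;> rw [h]
    · exact ⟨0, by decide⟩
    · exact ⟨gaussI, by decide⟩
    · exact ⟨⟨-1, 1⟩, by decide⟩
    · exact ⟨-1, by decide⟩
  · rw [h.sq_eq_quadraticChar hp]
    rcases quadraticChar_dichotomy (sub_ne_zero.2 hv1.symm) with h | h <;> rw [h]
    · simp
    · exact ⟨-1, by decide⟩

end IsQuarticChar

/-- A sum of values at squares, as a sum weighted by the quadratic character. -/
theorem sum_comp_sq {p : ℕ} [Fact p.Prime] (h2 : p ≠ 2) {R : Type*} [CommRing R]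
    (f : ZMod p → R) :
    ∑ x : ZMod p, f (x ^ 2) = ∑ u : ZMod p, (1 + (quadraticChar (ZMod p) u : R)) * f u := by
  have hring : ringChar (ZMod p) ≠ 2 := by rwa [ZMod.ringChar_zmod_n]
  rw [← Finset.sum_fiberwise (s := Finset.univ) (g := fun x : ZMod p => x ^ 2)]
  refine Finset.sum_congr rfl fun u _ => ?_
  have h3 : ∑ x ∈ Finset.univ.filter (fun x : ZMod p => x ^ 2 = u), f (x ^ 2) =
      ∑ x ∈ Finset.univ.filter (fun x : ZMod p => x ^ 2 = u), f u :=
    Finset.sum_congr rfl fun x hx => by rw [(Finset.mem_filter.1 hx).2]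
  rw [h3, Finset.sum_const, nsmul_eq_mul]
  congr 1
  have h4 := quadraticChar_card_sqrts hring u
  have h5 : {x : ZMod p | x ^ 2 = u}.toFinset =
      Finset.univ.filter (fun x : ZMod p => x ^ 2 = u) := by ext; simp
  rw [h5] at h4
  have h6 := congrArg (Int.cast (R := R)) h4
  push_cast at h6
  rw [h6, add_comm]

namespace IsQuarticChar

variable {p : ℕ} [Fact p.Prime] {ι : ZMod p} {hι : ι * ι = -1} {χ : MulChar (ZMod p) GaussianInt}

theorem apply_neg_one_sq (χ : MulChar (ZMod p) GaussianInt) : χ (-1) ^ 2 = 1 := by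
  rw [← map_pow]; simp

/-- The character sum of `x³ + D x` in terms of the Jacobi sum `J(χ, χ²)`: write the summand as
`χ(x²) χ²(x² + D)`, sum over `u = x²`, and substitute `u = -D v`. -/
theorem sum_cubic (h : IsQuarticChar ι hι χ) (hp : p % 4 = 1) {D : ZMod p} (hD : D ≠ 0) :
    ((∑ x : ZMod p, quadraticChar (ZMod p) (x ^ 3 + D * x) : ℤ) : GaussianInt) =
      χ (-1) * χ D ^ 3 * jacobiSum χ (χ ^ 2) + star (χ (-1) * χ D ^ 3 * jacobiSum χ (χ ^ 2)) := by
  have hp2 : p ≠ 2 := by rintro rfl; omega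
  push_cast
  have e1 : ∀ x : ZMod p, (quadraticChar (ZMod p) (x ^ 3 + D * x) : GaussianInt) =
      (fun u => χ u * (χ ^ 2) (u + D)) (x ^ 2) := by
    intro x
    simp only
    rw [← h.sq_eq_quadraticChar hp, show x ^ 3 + D * x = x * (x ^ 2 + D) by ring, map_mul,
      MulChar.pow_apply' _ two_ne_zero, MulChar.pow_apply' _ two_ne_zero, map_pow]
  rw [Finset.sum_congr rfl fun x _ => e1 x,
    sum_comp_sq hp2 (fun u => χ u * (χ ^ 2) (u + D))]
  simp only [← h.sq_eq_quadraticChar hp]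
  have e2 : ∀ u : ZMod p, (1 + (χ ^ 2) u) * (χ u * (χ ^ 2) (u + D)) =
      χ u * (χ ^ 2) (u + D) + (χ ^ 3) u * (χ ^ 2) (u + D) := by
    intro u
    rw [MulChar.pow_apply' _ (show 3 ≠ 0 by norm_num), MulChar.pow_apply' (n := 2) _ two_ne_zero u]
    ring
  simp only [e2]
  rw [Finset.sum_add_distrib]
  have hD' : -D ≠ 0 := neg_ne_zero.2 hD
  have e3 : ∀ ψ : MulChar (ZMod p) GaussianInt, ∑ u : ZMod p, ψ u * (χ ^ 2) (u + D) =
      ψ (-D) * (χ ^ 2) D * jacobiSum ψ (χ ^ 2) := by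
    intro ψ
    rw [← Equiv.sum_comp (Equiv.mulLeft₀ (-D) hD'), jacobiSum, Finset.mul_sum]
    refine Finset.sum_congr rfl fun v _ => ?_
    change ψ (-D * v) * (χ ^ 2) (-D * v + D) = _
    rw [show -D * v + D = D * (1 - v) by ring, map_mul, map_mul]
    ring
  rw [e3, e3, ← h.star_jacobiSum hp, star_mul', star_mul', h.star_apply, star_pow, h.star_apply,
    ← neg_one_mul D, map_mul, map_mul]
  have f1 := h.pow_four D hD
  have f2 := apply_neg_one_sq χ
  rw [MulChar.pow_apply' _ (show 3 ≠ 0 by norm_num), MulChar.pow_apply' _ (show 3 ≠ 0 by norm_num),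
    MulChar.pow_apply' _ two_ne_zero]
  set w := χ D
  have f3 : (w ^ 3) ^ 3 = w ^ 3 * w ^ 2 := by
    calc (w ^ 3) ^ 3 = w ^ 3 * w ^ 2 * w ^ 4 := by ring
      _ = _ := by rw [f1, mul_one]
  rw [f3]; ring

end IsQuarticChar

/-! ### The condition `a_p = 2r` as a condition on the quartic symbol of `-D` -/

/-- Two Gaussian integers of norm `p` in the same prime ideal are associated. -/
theorem exists_unit_of_lift_eq_zero {p : ℕ} [Fact p.Prime] {ι : ZMod p} {hι : ι * ι = -1}
    {z w : GaussianInt} (hz : gaussLift ι hι z = 0) (hw : gaussLift ι hι w = 0)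
    (hzn : z * star z = p) (hwn : w * star w = p) : ∃ u : GaussianInt, u ^ 4 = 1 ∧ z = u * w := by
  have hp0 : (p : GaussianInt) ≠ 0 := Nat.cast_ne_zero.2 (Fact.out : p.Prime).ne_zero
  rw [gaussLift_apply] at hz hw
  have hz' : (z.re : ZMod p) = -(z.im * ι) := eq_neg_of_add_eq_zero_left hz
  have hw' : (w.re : ZMod p) = -(w.im * ι) := eq_neg_of_add_eq_zero_left hw
  have h1 : (p : ℤ) ∣ z.re * w.re + z.im * w.im := by
    rw [← ZMod.intCast_zmod_eq_zero_iff_dvd]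
    push_cast
    rw [hz', hw']
    linear_combination (z.im * w.im : ZMod p) * hι
  have h2 : (p : ℤ) ∣ z.im * w.re - z.re * w.im := by
    rw [← ZMod.intCast_zmod_eq_zero_iff_dvd]
    push_cast
    rw [hz', hw']; ring
  obtain ⟨a, ha⟩ := h1
  obtain ⟨b, hb⟩ := h2
  have hu : z * star w = p * ⟨a, b⟩ := by
    ext
    · simp; linarith
    · simp; linarith
  have hun : (⟨a, b⟩ * star ⟨a, b⟩ : GaussianInt) = 1 := by
    have : (z * star z) * (w * star w) = (p * p : GaussianInt) * (⟨a, b⟩ * star ⟨a, b⟩) := by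
      calc (z * star z) * (w * star w) = (z * star w) * star (z * star w) := by
            rw [star_mul', star_star]; ring
        _ = _ := by rw [hu, star_mul', star_natCast]; ring
    rw [hzn, hwn] at this
    exact (mul_left_cancel₀ (mul_ne_zero hp0 hp0) (by rw [mul_one]; exact this)).symm
  refine ⟨⟨a, b⟩, ?_, ?_⟩
  · have h1 : a ^ 2 + b ^ 2 = 1 := by
      have := congrArg Zsqrtd.re hun
      simp at this; linarith
    have ha : -1 ≤ a ∧ a ≤ 1 := by constructor <;> nlinarith [sq_nonneg b]
    have hb : -1 ≤ b ∧ b ≤ 1 := by constructor <;> nlinarith [sq_nonneg a]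
    obtain ⟨ha1, ha2⟩ := ha
    obtain ⟨hb1, hb2⟩ := hb
    clear hu hun
    interval_cases a <;> interval_cases b <;> first | (exfalso; revert h1; decide) | decide
  · apply mul_left_cancel₀ hp0
    calc (p : GaussianInt) * z = z * star w * w := by rw [← hwn]; ring
      _ = _ := by rw [hu]; ring

namespace IsQuarticChar

variable {p : ℕ} [Fact p.Prime] {ι : ZMod p} {hι : ι * ι = -1} {χ : MulChar (ZMod p) GaussianInt}

/-- For `p = r² + x²`, the primary generator `-J(χ, χ²)` of the prime ideal of `χ` is `u (r + x i)`
with a unit `u`, and the trace is `2r` exactly when the quartic symbol of `-D` is `u`. -/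
theorem frobeniusTrace_eq_iff (h : IsQuarticChar ι hι χ) (hp : p % 4 = 1) {D r x : ℤ}
    (hD : ¬ (p : ℤ) ∣ 2 * D) (hr : r ≠ 0) (hpr : (p : ℤ) = r ^ 2 + x ^ 2)
    (hrx : (r : ZMod p) + x * ι = 0) :
    ∃ u : GaussianInt, u ^ 4 = 1 ∧ -jacobiSum χ (χ ^ 2) = u * ⟨r, x⟩ ∧
      (frobeniusTrace (curveE D) p = 2 * r ↔ χ ((-D : ℤ) : ZMod p) = u) := by
  have hprime : p.Prime := Fact.out
  set J := jacobiSum χ (χ ^ 2) with hJ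
  obtain ⟨u, hu4, hu⟩ := exists_unit_of_lift_eq_zero (p := p) (ι := ι) (hι := hι) (z := -J)
    (w := ⟨r, x⟩) (by rw [map_neg, h.lift_jacobiSum hp, neg_zero])
    (by rw [gaussLift_apply]; exact hrx)
    (by rw [star_neg, neg_mul_neg, h.jacobiSum_mul_star hp])
    (by
      have : (p : GaussianInt) = ((r ^ 2 + x ^ 2 : ℤ) : GaussianInt) := by
        rw [← hpr]; simp
      rw [this]
      ext
      · rw [Zsqrtd.re_intCast]; simp; ring
      · rw [Zsqrtd.im_intCast]; simp; ring)
  refine ⟨u, hu4, hu, ?_⟩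
  have hD0 : (D : ZMod p) ≠ 0 := fun h0 =>
    hD (((ZMod.intCast_zmod_eq_zero_iff_dvd _ _).1 h0).mul_left 2)
  have hf1 := h.pow_four _ hD0
  have hf2 := apply_neg_one_sq χ
  set v := χ (-1) * χ D ^ 3 * u with hv
  have hv4 : v ^ 4 = 1 := by
    calc v ^ 4 = (χ (-1) ^ 2) ^ 2 * (χ D ^ 4) ^ 3 * u ^ 4 := by rw [hv]; ring
      _ = 1 := by rw [hf1, hf2, hu4]; ring
  have htr : frobeniusTrace (curveE D) p = 2 * (v * ⟨r, x⟩ : GaussianInt).re := by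
    have h1 := h.sum_cubic hp hD0
    have h2 : χ (-1) * χ D ^ 3 * J = -(v * ⟨r, x⟩) := by
      rw [hv, mul_assoc _ u, ← hu]; ring
    rw [h2] at h1
    have h3 := congrArg Zsqrtd.re h1
    rw [frobeniusTrace_curveE hD]
    simp only [Zsqrtd.re_intCast, Zsqrtd.re_add, Zsqrtd.re_star, Zsqrtd.re_neg] at h3
    rw [h3]; ring
  have hxr : x ≠ r ∧ x ≠ -r := by
    have : x ^ 2 ≠ r ^ 2 := by
      intro hx
      rw [hx] at hpr
      omega
    exact ⟨fun e => this (by rw [e]), fun e => this (by rw [e]; ring)⟩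
  have hcrit : (v * ⟨r, x⟩ : GaussianInt).re = r ↔ v = 1 := by
    rcases gaussian_pow_four_cases hv4 with e | e | e | e
    · rw [e]; simp
    · rw [e]
      refine ⟨fun h0 => ?_, fun h0 => absurd h0 (by decide)⟩
      simp [gaussI] at h0
      exact absurd (by linarith) hxr.2
    · rw [e]
      refine ⟨fun h0 => ?_, fun h0 => absurd h0 (by decide)⟩
      simp at h0
      exact absurd (by linarith) hr
    · rw [e]
      refine ⟨fun h0 => ?_, fun h0 => absurd h0 (by decide)⟩
      simp [gaussI] at h0
      exact absurd h0 hxr.1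
  rw [htr, mul_right_inj' two_ne_zero, hcrit]
  have hneg : χ ((-D : ℤ) : ZMod p) = χ (-1) * χ D := by
    rw [← map_mul]; push_cast; rw [neg_one_mul]
  rw [hneg, hv]
  constructor
  · intro h1
    calc χ (-1) * χ D = χ (-1) * χ D * (χ (-1) * χ D ^ 3 * u) := by rw [h1, mul_one]
      _ = χ (-1) ^ 2 * χ D ^ 4 * u := by ring
      _ = u := by rw [hf1, hf2]; ring
  · intro h1
    rw [← h1]
    calc _ = χ (-1) ^ 2 * χ D ^ 4 := by ring
      _ = 1 := by rw [hf1, hf2]; ring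

end IsQuarticChar

/-! ### Quartic reciprocity for rational primes -/

theorem gaussLift_pow_char {K : Type*} [Field K] {l : ℕ} [Fact l.Prime] [CharP K l] {κ : K}
    (hκ : κ * κ = -1) (z : GaussianInt) :
    (l % 4 = 1 → gaussLift κ hκ z ^ l = gaussLift κ hκ z) ∧
      (l % 4 = 3 → gaussLift κ hκ z ^ l = gaussLift κ hκ (star z)) := by
  have h1 : gaussLift κ hκ z ^ l = z.re + z.im * κ ^ l := by
    have hint : ∀ n : ℤ, (n : K) ^ l = n := fun n => by
      have := ZMod.pow_card (n : ZMod l)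
      have h2 := congrArg (ZMod.castHom (dvd_refl l) K) this
      rwa [map_pow, map_intCast] at h2
    rw [gaussLift_apply, add_pow_char, mul_pow, hint, hint]
  have hκ4 : κ ^ 4 = 1 := by
    rw [show κ ^ 4 = (κ * κ) * (κ * κ) by ring, hκ]; ring
  rw [h1, gaussLift_apply, gaussLift_apply]
  constructor <;> intro hl
  · have : κ ^ l = κ := by
      rw [← Nat.div_add_mod l 4, hl, pow_succ, pow_mul, hκ4, one_pow, one_mul]
    rw [this]
  · have : κ ^ l = -κ := by
      rw [← Nat.div_add_mod l 4, hl, pow_add, pow_mul, hκ4, one_pow, one_mul, pow_succ, sq, hκ,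
        neg_one_mul]
    rw [this]; simp

namespace IsQuarticChar

variable {p : ℕ} [Fact p.Prime] {ι : ZMod p} {hι : ι * ι = -1} {χ : MulChar (ZMod p) GaussianInt}

theorem exists_sq_eq_neg_one (h : IsQuarticChar ι hι χ) (hp : p % 4 = 1) :
    ∃ a : ZMod p, a ≠ 0 ∧ χ a ^ 2 = -1 := by
  have hring : ringChar (ZMod p) ≠ 2 := by rw [ZMod.ringChar_zmod_n]; omega
  obtain ⟨a, ha⟩ := quadraticChar_exists_neg_one hring
  refine ⟨a, by rintro rfl; simp at ha, ?_⟩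
  have h2 := h.sq_eq_quadraticChar hp a
  rw [ha, MulChar.pow_apply' _ two_ne_zero] at h2
  rw [h2]; simp

theorem ringHomComp_pow_ne_one (h : IsQuarticChar ι hι χ) (hp : p % 4 = 1) {K : Type*} [Field K]
    (hK : (-1 : K) ≠ 1) (f : GaussianInt →+* K) :
    χ.ringHomComp f ≠ 1 ∧ χ.ringHomComp f ^ 2 ≠ 1 ∧ χ.ringHomComp f ^ 3 ≠ 1 := by
  obtain ⟨a, ha, h2⟩ := h.exists_sq_eq_neg_one hp
  have e2 : (χ.ringHomComp f) a ^ 2 = -1 := by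
    rw [MulChar.ringHomComp_apply, ← map_pow, h2]; simp
  have h2' : χ.ringHomComp f ^ 2 ≠ 1 := by
    intro h1
    have := congrArg (fun ψ : MulChar (ZMod p) K => ψ a) h1
    simp only [MulChar.pow_apply' _ two_ne_zero, MulChar.one_apply ha.isUnit] at this
    exact hK (e2.symm.trans this)
  refine ⟨fun h1 => h2' (by rw [h1, one_pow]), h2', fun h3 => ?_⟩
  have := congrArg (fun ψ : MulChar (ZMod p) K => ψ a) h3
  simp only [MulChar.pow_apply' _ (show 3 ≠ 0 by norm_num), MulChar.one_apply ha.isUnit] at this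
  rw [pow_succ, e2] at this
  have e1 : (χ.ringHomComp f) a = -1 := by linear_combination -this
  rw [e1] at e2
  exact hK (by linear_combination -e2)

/-- The relations `g(χ)⁴ = J² p` and `g(χ) g(χ³) = χ(-1) p` between Gauss sums over a field `K`,
where `J` is the image of the Jacobi sum `J(χ, χ²)`. -/
theorem gaussSum_relations (h : IsQuarticChar ι hι χ) (hp : p % 4 = 1) {K : Type*} [Field K]
    (hK : (-1 : K) ≠ 1) (hpK : (p : K) ≠ 0) (f : GaussianInt →+* K) {ψ : AddChar (ZMod p) K}
    (hψ : ψ.IsPrimitive) :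
    gaussSum (χ.ringHomComp f) ψ ^ 4 = f (jacobiSum χ (χ ^ 2)) ^ 2 * p ∧
      gaussSum (χ.ringHomComp f) ψ * gaussSum (χ.ringHomComp f ^ 3) ψ = f (χ (-1)) * p := by
  obtain ⟨h1, h2, h3⟩ := h.ringHomComp_pow_ne_one hp hK f
  set ω := χ.ringHomComp f with hω
  have hω4 : ω ^ 4 = 1 := by
    rw [hω, MulChar.ringHomComp_pow, h.pow_four_eq_one, MulChar.ringHomComp_one]
  have hm1 : ω (-1) = f (χ (-1)) := rfl
  have hm2 : ω (-1) ^ 2 = 1 := by rw [hm1, ← map_pow, apply_neg_one_sq, map_one]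
  have hJ : jacobiSum ω (ω ^ 2) = f (jacobiSum χ (χ ^ 2)) := by
    rw [← jacobiSum_ringHomComp, ← MulChar.ringHomComp_pow]
  have e1 : gaussSum (ω ^ 3) ψ * f (jacobiSum χ (χ ^ 2)) = gaussSum ω ψ * gaussSum (ω ^ 2) ψ := by
    have := jacobiSum_mul_nontrivial (χ := ω) (φ := ω ^ 2) (by rw [← pow_succ']; exact h3) ψ
    rwa [← pow_succ', hJ] at this
  have e2 : gaussSum ω ψ * gaussSum (ω ^ 3) ψ = f (χ (-1)) * p := by
    have k1 := gaussSum_mul_gaussSum_eq_card h1 hψ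
    have k2 : ω⁻¹ = ω ^ 3 := by rw [inv_eq_iff_mul_eq_one, ← pow_succ', hω4]
    have k3 := mul_gaussSum_inv_eq_gaussSum (ω ^ 3) ψ
    have k4 : (ω ^ 3) (-1) = f (χ (-1)) := by
      rw [MulChar.pow_apply' _ (by norm_num), pow_succ, hm2, one_mul, hm1]
    rw [k2, ZMod.card] at k1
    rw [k4] at k3
    rw [← k3, ← k1]; ring
  have e3 : gaussSum (ω ^ 2) ψ ^ 2 = p := by
    have hq : (ω ^ 2).IsQuadratic := by
      intro a
      rcases eq_or_ne a 0 with rfl | ha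
      · left; exact MulChar.map_zero _
      · right
        have : ((ω ^ 2) a) ^ 2 = 1 := by
          rw [MulChar.pow_apply' _ two_ne_zero, ← pow_mul]
          change f (χ a) ^ 4 = 1
          rw [← map_pow, h.pow_four a ha, map_one]
        exact sq_eq_one_iff.1 this
    rw [gaussSum_sq h2 hq hψ, ZMod.card, MulChar.pow_apply' _ two_ne_zero, hm2, one_mul]
  refine ⟨?_, e2⟩
  have hm2' : f (χ (-1)) ^ 2 = 1 := hm2
  apply mul_right_cancel₀ hpK
  set J := f (jacobiSum χ (χ ^ 2))
  set g₁ := gaussSum ω ψ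
  calc g₁ ^ 4 * p = (g₁ * (g₁ * gaussSum (ω ^ 2) ψ)) ^ 2 := by rw [← e3]; ring
    _ = (g₁ * gaussSum (ω ^ 3) ψ * J) ^ 2 := by rw [← e1]; ring
    _ = f (χ (-1)) ^ 2 * (J ^ 2 * p * p) := by rw [e2]; ring
    _ = _ := by rw [hm2', one_mul]

/-- **Quartic reciprocity** for a rational odd prime `l`, in a field of characteristic `l`. With
`π = -J(χ, χ²)` and `l* = ±l ≡ 1 (mod 4)` it says `χ(l*) = (π / π̄) ^ ((l* - 1) / 4)`. The proof
computes the `l`-th power of the Gauss sum of `χ` in characteristic `l`. -/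
theorem reciprocity (h : IsQuarticChar ι hι χ) (hp : p % 4 = 1) {l : ℕ} [Fact l.Prime]
    (hl2 : l ≠ 2) (hlp : l ≠ p) {K : Type*} [Field K] [IsAlgClosed K] [CharP K l] {κ : K}
    (hκ : κ * κ = -1) {w : GaussianInt} (hw : w = -jacobiSum χ (χ ^ 2)) :
    (l % 4 = 1 → gaussLift κ hκ (χ (l : ZMod p)) * gaussLift κ hκ (star w) ^ ((l - 1) / 4) =
        gaussLift κ hκ w ^ ((l - 1) / 4)) ∧
      (l % 4 = 3 → gaussLift κ hκ (χ (-l : ZMod p)) * gaussLift κ hκ w ^ ((l + 1) / 4) =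
        gaussLift κ hκ (star w) ^ ((l + 1) / 4)) := by
  have hpp : p.Prime := Fact.out
  have hlpr : l.Prime := Fact.out
  have hK : (-1 : K) ≠ 1 := by
    have := Ring.neg_one_ne_one_of_char_ne_two (R := K) (by rw [ringChar.eq K l]; exact hl2)
    exact this
  have hpK : (p : K) ≠ 0 := by
    rw [Ne, CharP.cast_eq_zero_iff K l p, Nat.prime_dvd_prime_iff_eq hlpr hpp]
    exact hlp
  have hlu : (l : ZMod p) ≠ 0 := by
    rw [Ne, ZMod.natCast_eq_zero_iff, Nat.prime_dvd_prime_iff_eq hpp hlpr]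
    exact hlp.symm
  have : NeZero (p : K) := ⟨hpK⟩
  obtain ⟨ζ, hζ⟩ := HasEnoughRootsOfUnity.exists_primitiveRoot K p
  have hψ := AddChar.zmodChar_primitive_of_primitive_root p hζ
  set ψ := AddChar.zmodChar p (C := K) hζ.pow_eq_one
  set f := gaussLift κ hκ with hf
  obtain ⟨e1, e2⟩ := h.gaussSum_relations hp hK hpK f hψ
  set ω := χ.ringHomComp f with hω
  have hω4 : ω ^ 4 = 1 := by
    rw [hω, MulChar.ringHomComp_pow, h.pow_four_eq_one, MulChar.ringHomComp_one]
  have hfrob := gaussSum_frob l ω ψ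
  rw [AddChar.pow_mulShift] at hfrob
  set a : (ZMod p)ˣ := Units.mk0 (l : ZMod p) hlu with ha
  have hχ4 : f (χ (l : ZMod p)) ^ 4 = 1 := by rw [← map_pow, h.pow_four _ hlu, map_one]
  have hww : f w * f (star w) = p := by
    rw [← map_mul, hw, star_neg, neg_mul_neg, h.jacobiSum_mul_star hp, map_natCast]
  have hw0 : f w ≠ 0 := left_ne_zero_of_mul (by rw [hww]; exact hpK)
  have e1' : gaussSum ω ψ ^ 4 = f w ^ 3 * f (star w) := by
    rw [e1, ← hww, hw, map_neg]; ring
  have hg0 : gaussSum ω ψ ≠ 0 := by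
    intro h0
    rw [h0, zero_pow (by norm_num)] at e1'
    have : f w ^ 2 * (p : K) = 0 := by rw [← hww, ← mul_zero (0 : K)]; linear_combination -e1'
    rcases mul_eq_zero.1 this with h | h
    · exact hw0 (pow_eq_zero_iff two_ne_zero |>.1 h)
    · exact hpK h
  constructor
  · intro hl
    obtain ⟨m, hm⟩ : ∃ m, l = 4 * m + 1 := ⟨l / 4, by omega⟩
    have hωl : ω ^ l = ω := by rw [hm, pow_succ, pow_mul, hω4, one_pow, one_mul]
    rw [hωl] at hfrob
    have k1 : f (χ (l : ZMod p)) * gaussSum ω ψ ^ l = gaussSum ω ψ := by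
      rw [hfrob]; exact gaussSum_mulShift ω ψ a
    have k2 : f (χ (l : ZMod p)) * (f w ^ 3 * f (star w)) ^ m = 1 := by
      apply mul_right_cancel₀ hg0
      rw [← e1', ← pow_mul, mul_assoc, ← pow_succ, ← hm, k1, one_mul]
    have k3 : f w ^ (4 * m) = 1 := by
      have := (gaussLift_pow_char (l := l) hκ w).1 hl
      apply mul_right_cancel₀ hw0
      rw [← pow_succ, ← hm, one_mul]; exact this
    have hm' : (l - 1) / 4 = m := by omega
    rw [hm']
    calc f (χ (l : ZMod p)) * f (star w) ^ m
        = f (χ (l : ZMod p)) * (f (star w) ^ m * f w ^ (4 * m)) := by rw [k3, mul_one]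
      _ = f (χ (l : ZMod p)) * (f w ^ 3 * f (star w)) ^ m * f w ^ m := by ring
      _ = _ := by rw [k2, one_mul]
  · intro hl
    obtain ⟨m, hm⟩ : ∃ m, l + 1 = 4 * m := ⟨(l + 1) / 4, by omega⟩
    have hωl : ω ^ l = ω ^ 3 := by
      have : l = 4 * (m - 1) + 3 := by omega
      rw [this, pow_add, pow_mul, hω4, one_pow, one_mul]
    rw [hωl] at hfrob
    have k1 : f (χ (l : ZMod p)) ^ 3 * gaussSum ω ψ ^ l = gaussSum (ω ^ 3) ψ := by
      rw [hfrob]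
      have := gaussSum_mulShift (ω ^ 3) ψ a
      rwa [MulChar.pow_apply' _ (by norm_num)] at this
    have k2 : (f w ^ 3 * f (star w)) ^ m = f (χ (-l : ZMod p)) * p := by
      have hneg : f (χ (-l : ZMod p)) = f (χ (-1)) * f (χ (l : ZMod p)) := by
        rw [← map_mul, ← map_mul, neg_one_mul]
      rw [← e1', ← pow_mul, ← hm, pow_succ, hneg]
      calc gaussSum ω ψ ^ l * gaussSum ω ψ
          = f (χ (l : ZMod p)) ^ 4 * (gaussSum ω ψ ^ l * gaussSum ω ψ) := by rw [hχ4, one_mul]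
        _ = f (χ (l : ZMod p)) * (gaussSum ω ψ *
              (f (χ (l : ZMod p)) ^ 3 * gaussSum ω ψ ^ l)) := by ring
        _ = _ := by rw [k1, e2]; ring
    have k3 : f w ^ (4 * m) = p := by
      have := (gaussLift_pow_char (l := l) hκ w).2 hl
      rw [← hm, pow_succ, this, mul_comm]; exact hww
    have hm' : (l + 1) / 4 = m := by omega
    rw [hm']
    apply mul_right_cancel₀ hpK
    calc f (χ (-l : ZMod p)) * f w ^ m * p = (f w ^ 3 * f (star w)) ^ m * f w ^ m := by
          rw [k2]; ring
      _ = f (star w) ^ m * f w ^ (4 * m) := by ring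
      _ = _ := by rw [k3]

end IsQuarticChar

/-! ### Powers of `i`, and the quartic symbols of `-1` and `2` -/

/-- The power `i ^ n` in `ℤ[i]`, for an integer exponent `n`. -/
def gaussIPow (n : ℤ) : GaussianInt := gaussI ^ (n % 4).toNat

theorem gaussIPow_cases (n : ℤ) :
    (n % 4 = 0 ∧ gaussIPow n = 1) ∨ (n % 4 = 1 ∧ gaussIPow n = gaussI) ∨
      (n % 4 = 2 ∧ gaussIPow n = -1) ∨ (n % 4 = 3 ∧ gaussIPow n = -gaussI) := by
  have : n % 4 = 0 ∨ n % 4 = 1 ∨ n % 4 = 2 ∨ n % 4 = 3 := by omega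
  unfold gaussIPow
  rcases this with h | h | h | h <;> rw [h] <;> decide

theorem gaussIPow_congr {m n : ℤ} (h : m % 4 = n % 4) : gaussIPow m = gaussIPow n := by
  unfold gaussIPow; rw [h]

theorem gaussIPow_pow_four (n : ℤ) : gaussIPow n ^ 4 = 1 := by
  rw [gaussIPow, ← pow_mul, mul_comm, pow_mul, gaussI_pow_four, one_pow]

theorem gaussLift_gaussIPow {K : Type*} [Field K] {κ : K} (hκ : κ * κ = -1) (n : ℤ) :
    gaussLift κ hκ (gaussIPow n) = κ ^ n := by
  have h0 : κ ≠ 0 := by rintro rfl; simp at hκ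
  have h4 : κ ^ (4 : ℤ) = 1 := by
    rw [show κ ^ (4 : ℤ) = (κ * κ) * (κ * κ) by rw [zpow_ofNat]; ring, hκ]; ring
  rw [gaussIPow, map_pow, gaussLift_gaussI]
  have h1 : ((n % 4).toNat : ℤ) = n % 4 := Int.toNat_of_nonneg (Int.emod_nonneg _ (by norm_num))
  conv_rhs => rw [← Int.emod_add_mul_ediv n 4, zpow_add₀ h0, zpow_mul, h4, one_zpow, mul_one, ← h1]
  rw [zpow_natCast]

theorem gaussIPow_add (m n : ℤ) : gaussIPow (m + n) = gaussIPow m * gaussIPow n := by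
  rcases gaussIPow_cases m with ⟨hm, em⟩ | ⟨hm, em⟩ | ⟨hm, em⟩ | ⟨hm, em⟩ <;>
  rcases gaussIPow_cases n with ⟨hn, en⟩ | ⟨hn, en⟩ | ⟨hn, en⟩ | ⟨hn, en⟩ <;>
  · rw [em, en, gaussIPow, Int.add_emod, hm, hn]; decide

theorem gaussIPow_nsmul (k : ℕ) (n : ℤ) : gaussIPow (k * n) = gaussIPow n ^ k := by
  induction k with
  | zero => simp [gaussIPow]
  | succ k ih => rw [pow_succ, ← ih, ← gaussIPow_add]; congr 1; push_cast; ring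

/-- Reduction to a field of characteristic different from `2` is injective on fourth roots of
unity. -/
theorem gaussLift_injOn_units {K : Type*} [Field K] (hK : (-1 : K) ≠ 1) {κ : K} (hκ : κ * κ = -1)
    {z w : GaussianInt} (hz : z ^ 4 = 1) (hw : w ^ 4 = 1)
    (h : gaussLift κ hκ z = gaussLift κ hκ w) : z = w := by
  have hz0 : z * star z = 1 := by rw [gaussian_star_eq_pow_three hz, ← pow_succ', hz]
  have hv : (w * star z) ^ 4 = 1 := by
    rw [mul_pow, hw, one_mul, gaussian_star_eq_pow_three hz, ← pow_mul, mul_comm 3 4, pow_mul, hz,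
      one_pow]
  have h1 : gaussLift κ hκ (w * star z) = 1 := by
    rw [map_mul, ← h, ← map_mul, hz0, map_one]
  have hκ1 : κ ≠ 1 := by rintro rfl; rw [one_mul] at hκ; exact hK hκ.symm
  have hκ2 : -κ ≠ 1 := by
    intro e; rw [← neg_mul_neg, e, one_mul] at hκ; exact hK hκ.symm
  have h2 : w * star z = 1 := by
    rcases gaussian_pow_four_cases hv with e | e | e | e
    · exact e
    · rw [e, gaussLift_gaussI] at h1; exact absurd h1 hκ1
    · rw [e, map_neg, map_one] at h1; exact absurd h1 hK
    · rw [e, map_neg, gaussLift_gaussI] at h1; exact absurd h1 hκ2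
  calc z = z * (w * star z) := by rw [h2, mul_one]
    _ = w * (z * star z) := by ring
    _ = w := by rw [hz0, mul_one]

theorem jacobiSym_eq_jacobiSym_natAbs {p : ℕ} (hp : p % 4 = 1) {n : ℤ} (hn : Odd n) :
    jacobiSym n p = jacobiSym p n.natAbs := by
  have h1 : jacobiSym n p = jacobiSym (n.natAbs : ℤ) p := by
    rcases Int.natAbs_eq n with h | h
    · rw [← h]
    · rw [h, Int.natAbs_neg, Int.natAbs_natCast, ← neg_one_mul, jacobiSym.mul_left,
        jacobiSym.at_neg_one (Nat.odd_iff.2 (by omega)), ZMod.χ₄_nat_one_mod_four hp, one_mul]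
  rw [h1]
  exact (jacobiSym.quadratic_reciprocity_one_mod_four hp (Int.natAbs_odd.2 hn)).symm

theorem jacobiSym_natAbs_eq_one {N n b : ℤ} (h : n ∣ N - b ^ 2) (hc : IsCoprime b n) :
    jacobiSym N n.natAbs = 1 := by
  have h1 : N % (n.natAbs : ℤ) = b ^ 2 % (n.natAbs : ℤ) :=
    ((Int.modEq_iff_dvd).2 (by rw [Int.natAbs_dvd]; exact h)).symm
  rw [jacobiSym.mod_left' h1]
  refine jacobiSym.sq_one' ?_
  rw [Int.gcd, Int.natAbs_natCast]
  exact Int.isCoprime_iff_gcd_eq_one.1 hc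

/-- Dirichlet's evaluation of the quartic symbol of `2`: if `p = a² + b²` with `a` odd and
`b ≡ f a`, then `2 ^ ((p - 1) / 4) ≡ f ^ (a b / 2)`. It rests on the quadratic symbols of `a` and
`a + b` modulo `p`. -/
theorem two_pow_eq_zpow {p : ℕ} [Fact p.Prime] (hp : p % 4 = 1) {a b : ℤ} (ha : Odd a)
    (hab : (p : ℤ) = a ^ 2 + b ^ 2) {f : ZMod p} (hf : f * f = -1) (hb : (b : ZMod p) = f * a)
    {c : ℤ} (hc : a * b = 2 * c) : (2 : ZMod p) ^ ((p - 1) / 4) = f ^ c := by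
  have hpp : p.Prime := Fact.out
  have hpZ := Nat.prime_iff_prime_int.1 hpp
  obtain ⟨m, hm⟩ : ∃ m, p = 4 * m + 1 := ⟨p / 4, by omega⟩
  have hbe : Even b := by
    rw [← Int.not_odd_iff_even]
    intro hb
    have h1 := Int.sq_mod_four_eq_one_of_odd ha
    have h2 := Int.sq_mod_four_eq_one_of_odd hb
    omega
  have hf0 : f ≠ 0 := by rintro rfl; simp at hf
  have hcop : IsCoprime a b := by
    rw [Int.isCoprime_iff_gcd_eq_one]
    by_contra hg
    obtain ⟨q, hq, hqg⟩ := Nat.exists_prime_and_dvd hg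
    have qa : (q : ℤ) ∣ a := (Int.natCast_dvd_natCast.2 hqg).trans (Int.gcd_dvd_left _ _)
    have qb : (q : ℤ) ∣ b := (Int.natCast_dvd_natCast.2 hqg).trans (Int.gcd_dvd_right _ _)
    have hqp : (q : ℤ) ^ 2 ∣ (p : ℤ) := by
      rw [hab]; exact dvd_add (pow_dvd_pow_of_dvd qa 2) (pow_dvd_pow_of_dvd qb 2)
    have h1 : q ^ 2 ∣ p := by exact_mod_cast hqp
    have h2 : q = p := (Nat.prime_dvd_prime_iff_eq hq hpp).1 ((dvd_pow_self q two_ne_zero).trans h1)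
    have h3 := Nat.le_of_dvd hpp.pos h1
    rw [h2] at h3
    nlinarith [hpp.two_le]
  have hm2 : p / 2 = 2 * m := by omega
  have leg : ∀ n : ℤ, Odd n → (n : ZMod p) ^ (2 * m) = (jacobiSym p n.natAbs : ZMod p) := by
    intro n hn
    rw [← jacobiSym_eq_jacobiSym_natAbs hp hn, ← hm2, ← legendreSym.eq_pow,
      jacobiSym.legendreSym.to_jacobiSym]
  have ja : (a : ZMod p) ^ (2 * m) = 1 := by
    rw [leg a ha, jacobiSym_natAbs_eq_one (b := b) ⟨a, by rw [hab]; ring⟩ hcop.symm, Int.cast_one]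
  set s := a + b with hs
  have hsodd : Odd s := ha.add_even hbe
  have h2s : IsCoprime 2 s := by
    obtain ⟨k, hk⟩ := hsodd
    exact ⟨-k, 1, by rw [hk]; ring⟩
  have hcop2 : IsCoprime (a - b) s := by
    have h1 : IsCoprime a s := by
      rw [hs]; simpa [add_comm] using (IsCoprime.add_mul_left_right hcop 1)
    have h2 : IsCoprime (2 * a) s := h2s.mul_left h1
    have : a - b = 2 * a + s * (-1) := by rw [hs]; ring
    rw [this]
    exact h2.add_mul_left_left (-1)
  have js : (s : ZMod p) ^ (2 * m) = (ZMod.χ₈ (s.natAbs : ℕ) : ZMod p) := by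
    rw [leg s hsodd, ← jacobiSym.at_two (Int.natAbs_odd.2 hsodd)]
    have h1 : jacobiSym (2 * p) s.natAbs = 1 :=
      jacobiSym_natAbs_eq_one (b := a - b) ⟨s, by rw [hab, hs]; ring⟩ hcop2
    have h2 : jacobiSym 2 s.natAbs ^ 2 = 1 := jacobiSym.sq_one (by
      rw [Int.gcd, Int.natAbs_natCast]; exact Int.isCoprime_iff_gcd_eq_one.1 h2s)
    rw [jacobiSym.mul_left] at h1
    congr 1
    calc jacobiSym p s.natAbs = jacobiSym 2 s.natAbs ^ 2 * jacobiSym p s.natAbs := by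
          rw [h2, one_mul]
      _ = jacobiSym 2 s.natAbs * (jacobiSym 2 s.natAbs * jacobiSym p s.natAbs) := by ring
      _ = _ := by rw [h1, mul_one]
  have hsq : (s : ZMod p) ^ 2 = 2 * f * a ^ 2 := by
    rw [hs]; push_cast; rw [hb]
    linear_combination (a : ZMod p) ^ 2 * hf
  have key : (2 : ZMod p) ^ m * f ^ m = (ZMod.χ₈ (s.natAbs : ℕ) : ZMod p) := by
    rw [← js, pow_mul, hsq, mul_pow, mul_pow, ← pow_mul, ja, mul_one]
  -- the exponents add up to `((a + b)² - 1) / 4`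
  have hk : ∃ k : ℤ, (m : ℤ) + c = 2 * k ∧ f ^ (2 * k) = (ZMod.χ₈ (s.natAbs : ℕ) : ZMod p) := by
    have hsum : 4 * ((m : ℤ) + c) = s ^ 2 - 1 := by
      have : (p : ℤ) = 4 * m + 1 := by exact_mod_cast hm
      rw [hs]; linear_combination -this + hab - 2 * hc
    have hf2 : f ^ (2 : ℤ) = -1 := by rw [zpow_ofNat, sq, hf]
    have hχ := ZMod.χ₈_nat_eq_if_mod_eight s.natAbs
    have hs8 : s.natAbs % 8 = 1 ∨ s.natAbs % 8 = 3 ∨ s.natAbs % 8 = 5 ∨ s.natAbs % 8 = 7 := by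
      have := Int.natAbs_odd.2 hsodd
      rw [Nat.odd_iff] at this; omega
    have hsn : s ^ 2 = (s.natAbs : ℤ) ^ 2 := (Int.natAbs_sq s).symm
    rw [hsn] at hsum
    rw [hχ]
    obtain ⟨q, hq⟩ : ∃ q ρ : ℕ, s.natAbs = 8 * q + ρ ∧ ρ = s.natAbs % 8 :=
      ⟨s.natAbs / 8, s.natAbs % 8, by omega, rfl⟩
    obtain ⟨ρ, hq, hρ⟩ := hq
    rw [hq] at hsum
    push_cast at hsum
    rcases hs8 with h | h | h | h <;> rw [h] at hρ <;> rw [hρ] at hsum <;> push_cast at hsum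
    · refine ⟨2 * (4 * q ^ 2 + q), by linarith, ?_⟩
      rw [if_neg (by omega), if_pos (by omega), zpow_mul, hf2, Even.neg_one_zpow ⟨_, two_mul _⟩]
      simp
    · refine ⟨2 * (4 * q ^ 2 + 3 * q) + 1, by linarith, ?_⟩
      rw [if_neg (by omega), if_neg (by omega), zpow_mul, hf2, Odd.neg_one_zpow ⟨_, rfl⟩]
      simp
    · refine ⟨2 * (4 * q ^ 2 + 5 * q + 1) + 1, by linarith, ?_⟩
      rw [if_neg (by omega), if_neg (by omega), zpow_mul, hf2, Odd.neg_one_zpow ⟨_, rfl⟩]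
      simp
    · refine ⟨2 * (4 * q ^ 2 + 7 * q + 3), by linarith, ?_⟩
      rw [if_neg (by omega), if_pos (by omega), zpow_mul, hf2, Even.neg_one_zpow ⟨_, two_mul _⟩]
      simp
  obtain ⟨k, hk1, hk2⟩ := hk
  rw [← hk2, ← hk1, zpow_add₀ hf0, zpow_natCast, mul_comm] at key
  have hm' : (p - 1) / 4 = m := by omega
  rw [hm']
  exact mul_left_cancel₀ (pow_ne_zero m hf0) key

namespace IsQuarticChar

variable {p : ℕ} [Fact p.Prime] {ι : ZMod p} {hι : ι * ι = -1} {χ : MulChar (ZMod p) GaussianInt}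

theorem apply_eq_of_pow_eq (h : IsQuarticChar ι hι χ) (hp : p % 4 = 1) {a : ZMod p} (ha : a ≠ 0)
    {n : ℤ} (hn : a ^ ((p - 1) / 4) = ι ^ n) : χ a = gaussIPow n := by
  have hK : (-1 : ZMod p) ≠ 1 := by
    have := (Fact.out : p.Prime).two_le
    have : Fact (2 < p) := ⟨by by_contra h; interval_cases p; omega⟩
    exact ZMod.neg_one_ne_one
  refine gaussLift_injOn_units hK hι (h.pow_four a ha) (gaussIPow_pow_four n) ?_
  rw [h.lift_apply, gaussLift_gaussIPow, hn]

/-- The quartic symbol of `2` modulo `r + x i`. -/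
theorem apply_two (h : IsQuarticChar ι hι χ) (hp : p % 4 = 1) {r x : ℤ}
    (hpr : (p : ℤ) = r ^ 2 + x ^ 2) (hrx : (r : ZMod p) + x * ι = 0) :
    χ 2 = if Odd r then gaussIPow (r * (x / 2)) else gaussIPow (-(x * (r / 2))) := by
  have h2 : (2 : ZMod p) ≠ 0 := by
    have h3 : ((2 : ℕ) : ZMod p) ≠ 0 := by
      rw [Ne, ZMod.natCast_eq_zero_iff, Nat.prime_dvd_prime_iff_eq Fact.out Nat.prime_two]
      omega
    exact_mod_cast h3
  have hx : (x : ZMod p) = ι * r := by linear_combination (x : ZMod p) * hι - ι * hrx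
  have hr : (r : ZMod p) = -ι * x := by linear_combination hrx
  have hpar : (r ^ 2 + x ^ 2) % 4 = 1 := by rw [← hpr]; omega
  split_ifs with hodd
  · have hxe : Even x := by
      rw [← Int.not_odd_iff_even]
      intro hb
      have h1 := Int.sq_mod_four_eq_one_of_odd hodd
      have h2 := Int.sq_mod_four_eq_one_of_odd hb
      omega
    refine h.apply_eq_of_pow_eq hp h2 (two_pow_eq_zpow hp hodd hpr hι hx ?_)
    obtain ⟨y, rfl⟩ := hxe
    rw [show (y + y) / 2 = y by omega]; ring
  · have hre := Int.not_odd_iff_even.1 hodd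
    have hxo : Odd x := by
      rw [← Int.not_even_iff_odd]
      rintro ⟨y, rfl⟩
      obtain ⟨s, rfl⟩ := hre
      have : ((s + s) ^ 2 + (y + y) ^ 2) % 4 = 0 := by
        rw [show (s + s) ^ 2 + (y + y) ^ 2 = 4 * (s ^ 2 + y ^ 2) by ring]; omega
      omega
    refine h.apply_eq_of_pow_eq hp h2 ?_
    have hι' : -ι * -ι = -1 := by rw [neg_mul_neg, hι]
    rw [two_pow_eq_zpow hp hxo (by rw [hpr]; ring) hι' hr (c := x * (r / 2))]
    · have : -ι = ι⁻¹ := by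
        refine eq_inv_of_mul_eq_one_left ?_
        rw [neg_mul, hι, neg_neg]
      rw [this, inv_zpow, zpow_neg]
    · obtain ⟨y, rfl⟩ := hre
      rw [show (y + y) / 2 = y by omega]; ring

/-- The quartic symbol of a sign `s` modulo `r + x i`. -/
theorem apply_sign (h : IsQuarticChar ι hι χ) (hp : p % 4 = 1) {r x : ℤ}
    (hpr : (p : ℤ) = r ^ 2 + x ^ 2) {s : ℤ} (hs : s = 1 ∨ s = -1) :
    χ (s : ZMod p) = if Odd r then gaussIPow ((1 - s) * (x / 2))
      else gaussIPow ((1 - s) * (r / 2)) := by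
  rcases hs with rfl | rfl
  · simp [gaussIPow]
  obtain ⟨m, hm⟩ : ∃ m, p = 4 * m + 1 := ⟨p / 4, by omega⟩
  have hm' : (p - 1) / 4 = m := by omega
  have hι2 : ι ^ (2 : ℤ) = -1 := by rw [zpow_ofNat, sq, hι]
  have h1 : χ (((-1 : ℤ)) : ZMod p) = gaussIPow (2 * m) := by
    refine h.apply_eq_of_pow_eq hp (by simp) ?_
    rw [zpow_mul, hι2, hm']; push_cast; rw [zpow_natCast]
  have hpar : (r ^ 2 + x ^ 2) = 4 * m + 1 := by rw [← hpr]; exact_mod_cast hm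
  rw [h1]
  split_ifs with hodd
  · obtain ⟨k, rfl⟩ := hodd
    have hxe : Even x := by
      rw [← Int.not_odd_iff_even]
      rintro ⟨y, rfl⟩
      have : 2 * (2 * (k ^ 2 + k + y ^ 2 + y)) + 2 = 2 * (2 * (m : ℤ)) + 1 := by linarith
      omega
    obtain ⟨y, rfl⟩ := hxe
    have hmy : (m : ℤ) = k * (k + 1) + y * (y - 1) + y := by linarith
    obtain ⟨u, hu⟩ := Int.even_mul_succ_self k
    obtain ⟨v, hv⟩ := Int.even_mul_succ_self (y - 1)
    rw [sub_add_cancel] at hv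
    refine gaussIPow_congr ?_
    rw [show (y + y) / 2 = y by omega]
    rw [mul_comm y] at hmy
    omega
  · obtain ⟨k, rfl⟩ := Int.not_odd_iff_even.1 hodd
    have hxo : Odd x := by
      rw [← Int.not_even_iff_odd]
      rintro ⟨y, rfl⟩
      have : 2 * (2 * (k ^ 2 + y ^ 2)) = 2 * (2 * (m : ℤ)) + 1 := by linarith
      omega
    obtain ⟨y, rfl⟩ := hxo
    have hmy : (m : ℤ) = y * (y + 1) + (k - 1) * k + k := by linarith
    obtain ⟨u, hu⟩ := Int.even_mul_succ_self y
    obtain ⟨v, hv⟩ := Int.even_mul_succ_self (k - 1)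
    rw [sub_add_cancel] at hv
    refine gaussIPow_congr ?_
    rw [show (k + k) / 2 = k by omega]
    omega

end IsQuarticChar

/-- The unit that makes `r + x i` primary. -/
theorem star_unit_eq_of_primary {r x : ℤ} (hpar : (Odd r ∧ Even x) ∨ (Even r ∧ Odd x))
    {u : GaussianInt} (hu : u ^ 4 = 1) (h : (⟨2, 2⟩ : GaussianInt) ∣ u * ⟨r, x⟩ - 1) :
    star u = if Odd r then gaussIPow (r + x - 1) else gaussIPow (r + x) := by
  obtain ⟨⟨c, d⟩, h⟩ := h
  rcases hpar with ⟨hr, hx⟩ | ⟨hr, hx⟩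
  · rw [if_pos hr]
    obtain ⟨k, rfl⟩ := hr
    obtain ⟨y, rfl⟩ := hx
    rcases gaussian_pow_four_cases hu with rfl | rfl | rfl | rfl <;>
      rw [Zsqrtd.ext_iff] at h <;> simp [gaussI] at h
    · rw [gaussIPow_congr (n := 0) (by omega)]; decide
    · omega
    · rw [gaussIPow_congr (n := 2) (by omega)]; decide
    · omega
  · rw [if_neg (Int.not_odd_iff_even.2 hr)]
    obtain ⟨k, rfl⟩ := hr
    obtain ⟨y, rfl⟩ := hx
    rcases gaussian_pow_four_cases hu with rfl | rfl | rfl | rfl <;>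
      rw [Zsqrtd.ext_iff] at h <;> simp [gaussI] at h
    · omega
    · rw [gaussIPow_congr (n := 3) (by omega)]; decide
    · omega
    · rw [gaussIPow_congr (n := 1) (by omega)]; decide

/-! ### The local factors of the quartic symbol at odd primes -/

/-- The signed prime `l* = ± l`, congruent to `1` modulo `4`. -/
def signedPrime (l : ℕ) : ℤ := ZMod.χ₄ l * l

/-- The square of the unit that makes `r + x i` primary, where `r² + x²` is odd. -/
def unitSq (r : ℤ) : ℤ := if Odd r then 1 else -1

/-- A quarter of the order `l - χ₄(l)` of the norm-one torus over `𝔽_l`. -/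
def torusQuarter (l : ℕ) : ℕ := if l % 4 = 1 then (l - 1) / 4 else (l + 1) / 4

/-- The value of the quartic symbol modulo `l` at the point at infinity `x / r = ∞`. -/
def valueAtInfinity (r : ℤ) (l : ℕ) : ℤ := (-unitSq r) ^ torusQuarter l

theorem unitSq_cases (r : ℤ) : unitSq r = 1 ∨ unitSq r = -1 := by
  unfold unitSq; split_ifs <;> simp

theorem valueAtInfinity_cases (r : ℤ) (l : ℕ) :
    valueAtInfinity r l = 1 ∨ valueAtInfinity r l = -1 := by
  unfold valueAtInfinity
  rcases unitSq_cases r with h | h <;> rw [h]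
  · exact neg_one_pow_eq_or ℤ _
  · simp

theorem torusQuarter_spec {l : ℕ} (hl : l.Prime) (hl2 : l ≠ 2) :
    (4 * torusQuarter l : ℤ) = l - ZMod.χ₄ l := by
  have hodd := Nat.odd_iff.1 (hl.odd_of_ne_two hl2)
  rw [ZMod.χ₄_nat_eq_if_mod_four, if_neg (by omega)]
  unfold torusQuarter
  have := hl.two_le
  split_ifs <;> omega

/-- The number of admissible residues modulo `l` is `admCount r l`. -/
theorem card_filter_sq_add_sq_ne_zero {l : ℕ} [Fact l.Prime] (hl2 : l ≠ 2) (r : ℤ) :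
    ((Finset.univ.filter (fun x : ZMod l => (r : ZMod l) ^ 2 + x ^ 2 ≠ 0)).card : ℤ) =
      admCount r l := by
  have hring : ringChar (ZMod l) ≠ 2 := by rwa [ZMod.ringChar_zmod_n]
  have h1 := quadraticChar_card_sqrts hring (-(r : ZMod l) ^ 2)
  have h2 : {x : ZMod l | x ^ 2 = -(r : ZMod l) ^ 2}.toFinset =
      Finset.univ.filter (fun x : ZMod l => ¬ ((r : ZMod l) ^ 2 + x ^ 2 ≠ 0)) := by
    ext x; simp [eq_neg_iff_add_eq_zero, add_comm]
  rw [h2] at h1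
  have h3 := Finset.card_filter_add_card_filter_not (s := (Finset.univ : Finset (ZMod l)))
    (fun x : ZMod l => (r : ZMod l) ^ 2 + x ^ 2 ≠ 0)
  rw [Finset.card_univ, ZMod.card] at h3
  have h4 : quadraticChar (ZMod l) (-(r : ZMod l) ^ 2) = jacobiSym (0 ^ 2 - 4 * 1 * r ^ 2) l := by
    rw [← jacobiSym.legendreSym.to_jacobiSym, legendreSym]
    have h20 : (2 : ZMod l) ≠ 0 := Ring.two_ne_zero hring
    have : (((0 ^ 2 - 4 * 1 * r ^ 2 : ℤ)) : ZMod l) = 2 ^ 2 * (-(r : ZMod l) ^ 2) := by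
      push_cast; ring
    rw [this, map_mul, quadraticChar_sq_one' h20, one_mul]
  rw [h4] at h1
  unfold admCount
  have h5 : ((Finset.univ.filter (fun x : ZMod l => (r : ZMod l) ^ 2 + x ^ 2 ≠ 0)).card : ℤ) +
    ((Finset.univ.filter (fun x : ZMod l => ¬ ((r : ZMod l) ^ 2 + x ^ 2 ≠ 0))).card : ℤ) = l := by
    exact_mod_cast h3
  linarith

/-- Orthogonality for the fourth roots of unity. -/
theorem sum_fourth_roots_pow (e : ℕ) :
    (1 : GaussianInt) ^ e + gaussI ^ e + (-1) ^ e + (-gaussI) ^ e = if 4 ∣ e then 4 else 0 := by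
  have h : ∀ z : GaussianInt, z ^ 4 = 1 → z ^ e = z ^ (e % 4) := fun z hz => by
    conv_lhs => rw [← Nat.div_add_mod e 4, pow_add, pow_mul, hz, one_pow, one_mul]
  rw [h 1 (by decide), h gaussI (by decide), h (-1) (by decide), h (-gaussI) (by decide)]
  simp only [Nat.dvd_iff_mod_eq_zero]
  have : e % 4 < 4 := Nat.mod_lt _ (by norm_num)
  interval_cases e % 4 <;> decide

/-- The possible values of a fourth root of unity in a field. -/
theorem exists_gaussLift_of_pow_four {K : Type*} [Field K] {κ : K} (hκ : κ * κ = -1) {z : K}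
    (hz : z ^ 4 = 1) : ∃ w : GaussianInt, w ^ 4 = 1 ∧ gaussLift κ hκ w = z := by
  have h : (z - 1) * (z + 1) * ((z - κ) * (z + κ)) = 0 := by
    linear_combination hz + (-z ^ 2 + 1) * hκ
  rcases mul_eq_zero.1 h with h | h
  · rcases mul_eq_zero.1 h with h | h
    · exact ⟨1, by decide, by rw [map_one]; linear_combination -h⟩
    · exact ⟨-1, by decide, by rw [map_neg, map_one]; linear_combination -h⟩
  · rcases mul_eq_zero.1 h with h | h
    · exact ⟨gaussI, by decide, by rw [gaussLift_gaussI]; linear_combination -h⟩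
    · exact ⟨-gaussI, by decide, by rw [map_neg, gaussLift_gaussI]; linear_combination -h⟩

/-- If `z ^ m` runs through the fourth roots of unity on an injective family of `4 m - 1` elements
`z ≠ z₀`, then each value is taken `m` times, except that the value `z₀ ^ m` is taken `m - 1`
times; so the power sums of the values are minus the powers of `z₀ ^ m`. -/
theorem sum_pow_of_fourth_roots {α K : Type*} [Field K]
    {κ : K} (hκ : κ * κ = -1) {m : ℕ} (hm : 0 < m) (A : Finset α) (hA : A.card + 1 = 4 * m)
    (Z : α → K) (hZ : Set.InjOn Z A) (z₀ : K) (hz₀ : ∀ x ∈ A, Z x ≠ z₀) (θ : α → GaussianInt)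
    (hθ : ∀ x ∈ A, θ x ^ 4 = 1) (hθZ : ∀ x ∈ A, gaussLift κ hκ (θ x) = Z x ^ m)
    (w₀ : GaussianInt) (hw₀ : w₀ ^ 4 = 1) (hw₀z : gaussLift κ hκ w₀ = z₀ ^ m) (e : ℕ) :
    ∑ x ∈ A, θ x ^ e = (if 4 ∣ e then 4 * (m : GaussianInt) else 0) - w₀ ^ e := by
  classical
  set N : GaussianInt → ℕ := fun w => (A.filter (fun x => θ x = w)).card with hN
  have hbound : ∀ w : GaussianInt, N w + (if w = w₀ then 1 else 0) ≤ m := by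
    intro w
    set R := (Polynomial.nthRoots m (gaussLift κ hκ w)).toFinset with hR
    have hRc : R.card ≤ m :=
      (Multiset.toFinset_card_le _).trans (Polynomial.card_nthRoots _ _)
    have hmap : (A.filter (fun x => θ x = w)).image Z ⊆ R := by
      intro z hz
      obtain ⟨x, hx, rfl⟩ := Finset.mem_image.1 hz
      obtain ⟨hxA, hxw⟩ := Finset.mem_filter.1 hx
      rw [hR, Multiset.mem_toFinset, Polynomial.mem_nthRoots hm, ← hθZ x hxA, hxw]
    have hcard : ((A.filter (fun x => θ x = w)).image Z).card = N w :=
      Finset.card_image_of_injOn fun x hx y hy hxy =>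
        hZ (Finset.mem_filter.1 hx).1 (Finset.mem_filter.1 hy).1 hxy
    split_ifs with hw
    · have hz₀R : z₀ ∈ R := by
        rw [hR, Multiset.mem_toFinset, Polynomial.mem_nthRoots hm, hw, hw₀z]
      have hz₀n : z₀ ∉ (A.filter (fun x => θ x = w)).image Z := by
        intro h
        obtain ⟨x, hx, hxz⟩ := Finset.mem_image.1 h
        exact hz₀ x (Finset.mem_filter.1 hx).1 hxz
      have := Finset.card_le_card (Finset.insert_subset hz₀R hmap)
      rw [Finset.card_insert_of_notMem hz₀n, hcard] at this
      exact this.trans hRc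
    · rw [add_zero, ← hcard]
      exact (Finset.card_le_card hmap).trans hRc
  set W : Finset GaussianInt := {1, gaussI, -1, -gaussI} with hW
  have hmem : ∀ z : GaussianInt, z ^ 4 = 1 → z ∈ W := fun z hz => by
    rcases gaussian_pow_four_cases hz with rfl | rfl | rfl | rfl <;> simp [hW]
  have hsumW : ∀ f : GaussianInt → GaussianInt,
      ∑ w ∈ W, f w = f 1 + f gaussI + f (-1) + f (-gaussI) := by
    intro f
    rw [hW, Finset.sum_insert (by decide), Finset.sum_insert (by decide),
      Finset.sum_insert (by decide), Finset.sum_singleton]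
    ring
  have hWcard : W.card = 4 := by rw [hW]; decide
  have htotal : A.card = ∑ w ∈ W, N w :=
    Finset.card_eq_sum_card_fiberwise fun x hx => hmem _ (hθ x hx)
  have hexact : ∀ w ∈ W, N w + (if w = w₀ then 1 else 0) = m := by
    have h1 : ∑ w ∈ W, (N w + (if w = w₀ then 1 else 0)) = ∑ w ∈ W, m := by
      rw [Finset.sum_add_distrib, ← htotal, Finset.sum_ite_eq', if_pos (hmem _ hw₀), hA,
        Finset.sum_const, hWcard, smul_eq_mul]
    exact (Finset.sum_eq_sum_iff_of_le fun w _ => hbound w).1 h1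
  have hfib : ∑ x ∈ A, θ x ^ e = ∑ w ∈ W, (N w : GaussianInt) * w ^ e := by
    rw [← Finset.sum_fiberwise_of_maps_to (fun x hx => hmem _ (hθ x hx))]
    refine Finset.sum_congr rfl fun w _ => ?_
    rw [Finset.sum_congr rfl fun x hx => by rw [(Finset.mem_filter.1 hx).2], Finset.sum_const,
      nsmul_eq_mul]
  have hterm : ∀ w ∈ W, (N w : GaussianInt) * w ^ e =
      m * w ^ e - (if w = w₀ then w ^ e else 0) := by
    intro w hw
    have := congrArg (Nat.cast (R := GaussianInt)) (hexact w hw)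
    push_cast at this
    rw [← this]
    split_ifs <;> ring
  rw [hfib, Finset.sum_congr rfl hterm, Finset.sum_sub_distrib, Finset.sum_ite_eq',
    if_pos (hmem _ hw₀), ← Finset.mul_sum, hsumW, sum_fourth_roots_pow]
  split_ifs <;> ring

/-- The defining properties of the local symbol at the odd prime `l`: its values at the residues
`x` with `r² + x² ≠ 0` are fourth roots of unity with the power sums given by orthogonality on the
norm-one torus, and it computes the quartic symbol of `l*` modulo `r + x i`. The values at the other
residues do not matter. -/
structure IsLocalSymbol (r : ℤ) (l : ℕ) [Fact l.Prime] (θ : ZMod l → GaussianInt) : Prop where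
  pow_four : ∀ x : ZMod l, (r : ZMod l) ^ 2 + x ^ 2 ≠ 0 → θ x ^ 4 = 1
  sum_pow_of_dvd : (l : ℤ) ∣ r → ∀ e : ℕ,
    ∑ x : ZMod l with (r : ZMod l) ^ 2 + x ^ 2 ≠ 0, θ x ^ e =
      (admCount r l : GaussianInt) * (valueAtInfinity r l : GaussianInt) ^ e
  sum_pow_of_not_dvd : ¬ (l : ℤ) ∣ r → ∀ e : ℕ,
    ∑ x : ZMod l with (r : ZMod l) ^ 2 + x ^ 2 ≠ 0, θ x ^ e =
      (if 4 ∣ e then (admCount r l : GaussianInt) + 1 else 0) -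
        (valueAtInfinity r l : GaussianInt) ^ e
  apply_signedPrime : ∀ (p : ℕ) [Fact p.Prime] (ι : ZMod p) (hι : ι * ι = -1)
    (χ : MulChar (ZMod p) GaussianInt), IsQuarticChar ι hι χ → p % 4 = 1 → l ≠ p →
    ∀ (x : ℤ) (u : GaussianInt), (p : ℤ) = r ^ 2 + x ^ 2 → u ^ 4 = 1 → u ^ 2 = (unitSq r : ℤ) →
      -jacobiSum χ (χ ^ 2) = u * ⟨r, x⟩ → χ ((signedPrime l : ℤ) : ZMod p) = θ x

/-- The local symbol exists: its value at `x` is the fourth root of unity in characteristic `l` that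
quartic reciprocity gives, `(±(r + x i) / (r - x i)) ^ m` up to conjugation, where `4 m` is the
order of the norm-one torus. For `l ∤ r` the elements `±(r + x i) / (r - x i)` run through the torus
without the value at `x = ∞`; for `l ∣ r` all of them are equal to that value. -/
theorem exists_isLocalSymbol {l : ℕ} [Fact l.Prime] (hl2 : l ≠ 2) (r : ℤ) :
    ∃ θ, IsLocalSymbol r l θ := by
  classical
  have hlp : l.Prime := Fact.out
  have hodd := Nat.odd_iff.1 (hlp.odd_of_ne_two hl2)
  have hl4 : l % 4 = 1 ∨ l % 4 = 3 := by omega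
  set K := AlgebraicClosure (ZMod l)
  have hchar : CharP K l := charP_of_injective_algebraMap (algebraMap (ZMod l) K).injective l
  have hK : (-1 : K) ≠ 1 :=
    Ring.neg_one_ne_one_of_char_ne_two (R := K) (by rw [ringChar.eq K l]; exact hl2)
  have hK2 : (2 : K) ≠ 0 := fun h => hK (by linear_combination -h)
  obtain ⟨κ, hκ'⟩ := IsAlgClosed.exists_pow_nat_eq (-1 : K) (n := 2) two_pos
  have hκ : κ * κ = -1 := by rw [← sq, hκ']
  have hκ0 : κ ≠ 0 := by rintro h; rw [h, zero_mul] at hκ; exact hK (by linear_combination -2 * hκ)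
  set f := gaussLift κ hκ with hf
  set c : K := ((ZMod.χ₄ l : ℤ) : K) with hc
  set m := torusQuarter l with hm
  have hm4 := torusQuarter_spec hlp hl2
  rw [← hm] at hm4
  have hc1 : l % 4 = 1 → c = 1 := fun h => by rw [hc, ZMod.χ₄_nat_one_mod_four h]; simp
  have hc3 : l % 4 = 3 → c = -1 := fun h => by rw [hc, ZMod.χ₄_nat_three_mod_four h]; simp
  have hm1 : l % 4 = 1 → l = 4 * m + 1 := fun h => by
    rw [ZMod.χ₄_nat_one_mod_four h] at hm4; omega
  have hm3 : l % 4 = 3 → l + 1 = 4 * m := fun h => by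
    rw [ZMod.χ₄_nat_three_mod_four h] at hm4; omega
  have hc2 : c * c = 1 := by
    rcases hl4 with h | h
    · rw [hc1 h, one_mul]
    · rw [hc3 h]; ring
  have hc0 : c ≠ 0 := left_ne_zero_of_mul (by rw [hc2]; exact one_ne_zero)
  have hm0 : 0 < m := by
    have := hlp.two_le
    rcases hl4 with h | h
    · have := hm1 h; omega
    · have := hm3 h; omega
  set ρ : K := (r : K) with hρ
  set j := algebraMap (ZMod l) K with hj
  have hjr : j (r : ZMod l) = ρ := by rw [hj, map_intCast]
  set ε : K := ((unitSq r : ℤ) : K) with hε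
  have hε2 : ε * ε = 1 := by
    rcases unitSq_cases r with h | h <;> rw [hε, h] <;> push_cast <;> ring
  have hε0 : ε ≠ 0 := left_ne_zero_of_mul (by rw [hε2]; exact one_ne_zero)
  -- `A x` and `B x` are conjugate numbers `r ± x i` with product `r² + x²`
  set A : ZMod l → K := fun x => ρ + c * j x * κ with hA
  set B : ZMod l → K := fun x => ρ - c * j x * κ with hB
  have hAB : ∀ x, A x * B x = j ((r : ZMod l) ^ 2 + x ^ 2) := by
    intro x
    simp only [hA, hB]
    rw [map_add, map_pow, map_pow, hjr]
    linear_combination -(c * c * (j x) ^ 2) * hκ + (j x) ^ 2 * hc2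
  have hAB0 : ∀ x : ZMod l, (r : ZMod l) ^ 2 + x ^ 2 ≠ 0 → A x ≠ 0 ∧ B x ≠ 0 := by
    intro x hx
    have : A x * B x ≠ 0 := by
      rw [hAB]; exact (map_ne_zero _).2 hx
    exact ⟨left_ne_zero_of_mul this, right_ne_zero_of_mul this⟩
  have hjl : ∀ y : ZMod l, j y ^ l = j y := fun y => by rw [← map_pow, ZMod.pow_card]
  have hκl := gaussLift_pow_char (l := l) hκ gaussI
  rw [gaussLift_gaussI, show star gaussI = -gaussI from rfl, map_neg, gaussLift_gaussI] at hκl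
  have hcl : c ^ l = c := by
    have := hjl ((ZMod.χ₄ l : ℤ) : ZMod l)
    rwa [hj, map_intCast] at this
  have hρl : ρ ^ l = ρ := by rw [← hjr]; exact hjl _
  have hAB4 : ∀ x : ZMod l, (r : ZMod l) ^ 2 + x ^ 2 ≠ 0 → A x ^ (4 * m) = B x ^ (4 * m) := by
    intro x hx
    obtain ⟨hA0, hB0⟩ := hAB0 x hx
    have hAl : A x ^ l = ρ + c * j x * κ ^ l := by
      simp only [hA]; rw [add_pow_char, mul_pow, mul_pow, hjl, hcl, hρl]
    have hBl : B x ^ l = ρ - c * j x * κ ^ l := by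
      simp only [hB]; rw [sub_pow_char, mul_pow, mul_pow, hjl, hcl, hρl]
    rcases hl4 with h | h
    · rw [hκl.1 h] at hAl hBl
      have e1 : A x ^ (4 * m) = 1 := by
        apply mul_right_cancel₀ hA0; rw [← pow_succ, ← hm1 h, hAl, one_mul]
      have e2 : B x ^ (4 * m) = 1 := by
        apply mul_right_cancel₀ hB0; rw [← pow_succ, ← hm1 h, hBl, one_mul]
      rw [e1, e2]
    · rw [hκl.2 h] at hAl hBl
      rw [← hm3 h, pow_succ, pow_succ, hAl, hBl]
      simp only [hA, hB]; ring
  -- `ε = u²` accounts for the unit `u` that makes `r + x i` primary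
  set Z : ZMod l → K := fun x => ε * (A x / B x) with hZ
  have hZ4 : ∀ x : ZMod l, (r : ZMod l) ^ 2 + x ^ 2 ≠ 0 → (Z x ^ m) ^ 4 = 1 := by
    intro x hx
    have hB0 := (hAB0 x hx).2
    rw [← pow_mul, mul_comm m 4]
    simp only [hZ]
    rw [mul_pow, div_pow, hAB4 x hx, div_self (pow_ne_zero _ hB0), mul_one, pow_mul,
      show ε ^ 4 = (ε * ε) * (ε * ε) by ring, hε2, one_mul, one_pow]
  choose! θ hθ4 hθZ using fun (x : ZMod l) (hx : (r : ZMod l) ^ 2 + x ^ 2 ≠ 0) =>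
    exists_gaussLift_of_pow_four hκ (hZ4 x hx)
  have hw₀4 : ((valueAtInfinity r l : ℤ) : GaussianInt) ^ 4 = 1 := by
    rcases valueAtInfinity_cases r l with h | h <;> rw [h] <;> decide
  have hw₀ : f ((valueAtInfinity r l : ℤ) : GaussianInt) = (-ε) ^ m := by
    rw [map_intCast, valueAtInfinity, hε]; push_cast; rfl
  have hcard := card_filter_sq_add_sq_ne_zero hl2 r
  refine ⟨θ, ⟨hθ4, ?_, ?_, ?_⟩⟩
  · intro hlr e
    have hr0 : (r : ZMod l) = 0 := (ZMod.intCast_zmod_eq_zero_iff_dvd _ _).2 hlr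
    have hρ0 : ρ = 0 := by rw [← hjr, hr0, map_zero]
    have hconst : ∀ x ∈ Finset.univ.filter (fun x : ZMod l => (r : ZMod l) ^ 2 + x ^ 2 ≠ 0),
        θ x ^ e = ((valueAtInfinity r l : ℤ) : GaussianInt) ^ e := by
      intro x hx
      have hx' := (Finset.mem_filter.1 hx).2
      congr 1
      refine gaussLift_injOn_units hK hκ (hθ4 x hx') hw₀4 ?_
      change f _ = f _
      rw [hθZ x hx', hw₀]
      congr 1
      have hB0 := (hAB0 x hx').2
      have hAneg : A x = -B x := by simp only [hA, hB, hρ0]; ring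
      simp only [hZ]
      rw [hAneg, neg_div, div_self hB0]; ring
    rw [Finset.sum_congr rfl hconst, Finset.sum_const, nsmul_eq_mul]
    congr 1
    exact_mod_cast congrArg (Int.cast (R := GaussianInt)) hcard
  · intro hlr e
    have hρ0 : ρ ≠ 0 := by
      rw [← hjr]
      exact (map_ne_zero _).2 fun h => hlr ((ZMod.intCast_zmod_eq_zero_iff_dvd _ _).1 h)
    have hadm : admCount r l + 1 = 4 * m := by
      unfold admCount
      rw [jacobiSym_neg_four_mul_sq hlp (lt_of_le_of_ne hlp.two_le hl2.symm), if_neg hlr, hm4]; ring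
    have hcard' : (Finset.univ.filter
        (fun x : ZMod l => (r : ZMod l) ^ 2 + x ^ 2 ≠ 0)).card + 1 = 4 * m := by
      rw [← hcard] at hadm; exact_mod_cast hadm
    have key := sum_pow_of_fourth_roots hκ hm0 _ hcard' Z ?_ (-ε) ?_ θ
      (fun x hx => hθ4 x (Finset.mem_filter.1 hx).2) (fun x hx => hθZ x (Finset.mem_filter.1 hx).2)
      _ hw₀4 hw₀ e
    · rw [key]
      have : (admCount r l : GaussianInt) + 1 = 4 * (m : GaussianInt) := by
        have h1 := congrArg (Int.cast (R := GaussianInt)) hadm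
        push_cast at h1
        exact h1
      rw [this]
    · intro x hx y hy hxy
      have hBx := (hAB0 x (Finset.mem_filter.1 hx).2).2
      have hBy := (hAB0 y (Finset.mem_filter.1 hy).2).2
      simp only [hZ] at hxy
      have h1 := mul_left_cancel₀ hε0 hxy
      rw [div_eq_div_iff hBx hBy] at h1
      simp only [hA, hB] at h1
      have h2 : (2 * ρ * c * κ) * (j x - j y) = 0 := by linear_combination h1
      have h3 : (2 * ρ * c * κ) ≠ 0 :=
        mul_ne_zero (mul_ne_zero (mul_ne_zero hK2 hρ0) hc0) hκ0
      exact j.injective (sub_eq_zero.1 ((mul_eq_zero.1 h2).resolve_left h3))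
    · intro x hx hxe
      have hBx := (hAB0 x (Finset.mem_filter.1 hx).2).2
      simp only [hZ] at hxe
      have h1 : A x / B x = -1 := mul_left_cancel₀ hε0 (by rw [hxe]; ring)
      rw [div_eq_iff hBx] at h1
      simp only [hA, hB] at h1
      have h2 : 2 * ρ = 0 := by linear_combination h1
      exact mul_ne_zero hK2 hρ0 h2
  · intro p _ ι hι χ h hp hlp' x u hpr hu4 hu2 hJ
    have hpp : p.Prime := Fact.out
    have hx : (r : ZMod l) ^ 2 + (x : ZMod l) ^ 2 ≠ 0 := by
      intro h0
      have h1 : ((p : ℤ) : ZMod l) = 0 := by rw [hpr]; push_cast; exact h0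
      have h2 : l ∣ p := by exact_mod_cast (ZMod.intCast_zmod_eq_zero_iff_dvd _ _).1 h1
      exact hlp' ((Nat.prime_dvd_prime_iff_eq hlp hpp).1 h2)
    have hlu : (l : ZMod p) ≠ 0 := by
      rw [Ne, ZMod.natCast_eq_zero_iff, Nat.prime_dvd_prime_iff_eq hpp hlp]
      exact hlp'.symm
    have hB0 := (hAB0 x hx).2
    have hjx : j (x : ZMod l) = x := by rw [hj, map_intCast]
    have hfu : f u ^ 2 = ε := by rw [← map_pow, hu2, map_intCast]
    have hfu1 : f u * f (star u) = 1 := by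
      rw [← map_mul, gaussian_star_eq_pow_three hu4, ← pow_succ', hu4, map_one]
    have hfu' : f (star u) ^ 2 = ε := by
      have : (f u * f (star u)) ^ 2 = 1 := by rw [hfu1, one_pow]
      rw [mul_pow, hfu] at this
      calc f (star u) ^ 2 = ε * ε * f (star u) ^ 2 := by rw [hε2, one_mul]
        _ = ε * (ε * f (star u) ^ 2) := by ring
        _ = ε := by rw [this, mul_one]
    obtain ⟨r1, r3⟩ := h.reciprocity hp hl2 hlp' hκ (w := u * ⟨r, x⟩) hJ.symm
    rw [star_mul', ← hf, map_mul, map_mul] at r1 r3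
    have hstar : star (⟨r, x⟩ : GaussianInt) = ⟨r, -x⟩ := rfl
    rw [hstar] at r1 r3
    have hχ0 : ((signedPrime l : ℤ) : ZMod p) ≠ 0 := by
      unfold signedPrime
      push_cast
      refine mul_ne_zero ?_ hlu
      rcases hl4 with h | h
      · rw [ZMod.χ₄_nat_one_mod_four h]; simp
      · rw [ZMod.χ₄_nat_three_mod_four h]; simp
    refine gaussLift_injOn_units hK hκ (h.pow_four _ hχ0) (hθ4 x hx) ?_
    change f _ = f _
    rw [hθZ x hx]
    simp only [hZ]
    rw [mul_pow, div_pow, ← mul_div_assoc, eq_div_iff (pow_ne_zero _ hB0)]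
    rcases hl4 with h4 | h4
    · have hsp : ((signedPrime l : ℤ) : ZMod p) = l := by
        unfold signedPrime; rw [ZMod.χ₄_nat_one_mod_four h4]; push_cast; rw [one_mul]
      have e1 : f ⟨r, x⟩ = A x := by
        rw [hf, gaussLift_apply]; simp only [hA, hjx, hc1 h4, one_mul, hρ]
      have e2 : f ⟨r, -x⟩ = B x := by
        rw [hf, gaussLift_apply]; simp only [hB, hjx, hc1 h4, one_mul, hρ]; push_cast; ring
      have hmm : (l - 1) / 4 = m := by rw [hm, torusQuarter, if_pos h4]
      have r1 := r1 h4
      rw [e1, e2, hmm] at r1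
      rw [hsp, ← hfu]
      calc f (χ l) * B x ^ m = f (χ l) * (f (star u) * B x) ^ m * f u ^ m := by
            rw [mul_pow]
            calc _ = f (χ l) * B x ^ m * (f u * f (star u)) ^ m := by rw [hfu1, one_pow, mul_one]
              _ = _ := by rw [mul_pow]; ring
        _ = _ := by rw [r1, mul_pow, sq, mul_pow, mul_right_comm]
    · have hsp : ((signedPrime l : ℤ) : ZMod p) = -l := by
        unfold signedPrime; rw [ZMod.χ₄_nat_three_mod_four h4]; push_cast; ring
      have e1 : f ⟨r, x⟩ = B x := by
        rw [hf, gaussLift_apply]; simp only [hB, hjx, hc3 h4, hρ]; ring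
      have e2 : f ⟨r, -x⟩ = A x := by
        rw [hf, gaussLift_apply]; simp only [hA, hjx, hc3 h4, hρ]; push_cast; ring
      have hmm : (l + 1) / 4 = m := by rw [hm, torusQuarter, if_neg (by omega)]
      have r3 := r3 h4
      rw [e1, e2, hmm] at r3
      rw [hsp, ← hfu']
      calc f (χ (-l)) * B x ^ m = f (χ (-l)) * (f u * B x) ^ m * f (star u) ^ m := by
            rw [mul_pow]
            calc _ = f (χ (-l)) * B x ^ m * (f u * f (star u)) ^ m := by
                  rw [hfu1, one_pow, mul_one]
              _ = _ := by rw [mul_pow]; ring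
        _ = _ := by rw [r3, mul_pow, sq, mul_pow, mul_right_comm]

/-! ### The condition `a_p = 2r` as a congruence condition on `x` -/

/-- The exponent of `l` in `D`. -/
def valAt (D : ℤ) (l : ℕ) : ℕ := padicValNat l D.natAbs

theorem oddPrimeFactors_spec {D : ℤ} {l : ℕ} (hl : l ∈ oddPrimeFactors D) : l.Prime ∧ l ≠ 2 := by
  rw [oddPrimeFactors, Finset.mem_filter] at hl
  exact ⟨Nat.prime_of_mem_primeFactors hl.1, hl.2⟩

theorem dvd_two_mul_iff {D : ℤ} (hD : D ≠ 0) {q : ℕ} (hq : q.Prime) :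
    (q : ℤ) ∣ 2 * D ↔ q = 2 ∨ q ∈ oddPrimeFactors D := by
  rw [(Nat.prime_iff_prime_int.1 hq).dvd_mul, oddPrimeFactors, Finset.mem_filter,
    Nat.mem_primeFactors]
  have h2 : (q : ℤ) ∣ 2 ↔ q = 2 := by
    rw [← Nat.prime_dvd_prime_iff_eq hq Nat.prime_two]
    exact Int.natCast_dvd_natCast (m := q) (n := 2)
  have h3 : (q : ℤ) ∣ D ↔ q ∣ D.natAbs := Int.natCast_dvd
  rw [h2, h3]
  have := Int.natAbs_ne_zero.2 hD
  tauto

/-- The sign `s` for which `-D = s · 2 ^ v · ∏ (l*) ^ v_l`. -/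
def signPart (D : ℤ) : ℤ := -D.sign * ∏ l ∈ oddPrimeFactors D, (ZMod.χ₄ l : ℤ) ^ valAt D l

theorem chi_four_cases {l : ℕ} (hl : l.Prime) (hl2 : l ≠ 2) :
    (ZMod.χ₄ l : ℤ) = 1 ∨ (ZMod.χ₄ l : ℤ) = -1 := by
  have hodd := Nat.odd_iff.1 (hl.odd_of_ne_two hl2)
  rw [ZMod.χ₄_nat_eq_if_mod_four, if_neg (by omega)]
  split_ifs <;> simp

theorem chi_four_sq {l : ℕ} (hl : l.Prime) (hl2 : l ≠ 2) : (ZMod.χ₄ l : ℤ) ^ 2 = 1 := by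
  rcases chi_four_cases hl hl2 with h | h <;> rw [h] <;> rfl

theorem signPart_cases {D : ℤ} (hD : D ≠ 0) : signPart D = 1 ∨ signPart D = -1 := by
  have h : signPart D ^ 2 = 1 := by
    rw [signPart, mul_pow, neg_sq, ← Finset.prod_pow, Finset.prod_eq_one, mul_one]
    · rcases lt_or_gt_of_ne hD with h | h
      · rw [Int.sign_eq_neg_one_of_neg h]; rfl
      · rw [Int.sign_eq_one_of_pos h]; rfl
    · intro l hl
      obtain ⟨hp, h2⟩ := oddPrimeFactors_spec hl
      rw [← pow_mul, mul_comm, pow_mul, chi_four_sq hp h2, one_pow]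
  exact sq_eq_one_iff.1 h

theorem natAbs_eq_two_pow_mul_prod {D : ℤ} (hD : D ≠ 0) :
    D.natAbs = 2 ^ valAt D 2 * ∏ l ∈ oddPrimeFactors D, l ^ valAt D l := by
  have hn := Int.natAbs_ne_zero.2 hD
  have h1 : D.natAbs = ∏ l ∈ D.natAbs.primeFactors, l ^ valAt D l := by
    conv_lhs => rw [← Nat.prod_factorization_pow_eq_self hn]
    refine Finset.prod_congr rfl fun l hl => ?_
    rw [valAt, Nat.factorization_def _ (Nat.prime_of_mem_primeFactors hl)]
  conv_lhs => rw [h1, ← Finset.prod_filter_mul_prod_filter_not _ (fun l => l = 2)]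
  congr 1
  rw [Finset.filter_eq']
  split_ifs with h
  · rw [Finset.prod_singleton]
  · rw [Finset.prod_empty, valAt, padicValNat.eq_zero_of_not_dvd, pow_zero]
    intro h2
    exact h (Nat.mem_primeFactors.2 ⟨Nat.prime_two, h2, hn⟩)

theorem neg_eq_signPart_mul {D : ℤ} (hD : D ≠ 0) :
    -D = signPart D * 2 ^ valAt D 2 * ∏ l ∈ oddPrimeFactors D, signedPrime l ^ valAt D l := by
  have h1 : D = D.sign * D.natAbs := (Int.sign_mul_natAbs D).symm
  have h2 : ∏ l ∈ oddPrimeFactors D, signedPrime l ^ valAt D l =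
      (∏ l ∈ oddPrimeFactors D, (ZMod.χ₄ l : ℤ) ^ valAt D l) *
        ∏ l ∈ oddPrimeFactors D, (l : ℤ) ^ valAt D l := by
    rw [← Finset.prod_mul_distrib]
    exact Finset.prod_congr rfl fun l _ => by rw [signedPrime, mul_pow]
  have h3 : (∏ l ∈ oddPrimeFactors D, (ZMod.χ₄ l : ℤ) ^ valAt D l) ^ 2 = 1 := by
    rw [← Finset.prod_pow]
    refine Finset.prod_eq_one fun l hl => ?_
    obtain ⟨hp, h2⟩ := oddPrimeFactors_spec hl
    rw [← pow_mul, mul_comm, pow_mul, chi_four_sq hp h2, one_pow]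
  have h4 : (D.natAbs : ℤ) = 2 ^ valAt D 2 * ∏ l ∈ oddPrimeFactors D, (l : ℤ) ^ valAt D l := by
    rw [natAbs_eq_two_pow_mul_prod hD]; push_cast; rfl
  rw [h2, signPart]
  conv_lhs => rw [h1, h4]
  set P := ∏ l ∈ oddPrimeFactors D, (ZMod.χ₄ l : ℤ) ^ valAt D l
  linear_combination (D.sign * 2 ^ valAt D 2 *
    ∏ l ∈ oddPrimeFactors D, (l : ℤ) ^ valAt D l) * h3

/-- A local symbol at the odd prime `l`, as a function of an integer. For other `l` the value is the
junk value `0`. -/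
noncomputable def localSymbol (r : ℤ) (l : ℕ) (x : ℤ) : GaussianInt :=
  if h : l.Prime ∧ l ≠ 2 then
    haveI := Fact.mk h.1
    (exists_isLocalSymbol h.2 r).choose (x : ZMod l)
  else 0

theorem exists_localSymbol_eq {l : ℕ} [hl : Fact l.Prime] (hl2 : l ≠ 2) (r : ℤ) :
    ∃ θ : ZMod l → GaussianInt, IsLocalSymbol r l θ ∧ ∀ x : ℤ, localSymbol r l x = θ x :=
  ⟨(exists_isLocalSymbol hl2 r).choose, (exists_isLocalSymbol hl2 r).choose_spec, fun x => by
    rw [localSymbol, dif_pos ⟨hl.out, hl2⟩]⟩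

/-- The exponent of the power of `i` that the sign and the prime `2` contribute to the quartic
symbol of `-D`, together with the unit that makes `r + x i` primary. -/
def twoExponent (D r x : ℤ) : ℤ :=
  if Odd r then valAt D 2 * (r * (x / 2)) + (1 - signPart D) * (x / 2) + (r + x - 1)
  else (1 - signPart D) * (r / 2) - valAt D 2 * (x * (r / 2)) + (r + x)

/-- The quartic symbol that decides, for `p = r² + x²`, whether `a_p = 2r`. It depends only on
`x` modulo `8 ∏ l`. -/
noncomputable def traceSymbol (D r x : ℤ) : GaussianInt :=
  gaussIPow (twoExponent D r x) * ∏ l ∈ oddPrimeFactors D, localSymbol r l x ^ valAt D l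

/-- The residues `x` for which `r² + x²` is prime to `2 D`. -/
def Admissible (D r x : ℤ) : Prop :=
  Odd (r + x) ∧ ∀ l ∈ oddPrimeFactors D, ¬ (l : ℤ) ∣ r ^ 2 + x ^ 2

instance (D r x : ℤ) : Decidable (Admissible D r x) := by unfold Admissible; infer_instance

theorem mod_four_of_prime_sq_add_sq {p : ℕ} (hp : p.Prime) (hp2 : p ≠ 2) {r x : ℤ}
    (hpr : (p : ℤ) = r ^ 2 + x ^ 2) :
    p % 4 = 1 ∧ ((Odd r ∧ Even x) ∨ (Even r ∧ Odd x)) := by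
  have hodd := Nat.odd_iff.1 (hp.odd_of_ne_two hp2)
  rcases Int.even_or_odd r with hr | hr <;> rcases Int.even_or_odd x with hx | hx
  · obtain ⟨a, rfl⟩ := hr
    obtain ⟨b, rfl⟩ := hx
    have : (p : ℤ) = 2 * (2 * (a ^ 2 + b ^ 2)) := by rw [hpr]; ring
    omega
  · have h2 := Int.sq_mod_four_eq_one_of_odd hx
    obtain ⟨a, rfl⟩ := hr
    have : (p : ℤ) = 4 * a ^ 2 + x ^ 2 := by rw [hpr]; ring
    exact ⟨by omega, Or.inr ⟨⟨a, rfl⟩, hx⟩⟩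
  · have h2 := Int.sq_mod_four_eq_one_of_odd hr
    obtain ⟨a, rfl⟩ := hx
    have : (p : ℤ) = r ^ 2 + 4 * a ^ 2 := by rw [hpr]; ring
    exact ⟨by omega, Or.inl ⟨hr, ⟨a, rfl⟩⟩⟩
  · have h1 := Int.sq_mod_four_eq_one_of_odd hr
    have h2 := Int.sq_mod_four_eq_one_of_odd hx
    omega

/-- For a prime `p = r² + x²` of good reduction, `a_p = 2r` exactly when the trace symbol of `x`
is `1`. -/
theorem frobeniusTrace_eq_two_mul_iff {D r x : ℤ} (hD : D ≠ 0) (hr : r ≠ 0) {p : ℕ}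
    (hp : p.Prime) (hpD : ¬ (p : ℤ) ∣ 2 * D) (hpr : (p : ℤ) = r ^ 2 + x ^ 2) :
    frobeniusTrace (curveE D) p = 2 * r ↔ traceSymbol D r x = 1 := by
  have : Fact p.Prime := ⟨hp⟩
  have hp2 : p ≠ 2 := by rintro rfl; exact hpD (dvd_mul_right _ _)
  obtain ⟨hp4, hpar⟩ := mod_four_of_prime_sq_add_sq hp hp2 hpr
  have hsum : (r : ZMod p) ^ 2 + (x : ZMod p) ^ 2 = 0 := by
    have h1 : ((p : ℤ) : ZMod p) = ((r ^ 2 + x ^ 2 : ℤ) : ZMod p) := by rw [hpr]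
    push_cast at h1
    rw [← h1, ZMod.natCast_self]
  have hx0 : (x : ZMod p) ≠ 0 := by
    intro h0
    have hpx : (p : ℤ) ∣ x := (ZMod.intCast_zmod_eq_zero_iff_dvd _ _).1 h0
    rw [h0] at hsum
    have hr0 : (r : ZMod p) = 0 := by
      refine pow_eq_zero_iff two_ne_zero |>.1 ?_
      rw [← hsum]; ring
    have hpr' : (p : ℤ) ∣ r := (ZMod.intCast_zmod_eq_zero_iff_dvd _ _).1 hr0
    have h2 : (p : ℤ) ^ 2 ∣ p := by
      conv_rhs => rw [hpr]
      exact dvd_add (pow_dvd_pow_of_dvd hpr' 2) (pow_dvd_pow_of_dvd hpx 2)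
    have h3 : p ^ 2 ∣ p := by exact_mod_cast h2
    have h4 := Nat.le_of_dvd hp.pos h3
    nlinarith [hp.two_le]
  -- with this root of `-1` the prime ideal of `χ` is the one that contains `r + x i`
  set ι : ZMod p := -r / x with hιdef
  have hrx : (r : ZMod p) + x * ι = 0 := by rw [hιdef]; field_simp; ring
  have hι : ι * ι = -1 := by
    rw [hιdef]; field_simp; linear_combination hsum
  obtain ⟨χ, hχ⟩ := exists_isQuarticChar hp4 ι hι
  obtain ⟨u, hu4, hu, hiff⟩ := hχ.frobeniusTrace_eq_iff hp4 hpD hr hpr hrx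
  rw [hiff]
  have hprim : (⟨2, 2⟩ : GaussianInt) ∣ u * ⟨r, x⟩ - 1 := by
    rw [← hu]
    have := hχ.jacobiSum_congr hp4
    rw [show -jacobiSum χ (χ ^ 2) - 1 = -(jacobiSum χ (χ ^ 2) + 1) by ring]
    exact (dvd_neg).2 this
  have hstar := star_unit_eq_of_primary hpar hu4 hprim
  have hu1 : u * star u = 1 := by rw [gaussian_star_eq_pow_three hu4, ← pow_succ', hu4]
  have hu2 : u ^ 2 = (unitSq r : ℤ) := by
    have h1 : (star u) ^ 2 = (unitSq r : ℤ) := by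
      rw [hstar, unitSq]
      have hpar2 : (Odd r ∧ (r + x - 1) % 2 = 0) ∨ (¬ Odd r ∧ (r + x) % 2 = 1) := by
        rcases hpar with ⟨h1, h2⟩ | ⟨h1, h2⟩
        · left; refine ⟨h1, ?_⟩
          rw [Int.odd_iff] at h1; rw [Int.even_iff] at h2; omega
        · right; refine ⟨Int.not_odd_iff_even.2 h1, ?_⟩
          rw [Int.even_iff] at h1; rw [Int.odd_iff] at h2; omega
      rcases hpar2 with ⟨h1, h2⟩ | ⟨h1, h2⟩
      · rw [if_pos h1, if_pos h1]
        rcases gaussIPow_cases (r + x - 1) with ⟨h, e⟩ | ⟨h, e⟩ | ⟨h, e⟩ | ⟨h, e⟩ <;>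
          first | (exfalso; omega) | (rw [e]; decide)
      · rw [if_neg h1, if_neg h1]
        rcases gaussIPow_cases (r + x) with ⟨h, e⟩ | ⟨h, e⟩ | ⟨h, e⟩ | ⟨h, e⟩ <;>
          first | (exfalso; omega) | (rw [e]; decide)
    have h2 : u ^ 2 * star u ^ 2 = 1 := by rw [← mul_pow, hu1, one_pow]
    rw [h1] at h2
    rcases unitSq_cases r with h | h <;> rw [h] at h2 ⊢
    · simpa using h2
    · push_cast at h2 ⊢; linear_combination -h2
  have hval : χ ((-D : ℤ) : ZMod p) * star u = traceSymbol D r x := by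
    have hloc : ∀ l ∈ oddPrimeFactors D, χ ((signedPrime l : ℤ) : ZMod p) = localSymbol r l x := by
      intro l hl
      obtain ⟨hlp, hl2⟩ := oddPrimeFactors_spec hl
      have : Fact l.Prime := ⟨hlp⟩
      obtain ⟨θ, hθ, hθe⟩ := exists_localSymbol_eq hl2 r
      rw [hθe]
      refine hθ.apply_signedPrime p ι hι χ hχ hp4 ?_ x u hpr hu4 hu2 hu
      rintro rfl
      exact hpD ((dvd_two_mul_iff hD hlp).2 (Or.inr hl))
    rw [neg_eq_signPart_mul hD]
    push_cast
    rw [map_mul, map_mul, map_pow, map_prod, traceSymbol, hstar,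
      hχ.apply_sign hp4 hpr (signPart_cases hD), hχ.apply_two hp4 hpr hrx]
    have hprod : ∏ l ∈ oddPrimeFactors D, χ (((signedPrime l : ℤ) : ZMod p) ^ valAt D l) =
        ∏ l ∈ oddPrimeFactors D, localSymbol r l x ^ valAt D l :=
      Finset.prod_congr rfl fun l hl => by rw [map_pow, hloc l hl]
    rw [hprod, twoExponent]
    split_ifs with hodd
    · rw [gaussIPow_add, gaussIPow_add, gaussIPow_nsmul]; ring
    · rw [show (1 - signPart D) * (r / 2) - valAt D 2 * (x * (r / 2)) + (r + x) =
          (1 - signPart D) * (r / 2) + valAt D 2 * (-(x * (r / 2))) + (r + x) by ring,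
        gaussIPow_add _ (r + x), gaussIPow_add ((1 - signPart D) * (r / 2)), gaussIPow_nsmul]
      ring
  rw [← hval]
  constructor
  · intro h; rw [h, hu1]
  · intro h
    calc _ = χ ((-D : ℤ) : ZMod p) * star u * u := by
          rw [mul_assoc, mul_comm (star u), hu1, mul_one]
      _ = u := by rw [h, one_mul]

/-! ### Counting residues with trivial trace symbol -/

theorem sum_range_mul_of_coprime {R : Type*} [CommSemiring R] {m n : ℕ} (hm : 0 < m) (hn : 0 < n)
    (h : m.Coprime n) {F G : ℕ → R} (hF : ∀ x, F (x % m) = F x) (hG : ∀ x, G (x % n) = G x) :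
    ∑ x ∈ Finset.range (m * n), F x * G x =
      (∑ x ∈ Finset.range m, F x) * ∑ x ∈ Finset.range n, G x := by
  rw [Finset.sum_mul_sum, ← Finset.sum_product']
  refine Finset.sum_nbij' (fun x => (x % m, x % n))
    (fun y => (Nat.chineseRemainder h y.1 y.2 : ℕ)) ?_ ?_ ?_ ?_ ?_
  · intro x _
    exact Finset.mem_product.2
      ⟨Finset.mem_range.2 (Nat.mod_lt _ hm), Finset.mem_range.2 (Nat.mod_lt _ hn)⟩
  · intro y _
    exact Finset.mem_range.2 (Nat.chineseRemainder_lt_mul h _ _ hm.ne' hn.ne')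
  · intro x hx
    have h2 := (Nat.chineseRemainder h (x % m) (x % n)).2
    have h3 : (Nat.chineseRemainder h (x % m) (x % n) : ℕ) ≡ x [MOD m * n] :=
      (Nat.modEq_and_modEq_iff_modEq_mul h).1
        ⟨h2.1.trans (Nat.mod_modEq _ _), h2.2.trans (Nat.mod_modEq _ _)⟩
    exact Nat.ModEq.eq_of_lt_of_lt h3 (Nat.chineseRemainder_lt_mul h _ _ hm.ne' hn.ne')
      (Finset.mem_range.1 hx)
  · intro y hy
    have h2 := (Nat.chineseRemainder h y.1 y.2).2
    obtain ⟨hy1, hy2⟩ := Finset.mem_product.1 hy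
    refine Prod.ext ?_ ?_
    · exact Eq.trans h2.1 (Nat.mod_eq_of_lt (Finset.mem_range.1 hy1))
    · exact Eq.trans h2.2 (Nat.mod_eq_of_lt (Finset.mem_range.1 hy2))
  · intro x _
    simp only [hF, hG]

/-- The Chinese remainder theorem for sums of products of periodic functions. -/
theorem sum_range_mul_prod {R : Type*} [CommSemiring R] {n : ℕ} (hn : 0 < n) (S : Finset ℕ)
    (hS : ∀ l ∈ S, l.Prime) (hSn : ∀ l ∈ S, n.Coprime l) {F : ℕ → R} {G : ℕ → ℕ → R}
    (hF : ∀ x, F (x % n) = F x) (hG : ∀ l ∈ S, ∀ x, G l (x % l) = G l x) :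
    ∑ x ∈ Finset.range (n * ∏ l ∈ S, l), F x * ∏ l ∈ S, G l x =
      (∑ x ∈ Finset.range n, F x) * ∏ l ∈ S, ∑ x ∈ Finset.range l, G l x := by
  classical
  induction S using Finset.induction_on with
  | empty => simp
  | insert q S hq ih =>
    have hS' : ∀ l ∈ S, l.Prime := fun l hl => hS l (Finset.mem_insert_of_mem hl)
    have hqp := hS q (Finset.mem_insert_self _ _)
    have hpos : 0 < ∏ l ∈ S, l := Finset.prod_pos fun l hl => (hS' l hl).pos
    have hcop : (n * ∏ l ∈ S, l).Coprime q := by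
      refine Nat.Coprime.mul_left (hSn q (Finset.mem_insert_self _ _)) ?_
      refine Nat.Coprime.prod_left fun l hl => (Nat.coprime_primes (hS' l hl) hqp).2 ?_
      rintro rfl; exact hq hl
    have ih' := ih hS' (fun l hl => hSn l (Finset.mem_insert_of_mem hl))
      (fun l hl => hG l (Finset.mem_insert_of_mem hl))
    have key := sum_range_mul_of_coprime (Nat.mul_pos hn hpos) hqp.pos hcop
      (F := fun x => F x * ∏ l ∈ S, G l x) (G := G q) ?_ (hG q (Finset.mem_insert_self _ _))
    · rw [ih'] at key
      rw [Finset.prod_insert hq, Finset.prod_insert hq, mul_comm q, ← mul_assoc]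
      rw [show (∑ x ∈ Finset.range n, F x) * ((∑ x ∈ Finset.range q, G q x) *
        ∏ l ∈ S, ∑ x ∈ Finset.range l, G l x) = (∑ x ∈ Finset.range n, F x) *
        (∏ l ∈ S, ∑ x ∈ Finset.range l, G l x) * ∑ x ∈ Finset.range q, G q x by ring, ← key]
      refine Finset.sum_congr rfl fun x _ => ?_
      rw [Finset.prod_insert hq]; ring
    · intro x
      have h1 : F (x % (n * ∏ l ∈ S, l)) = F x := by
        rw [← hF, Nat.mod_mul_right_mod, hF]
      have h2 : ∀ l ∈ S, G l (x % (n * ∏ l ∈ S, l)) = G l x := fun l hl => by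
        rw [← hG l (Finset.mem_insert_of_mem hl),
          Nat.mod_mod_of_dvd _ ((Finset.dvd_prod_of_mem _ hl).mul_left n),
          hG l (Finset.mem_insert_of_mem hl)]
      simp only [h1, Finset.prod_congr rfl h2]

theorem sum_range_eq_sum_zmod {R : Type*} [AddCommMonoid R] {n : ℕ} [NeZero n] (f : ZMod n → R) :
    ∑ x ∈ Finset.range n, f x = ∑ x : ZMod n, f x := by
  refine Finset.sum_nbij' (fun x => (x : ZMod n)) ZMod.val ?_ ?_ ?_ ?_ ?_
  · intro x _; exact Finset.mem_univ _
  · intro x _; exact Finset.mem_range.2 (ZMod.val_lt x)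
  · intro x hx; exact ZMod.val_cast_of_lt (Finset.mem_range.1 hx)
  · intro x _; exact ZMod.natCast_zmod_val x
  · intro x _; rfl

/-- The modulus `8 ∏ l` of the trace symbol. -/
def traceModulus (D : ℤ) : ℕ := 8 * ∏ l ∈ oddPrimeFactors D, l

/-- The sum of the `e`-th powers of the local symbol at `l`. -/
def localFactor (r : ℤ) (l e : ℕ) : ℤ :=
  if (l : ℤ) ∣ r then admCount r l * valueAtInfinity r l ^ e
  else (if 4 ∣ e then admCount r l + 1 else 0) - valueAtInfinity r l ^ e

/-- The increment of `twoExponent` under `x ↦ x + 2`. -/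
def twoSlope (D r : ℤ) : ℤ :=
  if Odd r then valAt D 2 * r + 3 - signPart D else 2 * (1 - valAt D 2 * (r / 2))

/-- The value of `twoExponent` at `x = 0` or `x = 1`. -/
def twoBase (D r : ℤ) : ℤ :=
  if Odd r then r - 1 else (1 - signPart D) * (r / 2) - valAt D 2 * (r / 2) + r + 1

theorem twoExponent_eq (D : ℤ) {r x : ℤ} (h : Odd (r + x)) :
    twoExponent D r x = twoBase D r + (x / 2) * twoSlope D r := by
  unfold twoExponent twoBase twoSlope
  rw [Int.odd_iff] at h
  split_ifs with hr
  · rw [Int.odd_iff] at hr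
    have : x = 2 * (x / 2) := by omega
    set t := x / 2
    rw [this]; ring
  · rw [Int.odd_iff] at hr
    have : x = 2 * (x / 2) + 1 := by omega
    set t := x / 2
    rw [this]; ring

theorem sum_gaussIPow_mul (c : ℤ) :
    ∑ t ∈ Finset.range 4, gaussIPow (t * c) = if (4 : ℤ) ∣ c then 4 else 0 := by
  simp only [gaussIPow_nsmul, Finset.sum_range_succ, Finset.sum_range_zero]
  have h4 : (4 : ℤ) ∣ c ↔ c % 4 = 0 := Int.dvd_iff_emod_eq_zero
  rcases gaussIPow_cases c with ⟨h, e⟩ | ⟨h, e⟩ | ⟨h, e⟩ | ⟨h, e⟩ <;>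
    simp only [e, h4, h] <;> decide

theorem sum_range_eight_ite_odd {R : Type*} [AddCommMonoid R] (r : ℤ) (f : ℤ → R) :
    ∑ x ∈ Finset.range 8, (if Odd (r + ((x : ℕ) : ℤ)) then f ((x : ℤ) / 2) else 0) =
      ∑ t ∈ Finset.range 4, f ((t : ℕ) : ℤ) := by
  simp only [Finset.sum_range_succ, Finset.sum_range_zero]
  rcases Int.even_or_odd r with h | h
  · have e : ∀ k : ℤ, Even k → ¬ Odd (r + k) := fun k hk => Int.not_odd_iff_even.2 (h.add hk)
    have o : ∀ k : ℤ, Odd k → Odd (r + k) := fun k hk => h.add_odd hk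
    push_cast
    rw [if_neg (e 0 (by decide)), if_pos (o 1 (by decide)), if_neg (e 2 (by decide)),
      if_pos (o 3 (by decide)), if_neg (e 4 (by decide)), if_pos (o 5 (by decide)),
      if_neg (e 6 (by decide)), if_pos (o 7 (by decide))]
    norm_num
  · have e : ∀ k : ℤ, Odd k → ¬ Odd (r + k) := fun k hk => Int.not_odd_iff_even.2 (h.add_odd hk)
    have o : ∀ k : ℤ, Even k → Odd (r + k) := fun k hk => h.add_even hk
    push_cast
    rw [if_pos (o 0 (by decide)), if_neg (e 1 (by decide)), if_pos (o 2 (by decide)),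
      if_neg (e 3 (by decide)), if_pos (o 4 (by decide)), if_neg (e 5 (by decide)),
      if_pos (o 6 (by decide)), if_neg (e 7 (by decide))]
    norm_num

/-- The power sums of the contribution of the prime `2`. -/
theorem sum_twoExponent (D r : ℤ) (j : ℕ) :
    ∑ x ∈ Finset.range 8, (if Odd (r + ((x : ℕ) : ℤ)) then
      gaussIPow (twoExponent D r x) ^ j else 0) =
      if (4 : ℤ) ∣ j * twoSlope D r then 4 * gaussIPow (twoBase D r) ^ j else 0 := by
  have h1 : ∀ x ∈ Finset.range 8, (if Odd (r + ((x : ℕ) : ℤ)) then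
      gaussIPow (twoExponent D r x) ^ j else 0) = (if Odd (r + ((x : ℕ) : ℤ)) then
      (fun t : ℤ => gaussIPow (twoBase D r) ^ j * gaussIPow (t * (j * twoSlope D r))) ((x : ℤ) / 2)
      else 0) := by
    intro x _
    split_ifs with h
    · rw [twoExponent_eq D h, gaussIPow_add, mul_pow]
      congr 1
      rw [← gaussIPow_nsmul]
      congr 1; ring
    · rfl
  rw [Finset.sum_congr rfl h1, sum_range_eight_ite_odd r
    (fun t : ℤ => gaussIPow (twoBase D r) ^ j * gaussIPow (t * (j * twoSlope D r))),
    ← Finset.mul_sum, sum_gaussIPow_mul]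
  split_ifs <;> ring

/-- The power sums of the contribution of an odd prime. -/
theorem sum_localSymbol {l : ℕ} (hl : l.Prime) (hl2 : l ≠ 2) (r : ℤ) (e : ℕ) :
    ∑ x ∈ Finset.range l, (if ¬ (l : ℤ) ∣ r ^ 2 + ((x : ℕ) : ℤ) ^ 2 then
      localSymbol r l x ^ e else 0) = (localFactor r l e : GaussianInt) := by
  have : Fact l.Prime := ⟨hl⟩
  obtain ⟨θ, hθ, hθe⟩ := exists_localSymbol_eq hl2 r
  have h1 : ∀ x ∈ Finset.range l, (if ¬ (l : ℤ) ∣ r ^ 2 + ((x : ℕ) : ℤ) ^ 2 then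
      localSymbol r l x ^ e else 0) =
      (fun x : ZMod l => if (r : ZMod l) ^ 2 + x ^ 2 ≠ 0 then θ x ^ e else 0) (x : ℕ) := by
    intro x _
    have h2 : (l : ℤ) ∣ r ^ 2 + ((x : ℕ) : ℤ) ^ 2 ↔
        (r : ZMod l) ^ 2 + ((x : ℕ) : ZMod l) ^ 2 = 0 := by
      rw [← ZMod.intCast_zmod_eq_zero_iff_dvd]; push_cast; rfl
    simp only [h2, hθe, Int.cast_natCast, ne_eq]
  rw [Finset.sum_congr rfl h1, sum_range_eq_sum_zmod
    (fun x : ZMod l => if (r : ZMod l) ^ 2 + x ^ 2 ≠ 0 then θ x ^ e else 0),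
    ← Finset.sum_filter, localFactor]
  split_ifs with hlr h4
  · rw [hθ.sum_pow_of_dvd hlr]; push_cast; rfl
  · rw [hθ.sum_pow_of_not_dvd hlr, if_pos h4]; push_cast; rfl
  · rw [hθ.sum_pow_of_not_dvd hlr, if_neg h4]; push_cast; rfl

theorem localSymbol_congr {r x y : ℤ} {l : ℕ} (h : (l : ℤ) ∣ x - y) :
    localSymbol r l x = localSymbol r l y := by
  have : (x : ZMod l) = y := by
    rw [← sub_eq_zero, ← Int.cast_sub, ZMod.intCast_zmod_eq_zero_iff_dvd]; exact h
  unfold localSymbol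
  split_ifs with hl
  · simp only [this]
  · rfl

theorem localSymbol_pow_four {l : ℕ} (hl : l.Prime) (hl2 : l ≠ 2) {r x : ℤ}
    (h : ¬ (l : ℤ) ∣ r ^ 2 + x ^ 2) : localSymbol r l x ^ 4 = 1 := by
  have : Fact l.Prime := ⟨hl⟩
  obtain ⟨θ, hθ, hθe⟩ := exists_localSymbol_eq hl2 r
  rw [hθe]
  refine hθ.pow_four _ fun h0 => h ?_
  rw [← ZMod.intCast_zmod_eq_zero_iff_dvd]; push_cast; exact h0

theorem dvd_sq_add_sq_congr {r x y n : ℤ} (h : n ∣ x - y) :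
    n ∣ r ^ 2 + x ^ 2 ↔ n ∣ r ^ 2 + y ^ 2 := by
  have : r ^ 2 + x ^ 2 = r ^ 2 + y ^ 2 + (x - y) * (x + y) := by ring
  rw [this]
  exact dvd_add_left (h.mul_right _)

theorem traceSymbol_pow_four {D r x : ℤ} (h : Admissible D r x) : traceSymbol D r x ^ 4 = 1 := by
  rw [traceSymbol, mul_pow, gaussIPow_pow_four, one_mul, ← Finset.prod_pow]
  refine Finset.prod_eq_one fun l hl => ?_
  obtain ⟨hp, h2⟩ := oddPrimeFactors_spec hl
  rw [← pow_mul, mul_comm, pow_mul, localSymbol_pow_four hp h2 (h.2 l hl), one_pow]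

theorem eight_dvd_traceModulus (D : ℤ) : (8 : ℤ) ∣ traceModulus D := by
  rw [traceModulus]; push_cast; exact dvd_mul_right _ _

theorem dvd_traceModulus {D : ℤ} {l : ℕ} (hl : l ∈ oddPrimeFactors D) :
    (l : ℤ) ∣ traceModulus D := by
  rw [traceModulus]
  exact Int.natCast_dvd_natCast.2 ((Finset.dvd_prod_of_mem _ hl).mul_left 8)

theorem gaussIPow_twoExponent_congr {D r x y : ℤ} (hx : Odd (r + x)) (h : (8 : ℤ) ∣ x - y) :
    gaussIPow (twoExponent D r x) = gaussIPow (twoExponent D r y) := by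
  have hy : Odd (r + y) := by rw [Int.odd_iff] at hx ⊢; omega
  rw [twoExponent_eq D hx, twoExponent_eq D hy]
  apply gaussIPow_congr
  obtain ⟨k, hk⟩ := h
  have : x / 2 = y / 2 + 4 * k := by omega
  rw [this, show twoBase D r + (y / 2 + 4 * k) * twoSlope D r =
    twoBase D r + y / 2 * twoSlope D r + 4 * (k * twoSlope D r) by ring]
  omega

theorem admissible_congr {D r x y : ℤ} (h : (traceModulus D : ℤ) ∣ x - y) :
    Admissible D r x ↔ Admissible D r y := by
  have h8 := (eight_dvd_traceModulus D).trans h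
  unfold Admissible
  have h1 : Odd (r + x) ↔ Odd (r + y) := by rw [Int.odd_iff, Int.odd_iff]; omega
  rw [h1]
  refine and_congr_right fun _ => forall₂_congr fun l hl => not_congr ?_
  exact dvd_sq_add_sq_congr ((dvd_traceModulus hl).trans h)

theorem traceSymbol_congr {D r x y : ℤ} (hx : Admissible D r x) (h : (traceModulus D : ℤ) ∣ x - y) :
    traceSymbol D r x = traceSymbol D r y := by
  unfold traceSymbol
  rw [gaussIPow_twoExponent_congr hx.1 ((eight_dvd_traceModulus D).trans h)]
  congr 1
  exact Finset.prod_congr rfl fun l hl => by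
    rw [localSymbol_congr ((dvd_traceModulus hl).trans h)]

/-- The admissible residues modulo `traceModulus D`. -/
def admissibleResidues (D r : ℤ) : Finset ℕ :=
  (Finset.range (traceModulus D)).filter (fun x : ℕ => Admissible D r x)

/-- The power sums of the trace symbol factor over the prime `2` and the odd primes dividing `D`. -/
theorem sum_traceSymbol_pow (D r : ℤ) (j : ℕ) :
    ∑ x ∈ admissibleResidues D r, traceSymbol D r x ^ j =
      (if (4 : ℤ) ∣ j * twoSlope D r then 4 * gaussIPow (twoBase D r) ^ j else 0) *
        ∏ l ∈ oddPrimeFactors D, (localFactor r l (valAt D l * j) : GaussianInt) := by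
  have hprime : ∀ l ∈ oddPrimeFactors D, l.Prime := fun l hl => (oddPrimeFactors_spec hl).1
  have key := sum_range_mul_prod (R := GaussianInt) (n := 8) (by norm_num) (oddPrimeFactors D)
    hprime (fun l hl => ?_)
    (F := fun x : ℕ => if Odd (r + ((x : ℕ) : ℤ)) then gaussIPow (twoExponent D r x) ^ j else 0)
    (G := fun l x => if ¬ (l : ℤ) ∣ r ^ 2 + ((x : ℕ) : ℤ) ^ 2 then
      localSymbol r l x ^ (valAt D l * j) else 0) ?_ ?_
  · rw [sum_twoExponent, Finset.prod_congr rfl fun l hl => sum_localSymbol (hprime l hl)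
      (oddPrimeFactors_spec hl).2 r (valAt D l * j)] at key
    rw [← key, admissibleResidues, Finset.sum_filter, traceModulus]
    refine Finset.sum_congr rfl fun x _ => ?_
    by_cases h : Admissible D r x
    · rw [if_pos h, if_pos h.1, traceSymbol, mul_pow, ← Finset.prod_pow]
      congr 1
      exact Finset.prod_congr rfl fun l hl => by rw [if_pos (h.2 l hl), pow_mul]
    · rw [if_neg h]
      symm
      by_cases h1 : Odd (r + (x : ℤ))
      · have h2 : ∃ l ∈ oddPrimeFactors D, (l : ℤ) ∣ r ^ 2 + (x : ℤ) ^ 2 := by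
          by_contra h3
          push Not at h3
          exact h ⟨h1, h3⟩
        obtain ⟨l, hl, h2⟩ := h2
        rw [Finset.prod_eq_zero hl (by rw [if_neg (not_not.2 h2)]), mul_zero]
      · rw [if_neg h1, zero_mul]
  · obtain ⟨hp, h2⟩ := oddPrimeFactors_spec hl
    exact Nat.Coprime.pow_left 3 ((Nat.coprime_primes Nat.prime_two hp).2 h2.symm)
  · intro x
    have h8 : (8 : ℤ) ∣ ((x % 8 : ℕ) : ℤ) - x := by omega
    have h1 : Odd (r + ((x % 8 : ℕ) : ℤ)) ↔ Odd (r + (x : ℤ)) := by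
      rw [Int.odd_iff, Int.odd_iff]; omega
    by_cases h : Odd (r + (x : ℤ))
    · simp only [if_pos h, if_pos (h1.2 h)]
      rw [gaussIPow_twoExponent_congr (h1.2 h) h8]
    · simp only [if_neg h, if_neg (fun h' => h (h1.1 h'))]
  · intro l _ x
    have hl : (l : ℤ) ∣ ((x % l : ℕ) : ℤ) - x := by
      rw [Int.natCast_mod, ← Int.modEq_iff_dvd]; exact (Int.mod_modEq _ _).symm
    simp only [dvd_sq_add_sq_congr (r := r) hl, localSymbol_congr (r := r) hl]

/-- The residues `x` modulo `traceModulus D` for which the primes `p = r² + x²` have good reduction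
and `a_p = 2r`. -/
noncomputable def goodResidues (D r : ℤ) : Finset ℕ :=
  (admissibleResidues D r).filter (fun x : ℕ => traceSymbol D r x = 1)

theorem card_admissibleResidues (D r : ℤ) :
    ((admissibleResidues D r).card : ℤ) = 4 * ∏ l ∈ oddPrimeFactors D, admCount r l := by
  have h := sum_traceSymbol_pow D r 0
  have h1 : ∀ l, localFactor r l 0 = admCount r l := fun l => by
    unfold localFactor; split_ifs <;> simp_all
  simp only [pow_zero, mul_zero, h1, Finset.sum_const, nsmul_eq_mul, mul_one, Nat.cast_zero,
    zero_mul, dvd_zero, if_true] at h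
  have h2 : (((admissibleResidues D r).card : ℤ) : GaussianInt) =
      ((4 * ∏ l ∈ oddPrimeFactors D, admCount r l : ℤ) : GaussianInt) := by
    push_cast; exact h
  exact Int.cast_injective h2

theorem valueAtInfinity_pow_even {r : ℤ} {l e : ℕ} (he : Even e) : valueAtInfinity r l ^ e = 1 := by
  rcases valueAtInfinity_cases r l with h | h <;> rw [h]
  · exact one_pow _
  · exact he.neg_one_pow

theorem localFactor_mul_three (r : ℤ) (l v : ℕ) :
    localFactor r l (v * 3) = localFactor r l (v * 1) := by
  have h1 : valueAtInfinity r l ^ (v * 3) = valueAtInfinity r l ^ (v * 1) := by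
    rw [show v * 3 = v * 1 + v * 2 by ring, pow_add,
      valueAtInfinity_pow_even (e := v * 2) (even_two.mul_left v), mul_one]
  have h2 : 4 ∣ v * 3 ↔ 4 ∣ v * 1 := by omega
  simp only [localFactor, h1, h2]

/-- Orthogonality: the number of residues with trivial trace symbol, as a combination of the
contributions of the trivial, the quadratic and the two quartic characters. -/
theorem four_mul_card_goodResidues (D r : ℤ) (hE : (4 : ℤ) ∣ twoSlope D r → Even (twoBase D r)) :
    (4 * (goodResidues D r).card : ℤ) =
      4 * (∏ l ∈ oddPrimeFactors D, admCount r l +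
        (if (2 : ℤ) ∣ twoSlope D r then (if Even (twoBase D r) then 1 else -1) *
          ∏ l ∈ oddPrimeFactors D, localFactor r l (valAt D l * 2) else 0) +
        (if (4 : ℤ) ∣ twoSlope D r then (if twoBase D r % 4 = 0 then 1 else -1) *
          (2 * ∏ l ∈ oddPrimeFactors D, localFactor r l (valAt D l * 1)) else 0)) := by
  have h0 : ∀ x ∈ admissibleResidues D r, ∑ j ∈ Finset.range 4, traceSymbol D r x ^ j =
      if traceSymbol D r x = 1 then 4 else 0 := by
    intro x hx
    have := traceSymbol_pow_four (Finset.mem_filter.1 hx).2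
    simp only [Finset.sum_range_succ, Finset.sum_range_zero]
    rcases gaussian_pow_four_cases this with h | h | h | h <;> rw [h] <;> decide
  have h1 : ((4 * (goodResidues D r).card : ℤ) : GaussianInt) =
      ∑ j ∈ Finset.range 4, ∑ x ∈ admissibleResidues D r, traceSymbol D r x ^ j := by
    rw [Finset.sum_comm, Finset.sum_congr rfl h0, ← Finset.sum_filter, Finset.sum_const,
      nsmul_eq_mul, goodResidues]
    push_cast; ring
  have hadm : ∑ x ∈ admissibleResidues D r, traceSymbol D r x ^ 0 =
      ((4 * ∏ l ∈ oddPrimeFactors D, admCount r l : ℤ) : GaussianInt) := by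
    rw [← card_admissibleResidues]; simp
  rw [Finset.sum_range_succ, Finset.sum_range_succ, Finset.sum_range_succ, Finset.sum_range_one,
    hadm] at h1
  simp only [sum_traceSymbol_pow, localFactor_mul_three] at h1
  have d1 : (4 : ℤ) ∣ (1 : ℕ) * twoSlope D r ↔ (4 : ℤ) ∣ twoSlope D r := by push_cast; rw [one_mul]
  have d2 : (4 : ℤ) ∣ (2 : ℕ) * twoSlope D r ↔ (2 : ℤ) ∣ twoSlope D r := by push_cast; omega
  have d3 : (4 : ℤ) ∣ (3 : ℕ) * twoSlope D r ↔ (4 : ℤ) ∣ twoSlope D r := by push_cast; omega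
  simp only [d1, d2, d3] at h1
  have e2 : gaussIPow (twoBase D r) ^ 2 = ((if Even (twoBase D r) then 1 else -1 : ℤ)) := by
    rcases gaussIPow_cases (twoBase D r) with ⟨h, e⟩ | ⟨h, e⟩ | ⟨h, e⟩ | ⟨h, e⟩
    · rw [e, if_pos (Int.even_iff.2 (by omega))]; decide
    · rw [e, if_neg (fun h' => by rw [Int.even_iff] at h'; omega)]; decide
    · rw [e, if_pos (Int.even_iff.2 (by omega))]; decide
    · rw [e, if_neg (fun h' => by rw [Int.even_iff] at h'; omega)]; decide
  have e1 : (4 : ℤ) ∣ twoSlope D r → gaussIPow (twoBase D r) =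
      ((if twoBase D r % 4 = 0 then 1 else -1 : ℤ)) := by
    intro h4
    have hev := Int.even_iff.1 (hE h4)
    rcases gaussIPow_cases (twoBase D r) with ⟨h, e⟩ | ⟨h, e⟩ | ⟨h, e⟩ | ⟨h, e⟩
    · rw [e, if_pos h]; decide
    · omega
    · rw [e, if_neg (by omega)]; decide
    · omega
  refine Int.cast_injective (α := GaussianInt) ?_
  rw [h1]
  by_cases h4 : (4 : ℤ) ∣ twoSlope D r
  · have h2 : (2 : ℤ) ∣ twoSlope D r := by omega
    have hev := hE h4
    simp only [if_pos h4, if_pos h2, e1 h4, if_pos hev]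
    split_ifs <;> push_cast <;> ring
  · by_cases h2 : (2 : ℤ) ∣ twoSlope D r
    · simp only [if_neg h4, if_pos h2, e2]
      push_cast; ring
    · simp only [if_neg h4, if_neg h2]
      push_cast; ring

/-! ### The explicit density -/

/-- At a prime not dividing `r` the number of admissible residues is the factor `τ(l)` of the
density. -/
theorem admCount_eq_tauPrime {r : ℤ} {l : ℕ} (hl : l.Prime) (hl2 : l ≠ 2) (hlr : ¬ (l : ℤ) ∣ r) :
    (admCount r l : ℚ) = tauPrime l := by
  have hodd := Nat.odd_iff.1 (hl.odd_of_ne_two hl2)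
  unfold admCount tauPrime
  rw [jacobiSym_neg_four_mul_sq hl (lt_of_le_of_ne hl.two_le hl2.symm), if_neg hlr,
    ZMod.χ₄_nat_eq_if_mod_four, if_neg (by omega)]
  have : l % 4 = 1 ∨ l % 4 = 3 := by omega
  rcases this with h | h
  · rw [if_pos h, if_neg (by omega)]; push_cast; ring
  · rw [if_neg (by omega), if_pos h]; push_cast; ring

theorem admCount_pos {r : ℤ} {l : ℕ} (hl : l.Prime) (hl2 : l ≠ 2) : 0 < admCount r l := by
  have h3 : 2 < l := lt_of_le_of_ne hl.two_le hl2.symm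
  unfold admCount
  rw [jacobiSym_neg_four_mul_sq hl h3]
  split_ifs
  · omega
  · rcases chi_four_cases hl hl2 with h | h <;> rw [h] <;> omega

/-- The normalized power sums of the local symbol at `l`. -/
def localRatio (r : ℤ) (l e : ℕ) : ℚ := localFactor r l e / admCount r l

theorem localRatio_of_dvd {r : ℤ} {l : ℕ} (hl : l.Prime) (hl2 : l ≠ 2) (hlr : (l : ℤ) ∣ r)
    (e : ℕ) : localRatio r l e = (valueAtInfinity r l : ℚ) ^ e := by
  have h0 : (admCount r l : ℚ) ≠ 0 := by exact_mod_cast (admCount_pos hl hl2).ne'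
  rw [localRatio, localFactor, if_pos hlr]
  push_cast; field_simp

theorem localRatio_of_not_dvd {r : ℤ} {l : ℕ} (hl : l.Prime) (hl2 : l ≠ 2) (hlr : ¬ (l : ℤ) ∣ r)
    (e : ℕ) : localRatio r l e =
      if 4 ∣ e then 1 else -(valueAtInfinity r l : ℚ) ^ e / tauPrime l := by
  have h0 : (admCount r l : ℚ) ≠ 0 := by exact_mod_cast (admCount_pos hl hl2).ne'
  rw [localRatio, localFactor, if_neg hlr, ← admCount_eq_tauPrime hl hl2 hlr]
  split_ifs with h
  · rw [valueAtInfinity_pow_even ((by decide : Even 4).trans_dvd h), add_sub_cancel_right,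
      div_self h0]
  · push_cast; rw [zero_sub]

theorem neg_one_pow_countMod8 (s : Finset ℕ) (i j : ℕ) :
    (-1 : ℚ) ^ countMod8 s i j = ∏ l ∈ s, if l % 8 = i ∨ l % 8 = j then -1 else 1 := by
  rw [Finset.prod_ite, Finset.prod_const, Finset.prod_const_one, mul_one, countMod8]

theorem neg_one_pow_card (s : Finset ℕ) : (-1 : ℚ) ^ s.card = ∏ _l ∈ s, (-1 : ℚ) := by
  rw [Finset.prod_const]

theorem valueAtInfinity_of_odd {r : ℤ} (hr : Odd r) {l : ℕ} (hl : l.Prime) (hl2 : l ≠ 2) :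
    valueAtInfinity r l = if l % 8 = 3 ∨ l % 8 = 5 then -1 else 1 := by
  have hodd := Nat.odd_iff.1 (hl.odd_of_ne_two hl2)
  rw [valueAtInfinity, unitSq, if_pos hr, torusQuarter]
  split_ifs with h1 h2 h2
  · exact Odd.neg_one_pow (by rw [Nat.odd_iff]; omega)
  · exact Even.neg_one_pow (by rw [Nat.even_iff]; omega)
  · exact Odd.neg_one_pow (by rw [Nat.odd_iff]; omega)
  · exact Even.neg_one_pow (by rw [Nat.even_iff]; omega)

theorem valueAtInfinity_of_even {r : ℤ} (hr : ¬ Odd r) (l : ℕ) : valueAtInfinity r l = 1 := by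
  rw [valueAtInfinity, unitSq, if_neg hr]; simp

theorem expMod4_eq (D : ℤ) (l : ℕ) : expMod4 D l = valAt D l % 4 := rfl

theorem prod_localRatio_two (D r : ℤ) :
    ∏ l ∈ oddPrimeFactors D, localRatio r l (valAt D l * 2) = quadTerm D r := by
  rw [quadTerm, neg_one_pow_card, ← Finset.prod_div_distrib, oddExpOff, Finset.prod_filter]
  refine Finset.prod_congr rfl fun l hl => ?_
  obtain ⟨hp, h2⟩ := oddPrimeFactors_spec hl
  rw [expMod4_eq]
  by_cases hlr : (l : ℤ) ∣ r
  · rw [localRatio_of_dvd hp h2 hlr, if_neg (fun h => h.1 hlr)]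
    exact_mod_cast valueAtInfinity_pow_even (even_two.mul_left _)
  · rw [localRatio_of_not_dvd hp h2 hlr]
    by_cases hv : valAt D l % 4 = 1 ∨ valAt D l % 4 = 3
    · rw [if_neg (by omega), if_pos ⟨hlr, hv⟩]
      have : (valueAtInfinity r l : ℚ) ^ (valAt D l * 2) = 1 := by
        exact_mod_cast valueAtInfinity_pow_even (even_two.mul_left _)
      rw [this]
    · rw [if_pos (by omega), if_neg (fun h => hv h.2)]

theorem valueAtInfinity_pow_odd {r : ℤ} {l e : ℕ} (he : Odd e) :
    valueAtInfinity r l ^ e = valueAtInfinity r l := by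
  rcases valueAtInfinity_cases r l with h | h <;> rw [h]
  · exact one_pow _
  · exact he.neg_one_pow

/-- The quartic product, sorted by the type of the prime. -/
theorem prod_localRatio_one (D r : ℤ) :
    ∏ l ∈ oddPrimeFactors D, localRatio r l (valAt D l * 1) =
      ((∏ l ∈ oddExpOn D r, (valueAtInfinity r l : ℚ)) *
        ∏ l ∈ oddExpOff D r, -(valueAtInfinity r l : ℚ)) * (∏ _l ∈ twoExpOff D r, (-1 : ℚ)) /
        quartDenom D r := by
  rw [quartDenom, mul_div_mul_comm, mul_div_assoc, ← Finset.prod_div_distrib,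
    ← Finset.prod_div_distrib, oddExpOn, oddExpOff, twoExpOff, Finset.prod_filter,
    Finset.prod_filter, Finset.prod_filter, ← Finset.prod_mul_distrib, ← Finset.prod_mul_distrib]
  refine Finset.prod_congr rfl fun l hl => ?_
  obtain ⟨hp, h2⟩ := oddPrimeFactors_spec hl
  rw [expMod4_eq, mul_one]
  by_cases hlr : (l : ℤ) ∣ r
  · rw [localRatio_of_dvd hp h2 hlr]
    simp only [hlr, not_true_eq_false, false_and, true_and, if_false, mul_one]
    split_ifs with hv
    · exact_mod_cast valueAtInfinity_pow_odd (Nat.odd_iff.2 (by omega))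
    · exact_mod_cast valueAtInfinity_pow_even (Nat.even_iff.2 (by omega))
  · rw [localRatio_of_not_dvd hp h2 hlr]
    simp only [hlr, not_false_eq_true, false_and, true_and, if_false, one_mul]
    have : valAt D l % 4 = 0 ∨ valAt D l % 4 = 1 ∨ valAt D l % 4 = 2 ∨ valAt D l % 4 = 3 := by omega
    have hodd : valAt D l % 4 = 1 ∨ valAt D l % 4 = 3 →
        (valueAtInfinity r l : ℚ) ^ valAt D l = valueAtInfinity r l := fun h => by
      exact_mod_cast valueAtInfinity_pow_odd (Nat.odd_iff.2 (by omega))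
    have heven : valAt D l % 4 = 2 → (valueAtInfinity r l : ℚ) ^ valAt D l = 1 := fun h => by
      exact_mod_cast valueAtInfinity_pow_even (Nat.even_iff.2 (by omega))
    rcases this with h | h | h | h
    · rw [if_pos (by omega), if_neg (by omega), if_neg (by omega), one_mul]
    · rw [if_neg (by omega), if_pos (by omega), if_neg (by omega), hodd (Or.inl h), mul_one]
    · rw [if_neg (by omega), if_neg (by omega), if_pos (by omega), heven h, one_mul]
    · rw [if_neg (by omega), if_pos (by omega), if_neg (by omega), hodd (Or.inr h), mul_one]

theorem prod_localRatio_one_of_odd (D : ℤ) {r : ℤ} (hr : Odd r) :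
    ∏ l ∈ oddPrimeFactors D, localRatio r l (valAt D l * 1) = quartTermOdd D r := by
  have hA : ∏ l ∈ oddExpOn D r, (valueAtInfinity r l : ℚ) =
      (-1) ^ countMod8 (oddExpOn D r) 3 5 := by
    rw [neg_one_pow_countMod8]
    refine Finset.prod_congr rfl fun l hl => ?_
    obtain ⟨hp, h2⟩ := oddPrimeFactors_spec (Finset.mem_filter.1 hl).1
    rw [valueAtInfinity_of_odd hr hp h2]; push_cast; rfl
  have hB : ∏ l ∈ oddExpOff D r, -(valueAtInfinity r l : ℚ) =
      (-1) ^ countMod8 (oddExpOff D r) 1 7 := by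
    rw [neg_one_pow_countMod8]
    refine Finset.prod_congr rfl fun l hl => ?_
    obtain ⟨hp, h2⟩ := oddPrimeFactors_spec (Finset.mem_filter.1 hl).1
    have hodd := Nat.odd_iff.1 (hp.odd_of_ne_two h2)
    rw [valueAtInfinity_of_odd hr hp h2]
    split_ifs <;> first | (exfalso; omega) | norm_num
  rw [prod_localRatio_one, quartTermOdd, pow_add, pow_add, hA, hB, neg_one_pow_card]

/-- Modulo `4` a prime power `l ^ v` depends only on `χ₄(l)` and the parity of `v`, so that the
reduction of the exponents modulo `4` does not matter. -/
theorem prod_pow_expMod4_mod_four {D : ℤ} {S : Finset ℕ} (hS : S ⊆ oddPrimeFactors D) :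
    ((∏ l ∈ S, (l : ℤ) ^ expMod4 D l : ℤ) : ZMod 4) =
      ((∏ l ∈ S, (ZMod.χ₄ l : ℤ) ^ valAt D l : ℤ) : ZMod 4) := by
  push_cast
  refine Finset.prod_congr rfl fun l hl => ?_
  obtain ⟨hp, h2⟩ := oddPrimeFactors_spec (hS hl)
  have hodd := Nat.odd_iff.1 (hp.odd_of_ne_two h2)
  have key : ∀ a : ZMod 4, a = 1 ∨ a = 3 → ((ZMod.χ₄ a : ℤ) : ZMod 4) = a ∧ a ^ 4 = 1 := by decide
  have hl4 : (l : ZMod 4) = 1 ∨ (l : ZMod 4) = 3 := by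
    have : l % 4 = 1 ∨ l % 4 = 3 := by omega
    rcases this with h | h
    · left; rw [← ZMod.natCast_mod, h]; rfl
    · right; rw [← ZMod.natCast_mod, h]; rfl
  obtain ⟨k1, k2⟩ := key _ hl4
  rw [k1, expMod4_eq]
  conv_rhs => rw [← Nat.div_add_mod (valAt D l) 4, pow_add, pow_mul, k2, one_pow, one_mul]

theorem prod_chi_four_cases {D : ℤ} {S : Finset ℕ} (hS : S ⊆ oddPrimeFactors D) :
    ∏ l ∈ S, (ZMod.χ₄ l : ℤ) ^ valAt D l = 1 ∨ ∏ l ∈ S, (ZMod.χ₄ l : ℤ) ^ valAt D l = -1 := by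
  rw [← sq_eq_one_iff, ← Finset.prod_pow]
  refine Finset.prod_eq_one fun l hl => ?_
  obtain ⟨hp, h2⟩ := oddPrimeFactors_spec (hS hl)
  rw [← pow_mul, mul_comm, pow_mul, chi_four_sq hp h2, one_pow]

theorem prod_pow_expMod4_emod_four {D : ℤ} {S : Finset ℕ} (hS : S ⊆ oddPrimeFactors D) :
    (4 : ℤ) ∣ (∏ l ∈ S, (l : ℤ) ^ expMod4 D l) - ∏ l ∈ S, (ZMod.χ₄ l : ℤ) ^ valAt D l := by
  have h := prod_pow_expMod4_mod_four hS
  rw [← sub_eq_zero, ← Int.cast_sub] at h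
  exact (ZMod.intCast_zmod_eq_zero_iff_dvd _ 4).1 h

/-- The sign of the product of the `χ₄(l) ^ v_l`, which is the class modulo `4` of the odd part
of `|D|`. -/
def oddPartSign (D : ℤ) : ℤ := ∏ l ∈ oddPrimeFactors D, (ZMod.χ₄ l : ℤ) ^ valAt D l

theorem signPart_eq (D : ℤ) : signPart D = -D.sign * oddPartSign D := rfl

theorem sign_cases {D : ℤ} (hD : D ≠ 0) : D.sign = 1 ∨ D.sign = -1 := by
  rcases lt_or_gt_of_ne hD with h | h
  · exact Or.inr (Int.sign_eq_neg_one_of_neg h)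
  · exact Or.inl (Int.sign_eq_one_of_pos h)

/-- For odd `r` the quartic characters contribute exactly in the case `QuarticCase`: the right-hand
side is `4 ∣ twoSlope D r`. -/
theorem quarticCase_iff {D r : ℤ} (hD : D ≠ 0) (hr : Odd r) :
    QuarticCase D ↔ (4 : ℤ) ∣ valAt D 2 * r + 3 - signPart D := by
  obtain ⟨k, hk⟩ := prod_pow_expMod4_emod_four (Finset.Subset.refl (oddPrimeFactors D))
  have hX : oddPartSign D = 1 ∨ oddPartSign D = -1 :=
    prod_chi_four_cases (Finset.Subset.refl (oddPrimeFactors D))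
  have hP : ∏ l ∈ oddPrimeFactors D, (l : ℤ) ^ expMod4 D l = oddPartSign D + 4 * k := by
    unfold oddPartSign; linarith
  rw [signPart_eq]
  unfold QuarticCase fourthFree
  rw [hP, expMod4_eq]
  have hv : (valAt D 2 : ℤ) * r = 4 * ((valAt D 2 / 4 : ℕ) * r) + (valAt D 2 % 4 : ℕ) * r := by
    conv_lhs => rw [← Nat.div_add_mod (valAt D 2) 4]
    push_cast; ring
  rw [hv]
  set m : ℤ := (valAt D 2 / 4 : ℕ) * r
  rw [Int.odd_iff] at hr
  have hσ : valAt D 2 % 4 < 4 := Nat.mod_lt _ (by norm_num)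
  rcases sign_cases hD with hs | hs <;> rcases hX with hx | hx <;> rw [hs, hx] <;>
    interval_cases valAt D 2 % 4 <;> norm_num <;> omega

theorem dPart_pos (D r : ℤ) : 0 < dPart D r := by
  refine Finset.prod_pos fun l hl => pow_pos ?_ _
  exact_mod_cast (oddPrimeFactors_spec (Finset.mem_filter.1 hl).1).1.pos

/-- The number of sign changes in the quartic term for even `r`. -/
theorem neg_one_pow_oddExpOff (D r : ℤ) :
    (oddPartSign D : ℚ) * (-1) ^ (oddExpOff D r).card =
      (-1) ^ (countMod8 (oddExpOff D r) 1 5 + ((dPart D r - 1) / 2).toNat) := by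
  have hsub : (oddPrimeFactors D).filter (fun l : ℕ => (l : ℤ) ∣ r) ⊆ oddPrimeFactors D :=
    Finset.filter_subset _ _
  obtain ⟨k, hk⟩ := prod_pow_expMod4_emod_four hsub
  have hY := prod_chi_four_cases hsub
  set Y := ∏ l ∈ (oddPrimeFactors D).filter (fun l : ℕ => (l : ℤ) ∣ r),
    (ZMod.χ₄ l : ℤ) ^ valAt D l with hYdef
  have hd : dPart D r = Y + 4 * k := by unfold dPart; linarith
  have hdpos := dPart_pos D r
  have h1 : ((-1 : ℚ)) ^ ((dPart D r - 1) / 2).toNat = Y := by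
    rcases hY with h | h
    · rw [h, Even.neg_one_pow (by rw [Nat.even_iff]; omega)]; norm_num
    · rw [h, Odd.neg_one_pow (by rw [Nat.odd_iff]; omega)]; norm_num
  have h2 : oddPartSign D = Y * ∏ l ∈ oddExpOff D r, (ZMod.χ₄ l : ℤ) := by
    rw [oddPartSign, hYdef, ← Finset.prod_filter_mul_prod_filter_not (oddPrimeFactors D)
      (fun l : ℕ => (l : ℤ) ∣ r)]
    congr 1
    rw [oddExpOff, ← Finset.filter_filter, Finset.prod_filter (fun l => expMod4 D l = 1 ∨ _)]
    refine Finset.prod_congr rfl fun l hl => ?_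
    obtain ⟨hp, h2⟩ := oddPrimeFactors_spec (Finset.mem_filter.1 hl).1
    rw [expMod4_eq]
    rcases chi_four_cases hp h2 with h | h <;> rw [h]
    · simp
    · split_ifs with hv
      · exact Odd.neg_one_pow (by rw [Nat.odd_iff]; omega)
      · exact Even.neg_one_pow (by rw [Nat.even_iff]; omega)
  rw [pow_add, h1, h2, neg_one_pow_card, neg_one_pow_countMod8]
  push_cast
  rw [mul_assoc, ← Finset.prod_mul_distrib, mul_comm]
  congr 1
  refine Finset.prod_congr rfl fun l hl => ?_
  obtain ⟨hp, h2⟩ := oddPrimeFactors_spec (Finset.mem_filter.1 hl).1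
  have hodd := Nat.odd_iff.1 (hp.odd_of_ne_two h2)
  rw [ZMod.χ₄_nat_eq_if_mod_four, if_neg (by omega)]
  have : l % 4 = 1 ∨ l % 4 = 3 := by omega
  rcases this with h | h
  · rw [if_pos h, if_pos (by omega)]; norm_num
  · rw [if_neg (by omega), if_neg (by omega)]; norm_num

theorem prod_localRatio_one_of_even (D : ℤ) {r : ℤ} (hr : ¬ Odd r) :
    ∏ l ∈ oddPrimeFactors D, localRatio r l (valAt D l * 1) =
      oddPartSign D * quartTermEven D r := by
  have h := neg_one_pow_oddExpOff D r
  have hX : (oddPartSign D : ℚ) * oddPartSign D = 1 := by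
    rcases prod_chi_four_cases (Finset.Subset.refl (oddPrimeFactors D)) with h | h <;>
      · unfold oddPartSign; rw [h]; norm_num
  rw [prod_localRatio_one, quartTermEven, add_right_comm, pow_add _ _ (twoExpOff D r).card, ← h,
    neg_one_pow_card, neg_one_pow_card]
  simp only [valueAtInfinity_of_even hr, Int.cast_one, Finset.prod_const_one, one_mul]
  rw [mul_div_assoc', ← mul_assoc, ← mul_assoc, hX, one_mul]

theorem even_twoBase {D r : ℤ} (hD : D ≠ 0) (h : (4 : ℤ) ∣ twoSlope D r) : Even (twoBase D r) := by
  unfold twoSlope at h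
  unfold twoBase
  rw [Int.even_iff]
  split_ifs at h ⊢ with hr
  · rw [Int.odd_iff] at hr; omega
  · rw [Int.odd_iff] at hr
    set w := (valAt D 2 : ℤ) * (r / 2)
    rcases signPart_cases hD with hs | hs <;> rw [hs] <;> omega

/-- The explicit density, as the combination of products of local ratios given by orthogonality. -/
theorem four_mul_explicitDensity {D : ℤ} (hD : D ≠ 0) (r : ℤ) :
    4 * explicitDensity D r = 1 +
      (if (2 : ℤ) ∣ twoSlope D r then (if Even (twoBase D r) then 1 else -1) *
        ∏ l ∈ oddPrimeFactors D, localRatio r l (valAt D l * 2) else 0) +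
      (if (4 : ℤ) ∣ twoSlope D r then (if twoBase D r % 4 = 0 then 1 else -1) *
        (2 * ∏ l ∈ oddPrimeFactors D, localRatio r l (valAt D l * 1)) else 0) := by
  rw [prod_localRatio_two]
  by_cases hr : Odd r
  · have hr2 := Int.odd_iff.1 hr
    have hc : twoSlope D r = valAt D 2 * r + 3 - signPart D := if_pos hr
    have hE : twoBase D r = r - 1 := if_pos hr
    have h4 : (4 : ℤ) ∣ twoSlope D r ↔ QuarticCase D := by rw [hc, quarticCase_iff hD hr]
    have h2 : (2 : ℤ) ∣ twoSlope D r ↔ Even (expMod4 D 2) := by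
      have h3 : (2 : ℤ) ∣ twoSlope D r ↔ Even ((valAt D 2 : ℤ) * r) := by
        rw [hc, Int.even_iff]
        rcases signPart_cases hD with hs | hs <;> rw [hs] <;> omega
      rw [h3, Int.even_mul, or_iff_left (Int.not_even_iff_odd.2 hr), Int.even_coe_nat,
        Nat.even_iff, Nat.even_iff, expMod4_eq]
      omega
    have hev : Even (twoBase D r) := by rw [hE, Int.even_iff]; omega
    have h14 : twoBase D r % 4 = 0 ↔ r % 4 = 1 := by rw [hE]; omega
    rw [prod_localRatio_one_of_odd D hr, explicitDensity, if_pos hr, if_pos hev]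
    simp only [h14, h4]
    by_cases hq : QuarticCase D
    · have h22 : (2 : ℤ) ∣ twoSlope D r := (by decide : (2 : ℤ) ∣ 4).trans (h4.2 hq)
      rw [if_pos hq, if_pos hq, if_pos h22]
      ring
    · rw [if_neg hq, if_neg hq]
      simp only [h2]
      split_ifs <;> ring
  · have hr2 : r % 2 = 0 := by rw [Int.odd_iff] at hr; omega
    obtain ⟨q, rfl⟩ : ∃ q, r = 2 * q := ⟨r / 2, by omega⟩
    have hq2 : 2 * q / 2 = q := by omega
    have hc : twoSlope D (2 * q) = 2 * (1 - valAt D 2 * q) := by rw [twoSlope, if_neg hr, hq2]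
    have hE : twoBase D (2 * q) =
        (1 - signPart D) * q - valAt D 2 * q + 2 * q + 1 := by rw [twoBase, if_neg hr, hq2]
    have h2 : (2 : ℤ) ∣ twoSlope D (2 * q) := by rw [hc]; exact dvd_mul_right _ _
    rw [if_pos h2, prod_localRatio_one_of_even D hr, explicitDensity, if_neg hr]
    have hcond : Even (expMod4 D 2) ∨ (4 : ℤ) ∣ 2 * q ↔ Even ((valAt D 2 : ℤ) * q) := by
      rw [Int.even_mul, Int.even_coe_nat, Nat.even_iff, Nat.even_iff, expMod4_eq, Int.even_iff]
      omega
    by_cases h : Even ((valAt D 2 : ℤ) * q)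
    · rw [if_pos (hcond.2 h)]
      rw [Int.even_iff] at h
      have hnE : ¬ Even (twoBase D (2 * q)) := by
        rw [hE, Int.even_iff]
        rcases signPart_cases hD with hs | hs <;> rw [hs] <;> omega
      have hn4 : ¬ (4 : ℤ) ∣ twoSlope D (2 * q) := by rw [hc]; omega
      rw [if_neg hnE, if_neg hn4]
      ring
    · rw [if_neg (fun h' => h (hcond.1 h'))]
      have h' := Int.not_even_iff_odd.1 h
      obtain ⟨hv1, hq1⟩ := Int.odd_mul.1 h'
      rw [Int.odd_iff] at h' hv1 hq1
      have h4 : (4 : ℤ) ∣ twoSlope D (2 * q) := by rw [hc]; omega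
      rw [if_pos (even_twoBase hD h4), if_pos h4]
      -- `v₂(D)` and `r / 2` are odd here, and the sign depends on their classes modulo `4`
      have hsign : (if twoBase D (2 * q) % 4 = 0 then (1 : ℚ) else -1) * oddPartSign D =
          (if 2 * q % 8 = 2 then 1 else -1) * (if expMod4 D 2 = 1 then 1 else -1) * D.sign := by
        obtain ⟨w, hw⟩ : ∃ w, q = 4 * w + q % 4 := ⟨q / 4, by omega⟩
        obtain ⟨z, hz⟩ : ∃ z : ℤ, (valAt D 2 : ℤ) = 4 * z + (valAt D 2 % 4 : ℕ) :=
          ⟨(valAt D 2 / 4 : ℕ), by omega⟩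
        have hmul : (valAt D 2 : ℤ) * q =
            4 * (4 * z * w + z * (q % 4) + (valAt D 2 % 4 : ℕ) * w) +
              (valAt D 2 % 4 : ℕ) * (q % 4) := by
          conv_lhs => rw [hz, hw]
          ring
        rw [hE, hmul, signPart_eq, expMod4_eq]
        set K := 4 * z * w + z * (q % 4) + (valAt D 2 % 4 : ℕ) * w
        have hX : oddPartSign D = 1 ∨ oddPartSign D = -1 :=
          prod_chi_four_cases (Finset.Subset.refl (oddPrimeFactors D))
        have hv4 : valAt D 2 % 4 = 1 ∨ valAt D 2 % 4 = 3 := by omega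
        have hq4 : q % 4 = 1 ∨ q % 4 = 3 := by omega
        rcases sign_cases hD with hs | hs <;> rcases hX with hx | hx <;>
          rcases hv4 with hv4 | hv4 <;> rcases hq4 with hq4 | hq4 <;>
          rw [hs, hx, hv4, hq4] <;> norm_num <;> split_ifs <;>
          first | (exfalso; omega) | norm_num
      calc _ = 1 + quadTerm D (2 * q) +
            ((if 2 * q % 8 = 2 then 1 else -1) * (if expMod4 D 2 = 1 then 1 else -1) * D.sign) *
              (2 * quartTermEven D (2 * q)) := by ring
        _ = _ := by rw [← hsign]; ring

/-- The proportion of good residues is the explicit density. -/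
theorem card_goodResidues {D : ℤ} (hD : D ≠ 0) (r : ℤ) :
    ((goodResidues D r).card : ℚ) = explicitDensity D r * (admissibleResidues D r).card := by
  have h1 := four_mul_card_goodResidues D r (even_twoBase hD)
  have h2 := card_admissibleResidues D r
  have h3 := four_mul_explicitDensity hD r
  have hne : ∏ l ∈ oddPrimeFactors D, (admCount r l : ℚ) ≠ 0 :=
    Finset.prod_ne_zero_iff.2 fun l hl => by
      obtain ⟨hp, hl2⟩ := oddPrimeFactors_spec hl
      exact_mod_cast (admCount_pos hp hl2).ne'
  have hQ : ∀ j, ((∏ l ∈ oddPrimeFactors D, localFactor r l (valAt D l * j) : ℤ) : ℚ) =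
      (∏ l ∈ oddPrimeFactors D, localRatio r l (valAt D l * j)) *
        ∏ l ∈ oddPrimeFactors D, (admCount r l : ℚ) := by
    intro j
    rw [← Finset.prod_mul_distrib]
    push_cast
    refine Finset.prod_congr rfl fun l hl => ?_
    obtain ⟨hp, hl2⟩ := oddPrimeFactors_spec hl
    have : (admCount r l : ℚ) ≠ 0 := by exact_mod_cast (admCount_pos hp hl2).ne'
    rw [localRatio, div_mul_cancel₀ _ this]
  have h1' : ((4 * (goodResidues D r).card : ℤ) : ℚ) = _ := congrArg (Int.cast (R := ℚ)) h1
  have h2' : (((admissibleResidues D r).card : ℤ) : ℚ) = _ := congrArg (Int.cast (R := ℚ)) h2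
  rw [Int.cast_mul, Int.cast_mul, Int.cast_add, Int.cast_add, apply_ite (Int.cast (R := ℚ)),
    apply_ite (Int.cast (R := ℚ)), Int.cast_mul, Int.cast_mul, Int.cast_mul, hQ, hQ] at h1'
  push_cast at h1' h2'
  rw [h2']
  set P := ∏ l ∈ oddPrimeFactors D, (admCount r l : ℚ)
  set A := ∏ l ∈ oddPrimeFactors D, localRatio r l (valAt D l * 2)
  set B := ∏ l ∈ oddPrimeFactors D, localRatio r l (valAt D l * 1)
  have : explicitDensity D r * (4 * P) = (4 * explicitDensity D r) * P := by ring
  rw [this, h3]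
  split_ifs at h1' ⊢ <;> linear_combination h1' / 4

/-! ### The zeros of the density -/

theorem card_admissibleResidues_pos (D r : ℤ) : 0 < (admissibleResidues D r).card := by
  have h : 0 < ((admissibleResidues D r).card : ℤ) := by
    rw [card_admissibleResidues]
    refine mul_pos (by norm_num) (Finset.prod_pos fun l hl => ?_)
    obtain ⟨hp, hl2⟩ := oddPrimeFactors_spec hl
    exact admCount_pos hp hl2
  exact_mod_cast h

theorem explicitDensity_nonneg {D : ℤ} (hD : D ≠ 0) (r : ℤ) : 0 ≤ explicitDensity D r := by
  have h1 := card_goodResidues hD r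
  have h2 : (0 : ℚ) < (admissibleResidues D r).card := by
    exact_mod_cast card_admissibleResidues_pos D r
  have h3 : (0 : ℚ) ≤ (goodResidues D r).card := Nat.cast_nonneg _
  rw [h1] at h3
  exact nonneg_of_mul_nonneg_left h3 h2

theorem three_le_tauPrime {l : ℕ} (hl : l.Prime) (hl2 : l ≠ 2) : 3 ≤ tauPrime l := by
  have hodd := Nat.odd_iff.1 (hl.odd_of_ne_two hl2)
  have h1 := hl.two_le
  unfold tauPrime
  split_ifs with h
  · exact_mod_cast (by omega : 3 ≤ l)
  · have : ((5 : ℕ) : ℚ) ≤ l := by exact_mod_cast (by omega : 5 ≤ l)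
    push_cast at this; linarith

theorem tauPrime_eq_three {l : ℕ} (h : tauPrime l = 3) : l = 3 ∨ l = 5 := by
  unfold tauPrime at h
  split_ifs at h
  · left; exact_mod_cast h
  · right
    have : (l : ℚ) = 5 := by linarith
    exact_mod_cast this

theorem prod_tauPrime_eq_one_or {S : Finset ℕ} (hS : ∀ l ∈ S, l.Prime ∧ l ≠ 2) :
    (S = ∅ ∧ ∏ l ∈ S, tauPrime l = 1) ∨ (S ≠ ∅ ∧ 3 ^ S.card ≤ ∏ l ∈ S, tauPrime l ∧
      3 ≤ ∏ l ∈ S, tauPrime l) := by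
  rcases S.eq_empty_or_nonempty with rfl | h
  · left; simp
  · right
    have h1 : (3 : ℚ) ^ S.card ≤ ∏ l ∈ S, tauPrime l := by
      rw [← Finset.prod_const]
      exact Finset.prod_le_prod (fun _ _ => by norm_num)
        fun l hl => three_le_tauPrime (hS l hl).1 (hS l hl).2
    have h2 : (3 : ℚ) ≤ 3 ^ S.card := by
      calc (3 : ℚ) = 3 ^ 1 := by norm_num
        _ ≤ _ := pow_le_pow_right₀ (by norm_num) h.card_pos
    exact ⟨h.ne_empty, h1, h2.trans h1⟩

/-- Since `τ(l) ≥ 3`, with equality only for `l = 3, 5`, the expression vanishes only when it is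
`1 + 1 - 2` or `1 - 1/3 - 2/3`. -/
theorem density_factor_eq_zero_iff {A B : Finset ℕ} (hA : ∀ l ∈ A, l.Prime ∧ l ≠ 2)
    (hB : ∀ l ∈ B, l.Prime ∧ l ≠ 2) {x : ℚ} (hx : x = 1 ∨ x = -1) :
    1 + (-1) ^ A.card / ∏ l ∈ A, tauPrime l +
        2 * (x / ((∏ l ∈ A, tauPrime l) * ∏ l ∈ B, tauPrime l)) = 0 ↔
      B = ∅ ∧ (A = ∅ ∨ A = {3} ∨ A = {5}) ∧ x = -1 := by
  have hA' := prod_tauPrime_eq_one_or hA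
  have hB' := prod_tauPrime_eq_one_or hB
  set a := ∏ l ∈ A, tauPrime l with ha
  set b := ∏ l ∈ B, tauPrime l
  have ha1 : 1 ≤ a := by
    rcases hA' with ⟨_, h⟩ | ⟨_, _, h⟩ <;> linarith
  have hb1 : 1 ≤ b := by
    rcases hB' with ⟨_, h⟩ | ⟨_, _, h⟩ <;> linarith
  have ha0 : a ≠ 0 := by linarith
  have hb0 : b ≠ 0 := by linarith
  have hbB : b = 1 ↔ B = ∅ := by
    rcases hB' with ⟨h1, h⟩ | ⟨h1, _, h⟩
    · exact ⟨fun _ => h1, fun _ => h⟩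
    · exact ⟨fun h' => by linarith, fun h' => absurd h' h1⟩
  have hmul : 1 + (-1) ^ A.card / a + 2 * (x / (a * b)) =
      (a * b + (-1) ^ A.card * b + 2 * x) / (a * b) := by
    field_simp
  rw [hmul, div_eq_zero_iff, or_iff_left (mul_ne_zero ha0 hb0), ← hbB]
  have hcard : A.card = 0 ∨ A.card = 1 ∨ 2 ≤ A.card := by omega
  rcases hcard with h | h | h
  · have hAe := Finset.card_eq_zero.1 h
    have : a = 1 := by rw [ha, hAe, Finset.prod_empty]
    rw [this, h, hAe]
    constructor
    · intro h0
      rcases hx with hx | hx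
      · rw [hx] at h0; linarith
      · rw [hx] at h0; exact ⟨by linarith, Or.inl rfl, hx⟩
    · rintro ⟨h1, _, h2⟩; rw [h1, h2]; norm_num
  · obtain ⟨l, hl⟩ := Finset.card_eq_one.1 h
    have hal : a = tauPrime l := by rw [ha, hl, Finset.prod_singleton]
    have hlp := hA l (by rw [hl]; exact Finset.mem_singleton_self l)
    have h3 := three_le_tauPrime hlp.1 hlp.2
    rw [← hal] at h3
    rw [h, pow_one]
    constructor
    · intro h0
      have hx' : x = -1 := by
        rcases hx with hx | hx
        · rw [hx] at h0; nlinarith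
        · exact hx
      rw [hx'] at h0
      have hb : b = 1 := by nlinarith
      have ha3 : a = 3 := by rw [hb] at h0; linarith
      refine ⟨hb, Or.inr ?_, hx'⟩
      rcases tauPrime_eq_three (hal.symm.trans ha3) with e | e <;> rw [hl, e] <;> simp
    · rintro ⟨h1, h2, h4⟩
      have ha3 : a = 3 := by
        rcases h2 with h2 | h2 | h2
        · rw [h2] at h; simp at h
        · rw [ha, h2, Finset.prod_singleton, tauPrime]; norm_num
        · rw [ha, h2, Finset.prod_singleton, tauPrime]; norm_num
      rw [h1, h4, ha3]; norm_num
  · have h9 : (9 : ℚ) ≤ a := by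
      rcases hA' with ⟨h1, _⟩ | ⟨_, h1, _⟩
      · rw [h1] at h; simp at h
      · calc (9 : ℚ) = 3 ^ 2 := by norm_num
          _ ≤ 3 ^ A.card := pow_le_pow_right₀ (by norm_num) h
          _ ≤ a := h1
    have he : (-1 : ℚ) ≤ (-1) ^ A.card := by
      rcases neg_one_pow_eq_or ℚ A.card with e | e <;> rw [e]; norm_num
    constructor
    · intro h0
      exfalso
      have hx2 : -1 ≤ x := by rcases hx with e | e <;> rw [e]; norm_num
      have h1 : (8 : ℚ) * b ≤ (a + (-1) ^ A.card) * b :=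
        mul_le_mul_of_nonneg_right (by linarith) (by linarith)
      linarith
    · rintro ⟨_, h2, _⟩
      exfalso
      rcases h2 with h2 | h2 | h2 <;> rw [h2] at h <;> simp at h

/-- The odd part of `|d̄|`. -/
def oddBar (D r : ℤ) : ℕ :=
  ∏ l ∈ (oddPrimeFactors D).filter (fun l : ℕ => ¬ (l : ℤ) ∣ r), l ^ expMod4 D l

theorem dBar_eq (D r : ℤ) : dBar D r = D.sign * 2 ^ expMod4 D 2 * (oddBar D r : ℤ) := by
  rw [dBar, oddBar]; push_cast; rfl

theorem fourthFree_eq (D r : ℤ) : fourthFree D = dPart D r * dBar D r := by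
  rw [fourthFree, dPart, dBar, ← Finset.prod_filter_mul_prod_filter_not (oddPrimeFactors D)
    (fun l : ℕ => (l : ℤ) ∣ r)]
  ring

theorem oddBar_odd (D r : ℤ) : Odd (oddBar D r) := by
  refine Finset.prod_induction _ Odd (fun _ _ => Odd.mul) odd_one fun l hl => ?_
  obtain ⟨hp, hl2⟩ := oddPrimeFactors_spec (Finset.mem_filter.1 hl).1
  exact (hp.odd_of_ne_two hl2).pow

theorem expMod4_lt (D : ℤ) (l : ℕ) : expMod4 D l < 4 := Nat.mod_lt _ (by norm_num)

theorem mem_off_iff {D r : ℤ} {l : ℕ} :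
    (l ∈ oddExpOff D r ∨ l ∈ twoExpOff D r) ↔
      l ∈ (oddPrimeFactors D).filter (fun l : ℕ => ¬ (l : ℤ) ∣ r) ∧ expMod4 D l ≠ 0 := by
  have := expMod4_lt D l
  rw [oddExpOff, twoExpOff, Finset.mem_filter, Finset.mem_filter, Finset.mem_filter]
  have h : expMod4 D l ≠ 0 ↔ (expMod4 D l = 1 ∨ expMod4 D l = 3) ∨ expMod4 D l = 2 := by omega
  rw [h]; tauto

theorem oddBar_eq_one_iff {D r : ℤ} : oddBar D r = 1 ↔ oddExpOff D r = ∅ ∧ twoExpOff D r = ∅ := by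
  rw [oddBar, Finset.prod_eq_one_iff]
  constructor
  · intro h
    have key : ∀ l, ¬ (l ∈ oddExpOff D r ∨ l ∈ twoExpOff D r) := by
      intro l hl
      obtain ⟨h1, h2⟩ := mem_off_iff.1 hl
      have := h l h1
      rw [Nat.pow_eq_one] at this
      rcases this with h3 | h3
      · exact (oddPrimeFactors_spec (Finset.mem_filter.1 h1).1).1.one_lt.ne' h3
      · exact h2 h3
    exact ⟨Finset.eq_empty_of_forall_notMem fun l hl => key l (Or.inl hl),
      Finset.eq_empty_of_forall_notMem fun l hl => key l (Or.inr hl)⟩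
  · rintro ⟨h1, h2⟩ l hl
    by_contra h
    have h3 : expMod4 D l ≠ 0 := fun h0 => h (by rw [h0, pow_zero])
    have := mem_off_iff.2 ⟨hl, h3⟩
    rw [h1, h2] at this
    simp at this

theorem oddBar_eq_prime_pow_iff {D r : ℤ} {q : ℕ} (hq : q.Prime) :
    (oddBar D r = q ∨ oddBar D r = q ^ 3) ↔ oddExpOff D r = {q} ∧ twoExpOff D r = ∅ := by
  set T := (oddPrimeFactors D).filter (fun l : ℕ => ¬ (l : ℤ) ∣ r) with hT
  have hprime : ∀ l ∈ T, l.Prime := fun l hl =>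
    (oddPrimeFactors_spec (Finset.mem_filter.1 hl).1).1
  have hsingle : q ∈ T → (∀ l ∈ T, l ≠ q → expMod4 D l = 0) → oddBar D r = q ^ expMod4 D q := by
    intro h1 h2
    exact Finset.prod_eq_single_of_mem q h1 fun l hl hlq => by rw [h2 l hl hlq, pow_zero]
  constructor
  · intro h
    have hk : ∃ k, (k = 1 ∨ k = 3) ∧ oddBar D r = q ^ k := by
      rcases h with h | h
      · exact ⟨1, Or.inl rfl, by rw [h, pow_one]⟩
      · exact ⟨3, Or.inr rfl, h⟩
    obtain ⟨k, hk, hn⟩ := hk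
    have hother : ∀ l ∈ T, l ≠ q → expMod4 D l = 0 := by
      intro l hl hlq
      by_contra h0
      have h1 : l ∣ oddBar D r := (dvd_pow_self l h0).trans
        (Finset.dvd_prod_of_mem (fun l => l ^ expMod4 D l) hl)
      rw [hn] at h1
      exact hlq ((Nat.prime_dvd_prime_iff_eq (hprime l hl) hq).1 ((hprime l hl).dvd_of_dvd_pow h1))
    have hqT : q ∈ T := by
      by_contra hqT
      have : oddBar D r = 1 := Finset.prod_eq_one fun l hl => by
        rw [hother l hl (fun e => hqT (e ▸ hl)), pow_zero]
      rw [this] at hn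
      rcases (Nat.pow_eq_one.1 hn.symm) with h1 | h1
      · exact hq.one_lt.ne' h1
      · omega
    have hexp : expMod4 D q = k := by
      have := hsingle hqT hother
      rw [hn] at this
      exact (Nat.pow_right_injective hq.two_le this).symm
    constructor
    · ext l
      rw [Finset.mem_singleton]
      constructor
      · intro hl
        obtain ⟨h1, h2⟩ := mem_off_iff.1 (Or.inl hl)
        by_contra h3
        exact h2 (hother l h1 h3)
      · rintro rfl
        rw [oddExpOff, Finset.mem_filter]
        have h1 := Finset.mem_filter.1 hqT
        exact ⟨h1.1, h1.2, by rw [hexp]; exact hk⟩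
    · refine Finset.eq_empty_of_forall_notMem fun l hl => ?_
      obtain ⟨h1, h2⟩ := mem_off_iff.1 (Or.inr hl)
      have h3 : l = q := by
        by_contra h3
        exact h2 (hother l h1 h3)
      have h4 := (Finset.mem_filter.1 hl).2.2
      rw [h3, hexp] at h4
      omega
  · rintro ⟨h1, h2⟩
    have hqA : q ∈ oddExpOff D r := by rw [h1]; exact Finset.mem_singleton_self q
    have h3 := (Finset.mem_filter.1 hqA).2.2
    have h4 := hsingle (mem_off_iff.1 (Or.inl hqA)).1 fun l hl hlq => by
      by_contra h0
      have := mem_off_iff.2 ⟨hl, h0⟩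
      rw [h1, h2] at this
      simp [hlq] at this
    rcases h3 with h3 | h3 <;> rw [h3] at h4
    · left; rw [h4, pow_one]
    · right; exact h4

/-- The odd parts of the values of `d̄` in the lists. -/
theorem oddBar_mem_iff {D r : ℤ} :
    (oddBar D r = 1 ∨ (oddBar D r = 3 ∨ oddBar D r = 27) ∨ (oddBar D r = 5 ∨ oddBar D r = 125)) ↔
      twoExpOff D r = ∅ ∧
        (oddExpOff D r = ∅ ∨ oddExpOff D r = {3} ∨ oddExpOff D r = {5}) := by
  have h3 := oddBar_eq_prime_pow_iff (D := D) (r := r) Nat.prime_three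
  have h5 := oddBar_eq_prime_pow_iff (D := D) (r := r) Nat.prime_five
  norm_num at h3 h5
  rw [oddBar_eq_one_iff, h3, h5]
  tauto

theorem oddExpOff_spec {D r : ℤ} : ∀ l ∈ oddExpOff D r, l.Prime ∧ l ≠ 2 := fun _ hl =>
  oddPrimeFactors_spec (Finset.mem_filter.1 hl).1

theorem twoExpOff_spec {D r : ℤ} : ∀ l ∈ twoExpOff D r, l.Prime ∧ l ≠ 2 := fun _ hl =>
  oddPrimeFactors_spec (Finset.mem_filter.1 hl).1

/-- Without a quartic term the density does not vanish for odd `r`. -/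
theorem quadTerm_ne_neg_one {D r : ℤ} : 1 + quadTerm D r ≠ 0 := by
  unfold quadTerm
  have he : (-1 : ℚ) ≤ (-1) ^ (oddExpOff D r).card := by
    rcases neg_one_pow_eq_or ℚ (oddExpOff D r).card with e | e <;> rw [e]; norm_num
  rcases prod_tauPrime_eq_one_or (oddExpOff_spec (D := D) (r := r)) with ⟨h, h1⟩ | ⟨_, _, h⟩
  · rw [h]; norm_num
  · intro h0
    have hpos : (0 : ℚ) < ∏ l ∈ oddExpOff D r, tauPrime l := by linarith
    field_simp at h0
    linarith

theorem quadTerm_eq_one_iff {D r : ℤ} : 1 - quadTerm D r = 0 ↔ oddExpOff D r = ∅ := by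
  unfold quadTerm
  have he : (-1 : ℚ) ^ (oddExpOff D r).card ≤ 1 := by
    rcases neg_one_pow_eq_or ℚ (oddExpOff D r).card with e | e <;> rw [e]; norm_num
  rcases prod_tauPrime_eq_one_or (oddExpOff_spec (D := D) (r := r)) with ⟨h, h1⟩ | ⟨h', _, h⟩
  · rw [h]; norm_num
  · refine ⟨fun h0 => ?_, fun h => absurd h h'⟩
    have hpos : (0 : ℚ) < ∏ l ∈ oddExpOff D r, tauPrime l := by linarith
    field_simp at h0
    linarith

theorem natAbs_dBar {D : ℤ} (hD : D ≠ 0) (r : ℤ) :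
    (dBar D r).natAbs = 2 ^ expMod4 D 2 * oddBar D r := by
  rw [dBar_eq, Int.natAbs_mul, Int.natAbs_mul, Int.natAbs_sign_of_ne_zero hD, one_mul,
    Int.natAbs_pow, Int.natAbs_natCast]
  rfl

theorem QuarticCase.even_expMod4 {D : ℤ} (h : QuarticCase D) : Even (expMod4 D 2) := by
  rcases h with h | h
  · by_contra h0
    have h1 : expMod4 D 2 ≠ 0 := fun h1 => h0 (by rw [h1]; exact Even.zero)
    have h2 : (2 : ℤ) ∣ fourthFree D := by
      unfold fourthFree
      exact ((dvd_pow_self (2 : ℤ) h1).mul_left _).mul_right _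
    omega
  · rw [h.1]; exact even_two

theorem explicitDensity_eq_zero_iff_of_odd {D r : ℤ} (hD : D ≠ 0) (hr : Odd r) :
    explicitDensity D r = 0 ↔ VanishingOdd D r := by
  rw [explicitDensity, if_pos hr, VanishingOdd]
  by_cases hq : QuarticCase D
  · rw [if_pos hq]
    have hr2 := Int.odd_iff.1 hr
    have hcore := density_factor_eq_zero_iff (A := oddExpOff D r) (B := twoExpOff D r)
      oddExpOff_spec twoExpOff_spec
      (x := (if r % 4 = 1 then 1 else -1) * (-1) ^ (countMod8 (oddExpOn D r) 3 5 +
        countMod8 (oddExpOff D r) 1 7 + (twoExpOff D r).card)) (by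
        rcases neg_one_pow_eq_or ℚ (countMod8 (oddExpOn D r) 3 5 +
          countMod8 (oddExpOff D r) 1 7 + (twoExpOff D r).card) with e | e <;> rw [e] <;>
          split_ifs <;> norm_num)
    have hmem : (dBar D r).natAbs ∈ ({1, 4, 3, 5, 27, 125, 12, 20, 108, 500} : Finset ℕ) ↔
        twoExpOff D r = ∅ ∧
          (oddExpOff D r = ∅ ∨ oddExpOff D r = {3} ∨ oddExpOff D r = {5}) := by
      rw [← oddBar_mem_iff, natAbs_dBar hD]
      simp only [Finset.mem_insert, Finset.mem_singleton]
      have hn := Nat.odd_iff.1 (oddBar_odd D r)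
      have hσ := Nat.even_iff.1 hq.even_expMod4
      have hσ4 := expMod4_lt D 2
      have : expMod4 D 2 = 0 ∨ expMod4 D 2 = 2 := by omega
      rcases this with h | h <;> rw [h] <;> omega
    have hform : (1 / 4 * (1 + quadTerm D r + (if r % 4 = 1 then 1 else -1) *
        (2 * quartTermOdd D r)) = 0) ↔ (1 + (-1) ^ (oddExpOff D r).card /
        ∏ l ∈ oddExpOff D r, tauPrime l + 2 * (((if r % 4 = 1 then 1 else -1) *
        (-1) ^ (countMod8 (oddExpOn D r) 3 5 + countMod8 (oddExpOff D r) 1 7 +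
          (twoExpOff D r).card)) / ((∏ l ∈ oddExpOff D r, tauPrime l) *
          ∏ l ∈ twoExpOff D r, tauPrime l)) = 0) := by
      rw [mul_eq_zero, or_iff_right (by norm_num), quadTerm, quartTermOdd, quartDenom,
        mul_left_comm, mul_div_assoc]
    rw [hform, hcore, hmem, ← and_assoc]
    have hcond : ∀ h : twoExpOff D r = ∅ ∧
        (oddExpOff D r = ∅ ∨ oddExpOff D r = {3} ∨ oddExpOff D r = {5}),
        ((if r % 4 = 1 then (1 : ℚ) else -1) * (-1) ^ (countMod8 (oddExpOn D r) 3 5 +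
          countMod8 (oddExpOff D r) 1 7 + (twoExpOff D r).card) = -1 ↔
        ((r % 4 = 1 ∧ Odd (countMod8 (oddExpOn D r) 3 5)) ∨
          (r % 4 = 3 ∧ Even (countMod8 (oddExpOn D r) 3 5)))) := by
      rintro ⟨hB, hA⟩
      have h17 : countMod8 (oddExpOff D r) 1 7 = 0 := by
        rcases hA with h | h | h <;> rw [h] <;> rfl
      rw [h17, hB, Finset.card_empty, add_zero, add_zero]
      have h4 : r % 4 = 1 ∨ r % 4 = 3 := by omega
      rcases Nat.even_or_odd (countMod8 (oddExpOn D r) 3 5) with he | he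
      · have hno := Nat.not_odd_iff_even.2 he
        rw [he.neg_one_pow]
        rcases h4 with h | h <;> (simp [h, he, hno]; try norm_num)
      · have hno := Nat.not_even_iff_odd.2 he
        rw [he.neg_one_pow]
        rcases h4 with h | h <;> (simp [h, he, hno]; try norm_num)
    constructor
    · rintro ⟨h1, h2⟩; exact ⟨hq, h1, (hcond h1).1 h2⟩
    · rintro ⟨_, h1, h2⟩; exact ⟨h1, (hcond h1).2 h2⟩
  · rw [if_neg hq]
    refine iff_of_false ?_ (fun h => hq h.1)
    split_ifs
    · exact mul_ne_zero (by norm_num) quadTerm_ne_neg_one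
    · norm_num

theorem dPart_mod_four_cases (D r : ℤ) : dPart D r % 4 = 1 ∨ dPart D r % 4 = 3 := by
  have hsub : (oddPrimeFactors D).filter (fun l : ℕ => (l : ℤ) ∣ r) ⊆ oddPrimeFactors D :=
    Finset.filter_subset _ _
  have h1 := prod_pow_expMod4_emod_four hsub
  have hd : dPart D r = ∏ l ∈ (oddPrimeFactors D).filter (fun l : ℕ => (l : ℤ) ∣ r),
    (l : ℤ) ^ expMod4 D l := rfl
  rw [← hd] at h1
  rcases prod_chi_four_cases hsub with h | h <;> rw [h] at h1 <;> omega

theorem neg_one_pow_dPart (D r : ℤ) :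
    (-1 : ℚ) ^ ((dPart D r - 1) / 2).toNat = if dPart D r % 4 = 1 then 1 else -1 := by
  have h1 := dPart_mod_four_cases D r
  have h2 := dPart_pos D r
  split_ifs with h
  · exact Even.neg_one_pow (by rw [Nat.even_iff]; omega)
  · exact Odd.neg_one_pow (by rw [Nat.odd_iff]; omega)

theorem explicitDensity_eq_zero_iff_of_even {D r : ℤ} (hD : D ≠ 0) (hr : ¬ Odd r) :
    explicitDensity D r = 0 ↔ VanishingEven D r := by
  rw [explicitDensity, if_neg hr, VanishingEven, natAbs_dBar hD, fourthFree_eq D r]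
  have hdB := dBar_eq D r
  have hn := Nat.odd_iff.1 (oddBar_odd D r)
  have hσ4 := expMod4_lt D 2
  have hr2 : r % 2 = 0 := by rw [Int.odd_iff] at hr; omega
  have hsgn := sign_cases hD
  have hd4 := dPart_mod_four_cases D r
  by_cases hc : Even (expMod4 D 2) ∨ (4 : ℤ) ∣ r
  · rw [if_pos hc, mul_eq_zero, or_iff_right (by norm_num), quadTerm_eq_one_iff]
    have hc' : expMod4 D 2 = 0 ∨ expMod4 D 2 = 2 ∨ (4 : ℤ) ∣ r := by
      rw [Nat.even_iff] at hc; omega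
    constructor
    · intro h; exact Or.inl ⟨hc, h⟩
    · rintro (⟨_, h⟩ | h)
      · exact h
      · exfalso
        rw [hdB] at h
        simp only [Finset.mem_insert, Finset.mem_singleton] at h
        rcases hc' with h0 | h0 | h0
        · rw [h0] at h
          rcases hsgn with hs | hs <;> rw [hs] at h <;> omega
        · rw [h0] at h
          rcases hsgn with hs | hs <;> rw [hs] at h <;> omega
        · omega
  · rw [if_neg hc]
    have hσ : expMod4 D 2 = 1 ∨ expMod4 D 2 = 3 := by
      rw [Nat.even_iff] at hc; omega
    have hr8 : r % 8 = 2 ∨ r % 8 = 6 := by omega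
    have hcore := density_factor_eq_zero_iff (A := oddExpOff D r) (B := twoExpOff D r)
      oddExpOff_spec twoExpOff_spec
      (x := (if r % 8 = 2 then 1 else -1) * (if expMod4 D 2 = 1 then 1 else -1) * (D.sign : ℚ) *
        (-1) ^ (countMod8 (oddExpOff D r) 1 5 + (twoExpOff D r).card +
          ((dPart D r - 1) / 2).toNat)) (by
        rcases neg_one_pow_eq_or ℚ (countMod8 (oddExpOff D r) 1 5 + (twoExpOff D r).card +
          ((dPart D r - 1) / 2).toNat) with e | e <;> rcases hsgn with hs | hs <;>
          rw [e, hs] <;> split_ifs <;> norm_num)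
    have hform : (1 / 4 * (1 + quadTerm D r + (if r % 8 = 2 then 1 else -1) *
        (if expMod4 D 2 = 1 then 1 else -1) * (D.sign : ℚ) * (2 * quartTermEven D r)) = 0) ↔
        (1 + (-1) ^ (oddExpOff D r).card / ∏ l ∈ oddExpOff D r, tauPrime l +
        2 * (((if r % 8 = 2 then 1 else -1) * (if expMod4 D 2 = 1 then 1 else -1) * (D.sign : ℚ) *
        (-1) ^ (countMod8 (oddExpOff D r) 1 5 + (twoExpOff D r).card +
          ((dPart D r - 1) / 2).toNat)) / ((∏ l ∈ oddExpOff D r, tauPrime l) *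
          ∏ l ∈ twoExpOff D r, tauPrime l)) = 0) := by
      rw [mul_eq_zero, or_iff_right (by norm_num), quadTerm, quartTermEven, quartDenom,
        mul_left_comm, mul_div_assoc]
    rw [hform, hcore]
    have hmem := oddBar_mem_iff (D := D) (r := r)
    have h1 := oddBar_eq_one_iff (D := D) (r := r)
    have h3 := oddBar_eq_prime_pow_iff (D := D) (r := r) Nat.prime_three
    have h5 := oddBar_eq_prime_pow_iff (D := D) (r := r) Nat.prime_five
    norm_num at h3 h5
    rw [← and_assoc, ← hmem]
    have hx : ∀ k : ℚ, k = (-1) ^ countMod8 (oddExpOff D r) 1 5 → twoExpOff D r = ∅ →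
        ((if r % 8 = 2 then 1 else -1) * (if expMod4 D 2 = 1 then 1 else -1) * (D.sign : ℚ) *
        (-1) ^ (countMod8 (oddExpOff D r) 1 5 + (twoExpOff D r).card +
          ((dPart D r - 1) / 2).toNat) = -1 ↔ (if r % 8 = 2 then 1 else -1) *
          (if expMod4 D 2 = 1 then 1 else -1) * (D.sign : ℚ) *
          (k * if dPart D r % 4 = 1 then 1 else -1) = -1) := by
      intro k hk hB
      rw [hB, Finset.card_empty, add_zero, pow_add, ← hk, neg_one_pow_dPart]
    rw [hdB]
    simp only [Finset.mem_insert, Finset.mem_singleton]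
    have hprod : ∀ s : ℤ, s * 2 ^ expMod4 D 2 * (oddBar D r : ℤ) =
      s * (2 ^ expMod4 D 2 * (oddBar D r : ℤ)) := fun s => by ring
    by_cases hn0 : oddBar D r = 1 ∨ (oddBar D r = 3 ∨ oddBar D r = 27) ∨
        (oddBar D r = 5 ∨ oddBar D r = 125)
    · rw [and_iff_right hn0, or_iff_right (fun h => hc h.1)]
      obtain ⟨hB, _⟩ := hmem.1 hn0
      obtain ⟨e, he⟩ : ∃ e, dPart D r = 4 * e + dPart D r % 4 := ⟨dPart D r / 4, by omega⟩
      rcases hn0 with h | h | h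
      · have hk : (1 : ℚ) = (-1) ^ countMod8 (oddExpOff D r) 1 5 := by
          rw [(h1.1 h).1]; rfl
        rw [hx 1 hk hB, h]
        rcases hσ with hσ | hσ <;> rcases hsgn with hs | hs <;> rcases hr8 with h8 | h8 <;>
          rcases hd4 with h4 | h4 <;> rw [he, hσ, hs, h8, h4] <;> norm_num <;> omega
      · have hk : (1 : ℚ) = (-1) ^ countMod8 (oddExpOff D r) 1 5 := by
          rw [(h3.1 h).1]; rfl
        rw [hx 1 hk hB]
        rcases h with h | h <;>
        rcases hσ with hσ | hσ <;> rcases hsgn with hs | hs <;> rcases hr8 with h8 | h8 <;>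
          rcases hd4 with h4 | h4 <;> rw [h, hσ, hs, h8, h4] <;> norm_num
      · have hk : (-1 : ℚ) = (-1) ^ countMod8 (oddExpOff D r) 1 5 := by
          rw [(h5.1 h).1]; rfl
        rw [hx (-1) hk hB]
        rcases h with h | h <;>
        rcases hσ with hσ | hσ <;> rcases hsgn with hs | hs <;> rcases hr8 with h8 | h8 <;>
          rcases hd4 with h4 | h4 <;> rw [h, hσ, hs, h8, h4] <;> norm_num
    · refine iff_of_false (fun h => hn0 h.1) ?_
      rintro (h | h)
      · exact hc h.1
      · rcases hσ with hσ | hσ <;> rcases hsgn with hs | hs <;> rw [hσ, hs] at h <;> omega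

/-- The density vanishes exactly for the pairs in the two lists. -/
theorem explicitDensity_eq_zero_iff {D r : ℤ} (hD : D ≠ 0) :
    explicitDensity D r = 0 ↔ InVanishingTables D r := by
  rw [InVanishingTables]
  by_cases hr : Odd r
  · rw [explicitDensity_eq_zero_iff_of_odd hD hr]
    rw [and_iff_right hr, or_iff_left (fun h => Int.not_even_iff_odd.2 hr h.1)]
  · rw [explicitDensity_eq_zero_iff_of_even hD hr]
    rw [and_iff_right (Int.not_odd_iff_even.1 hr), or_iff_right (fun h => hr h.1)]

/-! ### The primes with `a_p = 2r` as a union of polynomial progressions -/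

/-- Half of the trace is the real part of a Gaussian integer of norm `p`. -/
theorem exists_frobeniusTrace_eq {D : ℤ} {p : ℕ} [Fact p.Prime] (hD : ¬ (p : ℤ) ∣ 2 * D)
    (hp : p % 4 = 1) :
    ∃ w : GaussianInt, frobeniusTrace (curveE D) p = 2 * w.re ∧ (p : ℤ) = w.re ^ 2 + w.im ^ 2 := by
  obtain ⟨ι, hι'⟩ := (ZMod.exists_sq_eq_neg_one_iff (p := p)).2 (by omega)
  have hι : ι * ι = -1 := hι'.symm
  obtain ⟨χ, h⟩ := exists_isQuarticChar hp ι hι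
  have hD0 : (D : ZMod p) ≠ 0 := fun h0 =>
    hD (((ZMod.intCast_zmod_eq_zero_iff_dvd _ _).1 h0).mul_left 2)
  have h1 := h.sum_cubic hp hD0
  set J := jacobiSum χ (χ ^ 2) with hJ
  set v := χ (-1) * χ D ^ 3 with hv
  have hv4 : v ^ 4 = 1 := by
    calc v ^ 4 = (χ (-1) ^ 2) ^ 2 * (χ D ^ 4) ^ 3 := by rw [hv]; ring
      _ = 1 := by rw [h.pow_four _ hD0, IsQuarticChar.apply_neg_one_sq χ]; ring
  have hv1 : v * star v = 1 := by rw [gaussian_star_eq_pow_three hv4, ← pow_succ', hv4]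
  refine ⟨-(v * J), ?_, ?_⟩
  · have h3 := congrArg Zsqrtd.re h1
    rw [frobeniusTrace_curveE hD]
    simp only [Zsqrtd.re_intCast, Zsqrtd.re_add, Zsqrtd.re_star] at h3
    rw [h3, Zsqrtd.re_neg]; ring
  · have hn : -(v * J) * star (-(v * J)) = (p : GaussianInt) := by
      rw [star_neg, neg_mul_neg, star_mul']
      calc _ = (v * star v) * (J * star J) := by ring
        _ = p := by rw [hv1, hJ, h.jacobiSum_mul_star hp, one_mul]
    have h3 := congrArg Zsqrtd.re hn
    set z := -(v * J)
    simp at h3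
    linarith

theorem even_frobeniusTrace {D : ℤ} {p : ℕ} (hp : p.Prime) (hD : ¬ (p : ℤ) ∣ 2 * D) :
    Even (frobeniusTrace (curveE D) p) := by
  have : Fact p.Prime := ⟨hp⟩
  have hp2 : p ≠ 2 := by rintro rfl; exact hD (dvd_mul_right _ _)
  have hodd := Nat.odd_iff.1 (hp.odd_of_ne_two hp2)
  have h4 : p % 4 = 1 ∨ p % 4 = 3 := by omega
  rcases h4 with h4 | h4
  · obtain ⟨w, hw, _⟩ := exists_frobeniusTrace_eq hD h4
    rw [hw]; exact even_two_mul _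
  · rw [frobeniusTrace_curveE_of_mod_four_eq_three hD h4]; exact Even.zero

theorem tracePrimes_of_odd (D : ℤ) {t : ℤ} (ht : Odd t) : tracePrimes (curveE D) t = ∅ := by
  refine Set.eq_empty_of_forall_notMem ?_
  rintro p ⟨hp, hpD, htr⟩
  rw [dvd_curveE_discr_iff hp] at hpD
  have h := even_frobeniusTrace hp hpD
  rw [htr] at h
  exact Int.not_even_iff_odd.2 ht h

theorem exists_eq_sq_add_sq_of_mem_tracePrimes {D r : ℤ} (hr : r ≠ 0) {p : ℕ}
    (h : p ∈ tracePrimes (curveE D) (2 * r)) : ∃ x : ℕ, (p : ℤ) = r ^ 2 + (x : ℤ) ^ 2 := by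
  obtain ⟨hp, hpD, htr⟩ := h
  rw [dvd_curveE_discr_iff hp] at hpD
  have : Fact p.Prime := ⟨hp⟩
  have hp2 : p ≠ 2 := by rintro rfl; exact hpD (dvd_mul_right _ _)
  have hodd := Nat.odd_iff.1 (hp.odd_of_ne_two hp2)
  have h4 : p % 4 = 1 ∨ p % 4 = 3 := by omega
  rcases h4 with h4 | h4
  · obtain ⟨w, hw, hwp⟩ := exists_frobeniusTrace_eq hpD h4
    refine ⟨w.im.natAbs, ?_⟩
    have hre : w.re = r := by rw [hw] at htr; linarith
    rw [hwp, hre, Int.natCast_natAbs, sq_abs]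
  · rw [frobeniusTrace_curveE_of_mod_four_eq_three hpD h4] at htr
    omega

/-- A prime `r² + x²` has good reduction exactly when `x` is admissible. -/
theorem admissible_iff_not_dvd {D r x : ℤ} (hD : D ≠ 0) {p : ℕ} (hp : p.Prime)
    (hpr : (p : ℤ) = r ^ 2 + x ^ 2) : Admissible D r x ↔ ¬ (p : ℤ) ∣ 2 * D := by
  rw [dvd_two_mul_iff hD hp, not_or]
  have hpar : Odd (r + x) ↔ p ≠ 2 := by
    have h1 : Odd (p : ℤ) ↔ Odd (r + x) := by
      rw [hpr, Int.odd_add, Int.odd_add, Int.odd_pow' two_ne_zero, Int.even_pow' two_ne_zero]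
    rw [← h1, Int.odd_coe_nat]
    exact ⟨by rintro h rfl; revert h; decide, hp.odd_of_ne_two⟩
  rw [Admissible, hpar, ← hpr]
  refine and_congr_right fun _ => ⟨fun h hmem => h p hmem dvd_rfl, fun h l hl hdvd => h ?_⟩
  have hlp := (oddPrimeFactors_spec hl).1
  rw [Int.natCast_dvd_natCast, Nat.prime_dvd_prime_iff_eq hlp hp] at hdvd
  rwa [← hdvd]

theorem mem_admissibleResidues {D r : ℤ} {x : ℕ} :
    x ∈ admissibleResidues D r ↔ x < traceModulus D ∧ Admissible D r x := by
  rw [admissibleResidues, Finset.mem_filter, Finset.mem_range]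

theorem traceModulus_pos (D : ℤ) : 0 < traceModulus D :=
  Nat.mul_pos (by norm_num) (Finset.prod_pos fun l hl => (oddPrimeFactors_spec hl).1.pos)

theorem mem_tracePrimes_iff {D r : ℤ} (hD : D ≠ 0) (hr : r ≠ 0) {p : ℕ} (hp : p.Prime) :
    p ∈ tracePrimes (curveE D) (2 * r) ↔ ∃ x : ℕ, (p : ℤ) = r ^ 2 + (x : ℤ) ^ 2 ∧
      x % traceModulus D ∈ goodResidues D r := by
  have key : ∀ x : ℕ, (p : ℤ) = r ^ 2 + (x : ℤ) ^ 2 →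
      (p ∈ tracePrimes (curveE D) (2 * r) ↔ x % traceModulus D ∈ goodResidues D r) := by
    intro x hx
    have hmod : (traceModulus D : ℤ) ∣ ((x % traceModulus D : ℕ) : ℤ) - x := by
      rw [Int.natCast_mod, ← Int.modEq_iff_dvd]; exact (Int.mod_modEq _ _).symm
    have hadm := admissible_congr (D := D) (r := r) hmod
    have h1 : p ∈ tracePrimes (curveE D) (2 * r) ↔
        Admissible D r x ∧ traceSymbol D r x = 1 := by
      rw [tracePrimes, Set.mem_ofPred_eq, dvd_curveE_discr_iff hp,
        ← admissible_iff_not_dvd hD hp hx, and_iff_right hp]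
      refine and_congr_right fun h => ?_
      exact frobeniusTrace_eq_two_mul_iff hD hr hp ((admissible_iff_not_dvd hD hp hx).1 h) hx
    rw [h1, goodResidues, Finset.mem_filter, mem_admissibleResidues,
      and_iff_right (Nat.mod_lt _ (traceModulus_pos D)), hadm]
    refine and_congr_right fun h => ?_
    rw [traceSymbol_congr (hadm.2 h) hmod]
  constructor
  · intro h
    obtain ⟨x, hx⟩ := exists_eq_sq_add_sq_of_mem_tracePrimes hr h
    exact ⟨x, hx, (key x hx).1 h⟩
  · rintro ⟨x, hx, h⟩
    exact (key x hx).2 h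

/-- The primes `p ≤ N` of the form `(M n + k)² + r²`, with `n ≥ 0`. -/
def progressionPrimes (M k : ℕ) (r : ℤ) (N : ℝ) : Set ℕ :=
  {p : ℕ | p.Prime ∧ (p : ℝ) ≤ N ∧ ∃ n : ℕ,
    (p : ℤ) = (M : ℤ) ^ 2 * (n : ℤ) ^ 2 + 2 * M * k * (n : ℤ) + ((k : ℤ) ^ 2 + r ^ 2)}

theorem finite_setOf_natCast_le (N : ℝ) : {p : ℕ | (p : ℝ) ≤ N}.Finite := by
  refine (Set.finite_le_nat ⌊N⌋₊).subset fun p hp => ?_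
  exact Nat.le_floor hp

theorem finite_progressionPrimes (M k : ℕ) (r : ℤ) (N : ℝ) : (progressionPrimes M k r N).Finite :=
  (finite_setOf_natCast_le N).subset fun _ hp => hp.2.1

theorem mem_progressionPrimes_iff {M k : ℕ} (hk : k < M) {r : ℤ} {N : ℝ} {p : ℕ} :
    p ∈ progressionPrimes M k r N ↔ p.Prime ∧ (p : ℝ) ≤ N ∧
      ∃ x : ℕ, (p : ℤ) = r ^ 2 + (x : ℤ) ^ 2 ∧ x % M = k := by
  refine and_congr_right fun _ => and_congr_right fun _ => ⟨?_, ?_⟩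
  · rintro ⟨n, hn⟩
    refine ⟨M * n + k, ?_, by rw [Nat.mul_add_mod, Nat.mod_eq_of_lt hk]⟩
    rw [hn]; push_cast; ring
  · rintro ⟨x, hx, hxk⟩
    refine ⟨x / M, ?_⟩
    have : (x : ℤ) = M * (x / M : ℕ) + k := by
      rw [← hxk]; exact_mod_cast (Nat.div_add_mod x M).symm
    rw [hx, this]; push_cast; ring

theorem tracePrimeCount_eq_sum {D r : ℤ} (hD : D ≠ 0) (hr : r ≠ 0) (N : ℝ) :
    tracePrimeCount (curveE D) (2 * r) N =
      ∑ k ∈ goodResidues D r, (progressionPrimes (traceModulus D) k r N).ncard := by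
  classical
  have hlt : ∀ k ∈ goodResidues D r, k < traceModulus D := fun k hk =>
    (mem_admissibleResidues.1 (Finset.mem_filter.1 hk).1).1
  have hset : {p : ℕ | p ∈ tracePrimes (curveE D) (2 * r) ∧ (p : ℝ) ≤ N} =
      ((goodResidues D r).biUnion fun k =>
        (finite_progressionPrimes (traceModulus D) k r N).toFinset : Finset ℕ) := by
    ext p
    simp only [Set.mem_ofPred_eq, Finset.coe_biUnion, Set.mem_iUnion, Set.Finite.coe_toFinset,
      Finset.mem_coe]
    constructor
    · rintro ⟨h, hN⟩
      have hp := h.1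
      obtain ⟨x, hx, hxg⟩ := (mem_tracePrimes_iff hD hr hp).1 h
      exact ⟨_, hxg, (mem_progressionPrimes_iff (hlt _ hxg)).2 ⟨hp, hN, x, hx, rfl⟩⟩
    · rintro ⟨k, hk, h⟩
      obtain ⟨hp, hN, x, hx, hxk⟩ := (mem_progressionPrimes_iff (hlt k hk)).1 h
      exact ⟨(mem_tracePrimes_iff hD hr hp).2 ⟨x, hx, by rwa [hxk]⟩, hN⟩
  rw [tracePrimeCount, hset, Set.ncard_coe_finset, Finset.card_biUnion]
  · exact Finset.sum_congr rfl fun k _ => (Set.ncard_eq_toFinset_card _ _).symm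
  · intro k hk k' hk' hne
    refine Finset.disjoint_left.2 ?_
    intro p hp hp'
    rw [Set.Finite.mem_toFinset] at hp hp'
    obtain ⟨_, _, x, hx, hxk⟩ := (mem_progressionPrimes_iff (hlt k hk)).1 hp
    obtain ⟨_, _, y, hy, hyk⟩ := (mem_progressionPrimes_iff (hlt k' hk')).1 hp'
    have h1 : (x : ℤ) ^ 2 = (y : ℤ) ^ 2 := by linarith
    have h2 : x = y := by
      have : x ^ 2 = y ^ 2 := by exact_mod_cast h1
      exact Nat.pow_left_injective two_ne_zero this
    exact hne (by rw [← hxk, ← hyk, h2])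

theorem primesQ_eq (r : ℤ) (N : ℝ) : primesQ r N = progressionPrimes 1 0 r N := by
  ext p
  rw [mem_progressionPrimes_iff one_pos]
  refine and_congr_right fun _ => and_congr_right fun _ => ⟨?_, ?_⟩
  · rintro ⟨x, hx⟩
    exact ⟨x.natAbs, by rw [hx, Int.natCast_natAbs, sq_abs], Nat.mod_one _⟩
  · rintro ⟨x, hx, _⟩
    exact ⟨x, hx⟩

theorem primesQ_inter_tracePrimes {D r : ℤ} (hr : r ≠ 0) (N : ℝ) :
    (primesQ r N ∩ tracePrimes (curveE D) (2 * r)).ncard =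
      tracePrimeCount (curveE D) (2 * r) N := by
  rw [tracePrimeCount]
  congr 1
  ext p
  constructor
  · rintro ⟨h1, h2⟩
    exact ⟨h2, h1.2.1⟩
  · rintro ⟨h1, h2⟩
    obtain ⟨x, hx⟩ := exists_eq_sq_add_sq_of_mem_tracePrimes hr h1
    exact ⟨⟨h1.1, h2, x, hx⟩, h1⟩

/-! ### Asymptotics -/

theorem tendsto_sqrt_div_log : Tendsto (fun x : ℝ => Real.sqrt x / Real.log x) atTop atTop := by
  have h := isLittleO_log_rpow_atTop (r := 1 / 2) (by norm_num)
  have h1 : Tendsto (fun x : ℝ => Real.log x / Real.sqrt x) atTop (𝓝[>] 0) := by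
    refine tendsto_nhdsWithin_iff.2 ⟨?_, ?_⟩
    · refine h.tendsto_div_nhds_zero.congr fun x => ?_
      rw [Real.sqrt_eq_rpow]
    · filter_upwards [eventually_gt_atTop (1 : ℝ)] with x hx
      exact div_pos (Real.log_pos hx) (Real.sqrt_pos.2 (by linarith))
  exact (h1.inv_tendsto_nhdsGT_zero).congr fun x => by simp [inv_div]

/-- Counting the primes `p ≤ N` instead of the primes `p < N` changes the count by at most one. -/
theorem abs_ncard_progressionPrimes_sub_le (M k : ℕ) (r : ℤ) (N : ℝ) :
    |((progressionPrimes M k r N).ncard : ℝ) -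
      hlPrimeCount ((M : ℤ) ^ 2) (2 * M * k) ((k : ℤ) ^ 2 + r ^ 2) N| ≤ 1 := by
  set A := {p : ℕ | p.Prime ∧ (p : ℝ) < N ∧ ∃ n : ℕ,
    (p : ℤ) = (M : ℤ) ^ 2 * (n : ℤ) ^ 2 + 2 * M * k * (n : ℤ) + ((k : ℤ) ^ 2 + r ^ 2)} with hA
  have hhl : hlPrimeCount ((M : ℤ) ^ 2) (2 * M * k) ((k : ℤ) ^ 2 + r ^ 2) N = A.ncard := rfl
  have hfin := finite_progressionPrimes M k r N
  have hsub : A ⊆ progressionPrimes M k r N := fun p hp => ⟨hp.1, hp.2.1.le, hp.2.2⟩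
  have hle := Set.ncard_le_ncard hsub hfin
  have hsup : progressionPrimes M k r N ⊆ insert ⌊N⌋₊ A := by
    rintro p ⟨hp, hN, hn⟩
    rcases hN.lt_or_eq with h | h
    · exact Or.inr ⟨hp, h, hn⟩
    · left; rw [← h, Nat.floor_natCast]
  have hge := (Set.ncard_le_ncard hsup ((hfin.subset hsub).insert _)).trans
    (Set.ncard_insert_le _ _)
  rw [hhl, abs_le]
  have h1 : (A.ncard : ℝ) ≤ (progressionPrimes M k r N).ncard := by exact_mod_cast hle
  have h2 : ((progressionPrimes M k r N).ncard : ℝ) ≤ A.ncard + 1 := by exact_mod_cast hge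
  constructor <;> linarith

/-- The conjecture for `(M n + k)² + r²`, with the error term in additive form, so that the
estimates for several polynomials can be added. -/
theorem HardyLittlewoodConjecture.progressionPrimes_isLittleO (hHL : HardyLittlewoodConjecture)
    {M k : ℕ} {r : ℤ} (hr : r ≠ 0) (hM : 0 < M) (hcop : IsCoprime (M : ℤ) ((k : ℤ) ^ 2 + r ^ 2))
    (hodd : ¬ (Even ((M : ℤ) ^ 2 + 2 * M * k) ∧ Even ((k : ℤ) ^ 2 + r ^ 2))) :
    (fun N : ℝ => ((progressionPrimes M k r N).ncard : ℝ) -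
      hlConst ((M : ℤ) ^ 2) (2 * M * k) ((k : ℤ) ^ 2 + r ^ 2) * (Real.sqrt N / Real.log N))
      =o[atTop] (fun N : ℝ => Real.sqrt N / Real.log N) := by
  have hM' : (0 : ℤ) < M := by exact_mod_cast hM
  have hr2 : 0 < r ^ 2 := by positivity
  have hgcd : Int.gcd (Int.gcd ((M : ℤ) ^ 2) (2 * M * k) : ℤ) ((k : ℤ) ^ 2 + r ^ 2) = 1 := by
    rw [← Int.isCoprime_iff_gcd_eq_one]
    exact (IsCoprime.pow_left (m := 2) hcop).of_isCoprime_of_dvd_left (Int.gcd_dvd_left _ _)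
  have hns : ¬ IsSquare ((2 * M * k : ℤ) ^ 2 - 4 * (M : ℤ) ^ 2 * ((k : ℤ) ^ 2 + r ^ 2)) := by
    intro h
    have h1 := h.nonneg
    have h2 : (2 * M * k : ℤ) ^ 2 - 4 * (M : ℤ) ^ 2 * ((k : ℤ) ^ 2 + r ^ 2) =
      -(4 * (M : ℤ) ^ 2 * r ^ 2) := by ring
    have h3 : 0 < 4 * (M : ℤ) ^ 2 * r ^ 2 := by positivity
    linarith
  have h := (hHL _ _ _ (pow_pos hM' 2) hgcd hodd hns).isLittleO
  set c := hlConst ((M : ℤ) ^ 2) (2 * M * k) ((k : ℤ) ^ 2 + r ^ 2)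
  have h1 := h.trans_isBigO (isBigO_const_mul_self c
    (fun N : ℝ => Real.sqrt N / Real.log N) atTop)
  have h2 : (fun N : ℝ => ((progressionPrimes M k r N).ncard : ℝ) -
      hlPrimeCount ((M : ℤ) ^ 2) (2 * M * k) ((k : ℤ) ^ 2 + r ^ 2) N) =o[atTop]
      (fun N : ℝ => Real.sqrt N / Real.log N) := by
    have hb : (fun N : ℝ => ((progressionPrimes M k r N).ncard : ℝ) -
      hlPrimeCount ((M : ℤ) ^ 2) (2 * M * k) ((k : ℤ) ^ 2 + r ^ 2) N) =O[atTop]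
        (fun _ : ℝ => (1 : ℝ)) :=
      IsBigO.of_bound 1 (Eventually.of_forall fun N => by
        rw [Real.norm_eq_abs, norm_one, mul_one]
        exact abs_ncard_progressionPrimes_sub_le M k r N)
    refine hb.trans_isLittleO ((isLittleO_const_left).2 (Or.inr ?_))
    exact tendsto_norm_atTop_atTop.comp tendsto_sqrt_div_log
  refine (h2.add h1).congr_left fun N => ?_
  simp only [Pi.sub_apply]
  ring

theorem isCoprime_traceModulus {D r k : ℤ} (h : Admissible D r k) :
    IsCoprime (traceModulus D : ℤ) (k ^ 2 + r ^ 2) := by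
  have hodd : Odd (k ^ 2 + r ^ 2) := by
    have := h.1
    rw [Int.odd_iff] at this
    rw [Int.odd_add, Int.odd_pow' two_ne_zero, Int.even_pow' two_ne_zero, Int.odd_iff, Int.even_iff]
    omega
  rw [traceModulus]
  push_cast
  refine IsCoprime.mul_left ?_ (IsCoprime.prod_left fun l hl => ?_)
  · rw [show (8 : ℤ) = 2 ^ 3 by norm_num]
    refine IsCoprime.pow_left ?_
    obtain ⟨m, hm⟩ := hodd
    exact ⟨-m, 1, by rw [hm]; ring⟩
  · have hp := Nat.prime_iff_prime_int.1 (oddPrimeFactors_spec hl).1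
    rw [hp.coprime_iff_not_dvd, add_comm]
    exact h.2 l hl

/-- The constants of the polynomials attached to the good residues add up to the Lang–Trotter
constant. -/
theorem sum_hlConst_goodResidues {D r : ℤ} (hD : D ≠ 0) (hr : r ≠ 0) :
    ∑ k ∈ goodResidues D r, hlConst ((traceModulus D : ℤ) ^ 2) (2 * traceModulus D * (k : ℕ))
      ((k : ℤ) ^ 2 + r ^ 2) = langTrotterConst D r := by
  have hadm : ((admissibleResidues D r).card : ℝ) =
      4 * ∏ l ∈ oddPrimeFactors D, (admCount r l : ℝ) := by
    exact_mod_cast congrArg (Int.cast (R := ℝ)) (card_admissibleResidues D r)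
  have hne : ((admissibleResidues D r).card : ℝ) ≠ 0 := by
    exact_mod_cast (card_admissibleResidues_pos D r).ne'
  have hS : ∀ l ∈ oddPrimeFactors D, l.Prime ∧ 2 < l := fun l hl => by
    obtain ⟨hp, h2⟩ := oddPrimeFactors_spec hl
    exact ⟨hp, lt_of_le_of_ne hp.two_le h2.symm⟩
  have hk : ∀ k : ℕ, hlConst ((traceModulus D : ℤ) ^ 2) (2 * traceModulus D * k)
      ((k : ℤ) ^ 2 + r ^ 2) = hlConst 1 0 (r ^ 2) / (admissibleResidues D r).card := by
    intro k
    rw [eq_div_iff hne, hadm]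
    exact hlConst_progression hr hS rfl k
  have hcard : ((goodResidues D r).card : ℝ) =
      (explicitDensity D r : ℝ) * (admissibleResidues D r).card := by
    exact_mod_cast congrArg (Rat.cast (K := ℝ)) (card_goodResidues hD r)
  rw [Finset.sum_congr rfl fun k _ => hk k, Finset.sum_const, nsmul_eq_mul, hcard,
    langTrotterConst]
  field_simp

theorem HardyLittlewoodConjecture.tracePrimeCount_isLittleO (hHL : HardyLittlewoodConjecture)
    {D r : ℤ} (hD : D ≠ 0) (hr : r ≠ 0) :
    (fun N : ℝ => (tracePrimeCount (curveE D) (2 * r) N : ℝ) -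
      langTrotterConst D r * (Real.sqrt N / Real.log N)) =o[atTop]
      (fun N : ℝ => Real.sqrt N / Real.log N) := by
  have h := IsLittleO.fun_sum (s := goodResidues D r) (l := atTop)
    (g' := fun N : ℝ => Real.sqrt N / Real.log N)
    (A := fun k (N : ℝ) => ((progressionPrimes (traceModulus D) k r N).ncard : ℝ) -
      hlConst ((traceModulus D : ℤ) ^ 2) (2 * traceModulus D * (k : ℕ))
      ((k : ℤ) ^ 2 + r ^ 2) * (Real.sqrt N / Real.log N)) ?_
  · refine h.congr_left fun N => ?_
    rw [Finset.sum_sub_distrib, ← Finset.sum_mul, sum_hlConst_goodResidues hD hr,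
      tracePrimeCount_eq_sum hD hr]
    push_cast; rfl
  · intro k hk
    have hadm := (mem_admissibleResidues.1 (Finset.mem_filter.1 hk).1).2
    have hcop := isCoprime_traceModulus hadm
    refine hHL.progressionPrimes_isLittleO hr (traceModulus_pos D) hcop fun h => ?_
    have h2 : (2 : ℤ) ∣ traceModulus D := (by decide : (2 : ℤ) ∣ 8).trans (eight_dvd_traceModulus D)
    have := hcop.isUnit_of_dvd' h2 h.2.two_dvd
    exact absurd this (by decide)

theorem HardyLittlewoodConjecture.primesQ_isLittleO (hHL : HardyLittlewoodConjecture)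
    {r : ℤ} (hr : r ≠ 0) :
    (fun N : ℝ => ((primesQ r N).ncard : ℝ) -
      hlConst 1 0 (r ^ 2) * (Real.sqrt N / Real.log N)) =o[atTop]
      (fun N : ℝ => Real.sqrt N / Real.log N) := by
  have h := hHL.progressionPrimes_isLittleO (M := 1) (k := 0) hr one_pos
    (by push_cast; exact isCoprime_one_left) (by norm_num)
  simpa [primesQ_eq] using h

theorem eventually_sqrt_div_log_ne_zero : ∀ᶠ N : ℝ in atTop, Real.sqrt N / Real.log N ≠ 0 := by
  filter_upwards [tendsto_sqrt_div_log.eventually_gt_atTop 0] with N hN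
  exact hN.ne'

theorem tendsto_div_of_isLittleO {f : ℝ → ℝ} {c : ℝ}
    (h : (fun N : ℝ => f N - c * (Real.sqrt N / Real.log N)) =o[atTop]
      (fun N : ℝ => Real.sqrt N / Real.log N)) :
    Tendsto (fun N => f N / (Real.sqrt N / Real.log N)) atTop (𝓝 c) := by
  have h1 := (h.tendsto_div_nhds_zero).add_const c
  rw [zero_add] at h1
  refine h1.congr' ?_
  filter_upwards [eventually_sqrt_div_log_ne_zero] with N hN
  rw [sub_div, mul_div_cancel_right₀ _ hN, sub_add_cancel]

theorem tracePrimes_finite_of_density_eq_zero {D r : ℤ} (hD : D ≠ 0) (hr : r ≠ 0)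
    (h : explicitDensity D r = 0) : (tracePrimes (curveE D) (2 * r)).Finite := by
  have h1 := card_goodResidues hD r
  rw [h, zero_mul, Nat.cast_eq_zero, Finset.card_eq_zero] at h1
  convert Set.finite_empty
  refine Set.eq_empty_of_forall_notMem fun p hp => ?_
  obtain ⟨x, _, hx⟩ := (mem_tracePrimes_iff hD hr hp.1).1 hp
  rw [h1] at hx
  exact Finset.notMem_empty _ hx

theorem langTrotterConst_eq_zero_iff {D r : ℤ} (hr : r ≠ 0) :
    langTrotterConst D r = 0 ↔ explicitDensity D r = 0 := by
  rw [langTrotterConst, mul_eq_zero, or_iff_right (hlConst_one_zero_sq_pos hr).ne',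
    Rat.cast_eq_zero]

theorem langTrotterConst_nonneg {D r : ℤ} (hD : D ≠ 0) (hr : r ≠ 0) : 0 ≤ langTrotterConst D r :=
  mul_nonneg (hlConst_one_zero_sq_pos hr).le (by exact_mod_cast explicitDensity_nonneg hD r)

theorem HardyLittlewoodConjecture.langTrotterAsymptotic (hHL : HardyLittlewoodConjecture)
    {D r : ℤ} (hD : D ≠ 0) (hr : r ≠ 0) :
    LangTrotterAsymptotic (curveE D) (2 * r) (langTrotterConst D r) :=
  ⟨langTrotterConst_nonneg hD hr, hHL.tracePrimeCount_isLittleO hD hr, fun h =>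
    tracePrimes_finite_of_density_eq_zero hD hr ((langTrotterConst_eq_zero_iff hr).1 h)⟩

theorem langTrotterAsymptotic_of_odd (D : ℤ) {t : ℤ} (ht : Odd t) :
    LangTrotterAsymptotic (curveE D) t 0 := by
  have h := tracePrimes_of_odd D ht
  refine ⟨le_rfl, ?_, fun _ => by rw [h]; exact Set.finite_empty⟩
  have h0 : ∀ N, tracePrimeCount (curveE D) t N = 0 := fun N => by
    rw [tracePrimeCount, h]; simp
  simp only [h0, Nat.cast_zero, zero_mul, sub_zero]
  exact isLittleO_zero _ _

theorem HardyLittlewoodConjecture.tendsto_proportion (hHL : HardyLittlewoodConjecture)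
    {D r : ℤ} (hD : D ≠ 0) (hr : r ≠ 0) :
    Tendsto (fun N : ℝ => ((primesQ r N ∩ tracePrimes (curveE D) (2 * r)).ncard : ℝ) /
      ((primesQ r N).ncard : ℝ)) atTop (𝓝 (explicitDensity D r : ℝ)) := by
  have hpos := (hlConst_one_zero_sq_pos hr).ne'
  have h1 := tendsto_div_of_isLittleO (hHL.tracePrimeCount_isLittleO hD hr)
  have h2 := tendsto_div_of_isLittleO (hHL.primesQ_isLittleO hr)
  have h3 := h1.div h2 hpos
  rw [langTrotterConst, mul_div_cancel_left₀ _ hpos] at h3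
  refine h3.congr' ?_
  filter_upwards [eventually_sqrt_div_log_ne_zero] with N hN
  rw [Pi.div_apply, div_div_div_cancel_right₀ hN, primesQ_inter_tracePrimes hr]

/-- With a positive constant the number of primes up to `N` is unbounded, as `√N / log N` is. -/
theorem LangTrotterAsymptotic.infinite_tracePrimes {W : WeierstrassCurve ℤ} {t : ℤ} {C : ℝ}
    (hC : 0 < C) (h : LangTrotterAsymptotic W t C) : (tracePrimes W t).Infinite := by
  intro hfin
  have h1 := tendsto_div_of_isLittleO h.2.1
  have h2 : Tendsto (fun N => (tracePrimeCount W t N : ℝ) / (Real.sqrt N / Real.log N))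
      atTop (𝓝 0) := by
    refine squeeze_zero' ?_ ?_
      (Tendsto.const_div_atTop tendsto_sqrt_div_log ((tracePrimes W t).ncard : ℝ))
    · filter_upwards [tendsto_sqrt_div_log.eventually_gt_atTop 0] with N hN
      positivity
    · filter_upwards [tendsto_sqrt_div_log.eventually_gt_atTop 0] with N hN
      have hsub : {p : ℕ | p ∈ tracePrimes W t ∧ (p : ℝ) ≤ N} ⊆ tracePrimes W t :=
        fun p hp => hp.1
      refine div_le_div_of_nonneg_right ?_ hN.le
      exact_mod_cast Set.ncard_le_ncard hsub hfin
  exact hC.ne' (tendsto_nhds_unique h1 h2)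

theorem mainTheorem1 :
    (HardyLittlewoodConjecture →
      ∀ D : ℤ, D ≠ 0 →
        (∀ t : ℤ, t ≠ 0 → ∃ C : ℝ, LangTrotterAsymptotic (curveE D) t C) ∧
        ∀ r : ℤ, r ≠ 0 →
          Tendsto
            (fun N : ℝ => ((primesQ r N ∩ tracePrimes (curveE D) (2 * r)).ncard : ℝ) /
              ((primesQ r N).ncard : ℝ))
            atTop (𝓝 (explicitDensity D r : ℝ)) ∧
          LangTrotterAsymptotic (curveE D) (2 * r) (langTrotterConst D r) ∧
          (InVanishingTables D r → langTrotterConst D r = 0) ∧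
          (¬ InVanishingTables D r → 0 < langTrotterConst D r ∧
            (fun N : ℝ => (tracePrimeCount (curveE D) (2 * r) N : ℝ)) ~[atTop]
              (fun N : ℝ => langTrotterConst D r * (Real.sqrt N / Real.log N)))) ∧
    (∀ D r : ℤ, D ≠ 0 → r ≠ 0 → ∀ C : ℝ, 0 < C →
      LangTrotterAsymptotic (curveE D) (2 * r) C →
      {p : ℕ | p.Prime ∧ ∃ x : ℤ, (p : ℤ) = x ^ 2 + r ^ 2}.Infinite) := by
  refine ⟨fun hHL D hD => ⟨fun t ht => ?_, fun r hr => ⟨hHL.tendsto_proportion hD hr,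
    hHL.langTrotterAsymptotic hD hr, fun h => ?_, fun h => ?_⟩⟩, ?_⟩
  · rcases Int.even_or_odd' t with ⟨r, rfl | rfl⟩
    · exact ⟨_, hHL.langTrotterAsymptotic hD (by rintro rfl; exact ht (mul_zero 2))⟩
    · exact ⟨0, langTrotterAsymptotic_of_odd D ⟨r, rfl⟩⟩
  · exact (langTrotterConst_eq_zero_iff hr).2 ((explicitDensity_eq_zero_iff hD).2 h)
  · have hne : langTrotterConst D r ≠ 0 := fun h0 =>
      h ((explicitDensity_eq_zero_iff hD).1 ((langTrotterConst_eq_zero_iff hr).1 h0))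
    refine ⟨lt_of_le_of_ne (langTrotterConst_nonneg hD hr) hne.symm, ?_⟩
    exact (hHL.tracePrimeCount_isLittleO hD hr).trans_isBigO (isBigO_self_const_mul hne _ _)
  · intro D r hD hr C hC h
    refine (h.infinite_tracePrimes hC).mono fun p hp => ?_
    obtain ⟨x, hx⟩ := exists_eq_sq_add_sq_of_mem_tracePrimes hr hp
    exact ⟨hp.1, x, by rw [hx, add_comm]⟩
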